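/- Let $X$ be a path-connected double loop space, that is, a path-connected topological space that is weakly homotopy equivalent to $\Omega^2(Y,y)$ for some pointed space $(Y,y)$ (two spaces are weakly homotopy equivalent if some space $Z$ maps to both of them by weak homotopy equivalences). Let $x\in X$. Then the natural sequence of abelian groups $$0\longrightarrow \pi_2(X,x)\xrightarrow{\;h\;} H_2(X;\mathbf{Z})\xrightarrow{\;t\;} H_2(K(\pi_1X,1);\mathbf{Z})\longrightarrow 0$$ is split exact: $h$ is injective, $\operatorname{im} h=\ker t$, $t$ is surjective, and $t$ has a right inverse that is a group homomorphism. Here $h$ is the Hurewicz homomorphism and $t$ is induced by the $1$-truncation $X\to K(\pi_1X,1)$. This holds for either description of the $1$-truncation: (a) $K(\pi_1X,1)$ is the nerve of the fundamental groupoid $\Pi_1(X)$ and $t$ is induced by the canonical simplicial map $\operatorname{Sing}(X)\to N\Pi_1(X)$, which sends a singular simplex to the sequence of its vertices together with the homotopy classes of its edges; (b) $K(\pi_1X,1)$ is any path-connected space $K$ with $\pi_n(K)=0$ for all $n\ge 2$, and $t=H_2(\tau)$ for any continuous map $\tau\colon X\to K$ that induces an isomorphism on fundamental groups. -/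

import Mathlib

universe u v

namespace LoopHurewicz

open CategoryTheory Simplicial Opposite
open scoped unitInterval

noncomputable section

/-! ### Weak homotopy equivalences, double loop spaces, 1-truncations, split exactness -/

section Homotopy

variable {X : Type*} {Y : Type*} [TopologicalSpace X] [TopologicalSpace Y]

/-- The map induced on path components. -/
def zerothHomotopyMap (f : C(X, Y)) : ZerothHomotopy X → ZerothHomotopy Y :=
  Quotient.map f fun _ _ h => h.map f.continuous

/-- The map induced on `n`-th homotopy groups. -/
def homotopyGroupMap (n : ℕ) (f : C(X, Y)) (x : X) :
    HomotopyGroup.Pi n X x → HomotopyGroup.Pi n Y (f x) :=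
  Quotient.map (fun p => ⟨f.comp p.1, fun y hy => congrArg f (p.2 y hy)⟩)
    fun _ _ h => h.map fun H => H.compContinuousMap f

/-- A weak homotopy equivalence: a bijection on path components and on all homotopy groups at all
base points. -/
structure IsWeakHomotopyEquiv (f : C(X, Y)) : Prop where
  bijective_zeroth : Function.Bijective (zerothHomotopyMap f)
  bijective_pi : ∀ (n : ℕ) (x : X), 1 ≤ n → Function.Bijective (homotopyGroupMap n f x)

/-- A 1-truncation: a bijection on path components, an isomorphism on fundamental groups at all
base points, and a target without higher homotopy groups. For path-connected `X` such a map is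
the canonical map from `X` to a `K(π₁ X, 1)`. -/
structure IsOneTruncation (f : C(X, Y)) : Prop where
  bijective_zeroth : Function.Bijective (zerothHomotopyMap f)
  bijective_pi_one : ∀ x : X, Function.Bijective (homotopyGroupMap 1 f x)
  subsingleton_pi : ∀ (n : ℕ) (y : Y), 2 ≤ n → Subsingleton (HomotopyGroup.Pi n Y y)

end Homotopy

/-- Two spaces are weakly homotopy equivalent if some space maps to both of them by weak homotopy
equivalences. -/
def WeaklyHomotopyEquivalent (X : Type u) (Y : Type v) [TopologicalSpace X] [TopologicalSpace Y] :
    Prop :=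
  ∃ (Z : Type (max u v)) (_ : TopologicalSpace Z) (f : C(Z, X)) (g : C(Z, Y)),
    IsWeakHomotopyEquiv f ∧ IsWeakHomotopyEquiv g

/-- `X` is a double loop space: it is weakly homotopy equivalent to `Ω²(Y, y)` for some pointed
space `(Y, y)`. -/
def IsDoubleLoopSpace (X : Type u) [TopologicalSpace X] : Prop :=
  ∃ (Y : Type v) (_ : TopologicalSpace Y) (y : Y),
    WeaklyHomotopyEquivalent X (GenLoop (Fin 2) Y y)

/-- `0 → A → B → C → 0` (with maps `f` and `g`) is a split short exact sequence. -/
structure IsSplitShortExact {A B C : Type*} [AddCommGroup A] [AddCommGroup B] [AddCommGroup C]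
    (f : A →+ B) (g : B →+ C) : Prop where
  injective : Function.Injective f
  exact : Function.Exact f g
  surjective : Function.Surjective g
  split : ∃ s : C →+ B, g.comp s = AddMonoidHom.id C

/-! ### The 1-truncation on singular simplicial sets -/

instance simplyConnectedSpace_stdSimplex (n : ℕ) : SimplyConnectedSpace (stdSimplex ℝ (Fin (n + 1))) :=
  haveI := (convex_stdSimplex ℝ (Fin (n + 1))).contractibleSpace
    ⟨_, (stdSimplex.vertex (S := ℝ) (0 : Fin (n + 1))).2⟩
  SimplyConnectedSpace.ofContractible _

/-- The functor `[n] ⥤ Π₁(Δⁿ)` given by the vertices of the topological `n`-simplex; between two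
vertices there is exactly one homotopy class of paths, as `Δⁿ` is simply connected. -/
def vertexFunctor (n : ℕ) :
    Fin (n + 1) ⥤ FundamentalGroupoid (stdSimplex ℝ (Fin (n + 1))) where
  obj i := ⟨stdSimplex.vertex i⟩
  map {i j} _ :=
    Path.Homotopic.Quotient.mk
      (PathConnectedSpace.somePath (stdSimplex.vertex (S := ℝ) i) (stdSimplex.vertex (S := ℝ) j))
  map_id _ := Subsingleton.elim (α := Path.Homotopic.Quotient _ _) _ _
  map_comp _ _ := Subsingleton.elim (α := Path.Homotopic.Quotient _ _) _ _

theorem vertexFunctor_natural {m n : ℕ} (f : Fin (m + 1) →o Fin (n + 1)) :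
    vertexFunctor m ⋙ FundamentalGroupoid.map ⟨_, stdSimplex.continuous_map f⟩ =
      f.monotone.functor ⋙ vertexFunctor n := by
  refine CategoryTheory.Functor.ext (fun i => ?_) (fun _ _ _ => ?_)
  · exact congrArg FundamentalGroupoid.mk (stdSimplex.map_vertex f i)
  · exact Subsingleton.elim (α := Path.Homotopic.Quotient _ _) _ _

theorem toSSetObjEquiv_map (X : TopCat.{u}) {m n : SimplexCategoryᵒᵖ} (f : m ⟶ n)
    (s : (TopCat.toSSet.obj X).obj m) :
    X.toSSetObjEquiv n ((TopCat.toSSet.obj X).map f s) =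
      (X.toSSetObjEquiv m s).comp ⟨_, stdSimplex.continuous_map f.unop.toOrderHom⟩ := rfl

/-- The 1-truncation of a space `X` as a map of simplicial sets, from the singular simplicial set
of `X` to the nerve of its fundamental groupoid (for path-connected `X` this nerve is a
`K(π₁ X, 1)`). A singular simplex `s : Δⁿ → X` goes to the functor `[n] ⥤ Π₁(X)` with value
`s (eᵢ)` at `i` and with value at `i ≤ j` the class of the image under `s` of the edge from `eᵢ`
to `eⱼ`. -/
def truncation (X : Type u) [TopologicalSpace X] :
    TopCat.toSSet.obj (TopCat.of X) ⟶ nerve (FundamentalGroupoid X) where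
  app n := ↾fun s => vertexFunctor n.unop.len ⋙
    FundamentalGroupoid.map ((TopCat.of X).toSSetObjEquiv n s)
  naturality m n f := by
    ext s
    change vertexFunctor _ ⋙ FundamentalGroupoid.map ((TopCat.of X).toSSetObjEquiv n
      ((TopCat.toSSet.obj (TopCat.of X)).map f s)) = f.unop.toOrderHom.monotone.functor ⋙
        (vertexFunctor _ ⋙ FundamentalGroupoid.map ((TopCat.of X).toSSetObjEquiv m s))
    rw [toSSetObjEquiv_map, FundamentalGroupoid.map_comp, ← Functor.assoc, ← Functor.assoc]
    rw [vertexFunctor_natural]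

/-- The coefficient group `ℤ`. -/
abbrev integers : AddCommGrpCat.{u} := AddCommGrpCat.of (ULift.{u} ℤ)

/-- Second integral homology of a simplicial set. Singular homology of a space is, by definition,
the homology of its singular simplicial set. -/
abbrev H2 (S : SSet.{u}) : Type u := (S.homology integers.{u} 2 : AddCommGrpCat.{u})

/-- Second integral singular homology of a space. -/
abbrev singularH2 (X : Type u) [TopologicalSpace X] : Type u :=
  (((AlgebraicTopology.singularHomologyFunctor AddCommGrpCat.{u} 2).obj integers.{u}).obj
    (TopCat.of X) : AddCommGrpCat.{u})

variable {X : Type u} [TopologicalSpace X]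
/-! ### The Hurewicz homomorphism -/

/-- The affine simplex in the cube `I^N` with vertices `v 0, …, v m`. -/
def affineSimplex {N : Type*} {m : ℕ} (v : Fin (m + 1) → N → I) :
    C(stdSimplex ℝ (Fin (m + 1)), N → I) where
  toFun t j := ⟨∑ i, t i * v i j, 
    Finset.sum_nonneg fun i _ => mul_nonneg (t.2.1 i) (v i j).2.1, 
    (Finset.sum_le_sum fun i _ => mul_le_of_le_one_right (t.2.1 i) (v i j).2.2).trans
      t.2.2.le⟩
  continuous_toFun := by
    refine continuous_pi fun j => Continuous.subtype_mk ?_ _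
    refine continuous_finsetSum _ fun i _ => ?_
    exact ((continuous_apply i).comp continuous_subtype_val).mul continuous_const

theorem affineSimplex_comp_map {N : Type*} {m n : ℕ} (v : Fin (n + 1) → N → I)
    (f : Fin (m + 1) → Fin (n + 1)) :
    (affineSimplex v).comp ⟨_, stdSimplex.continuous_map f⟩ = affineSimplex (v ∘ f) := by
  ext t j
  simp only [affineSimplex, ContinuousMap.comp_apply, ContinuousMap.coe_mk, stdSimplex.map_coe,
    FunOnFinite.linearMap_apply_apply, Function.comp_apply, Finset.sum_mul]
  rw [← Finset.sum_fiberwise Finset.univ f (fun i => t i * (v (f i) j : ℝ))]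
  refine Finset.sum_congr rfl fun k _ => Finset.sum_congr rfl fun i hi => ?_
  rw [(Finset.mem_filter.1 hi).2]

/-- The singular simplex of `X` given by a continuous map `Δᵐ → X`. -/
def singularSimplex {m : ℕ} (g : C(stdSimplex ℝ (Fin (m + 1)), X)) :
    (TopCat.toSSet.obj (TopCat.of X)) _⦋m⦌ :=
  ((TopCat.of X).toSSetObjEquiv (op ⦋m⦌)).symm g

theorem δ_singularSimplex {m : ℕ} (g : C(stdSimplex ℝ (Fin (m + 2)), X)) (i : Fin (m + 2)) :
    (TopCat.toSSet.obj (TopCat.of X)).δ i (singularSimplex g) =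
      singularSimplex (g.comp ⟨_, stdSimplex.continuous_map i.succAbove⟩) := rfl


/-- The integral singular chain complex of `X`. -/
abbrev chains (X : Type u) [TopologicalSpace X] : ChainComplex AddCommGrpCat.{u} ℕ :=
  (TopCat.toSSet.obj (TopCat.of X)).chainComplex integers.{u}

/-- The generator of the singular `m`-chains of `X` given by the composite of the affine simplex
with vertices `v` and the map `K` from the cube to `X`. -/
def cubeSimplex {n m : ℕ} (K : C(Fin n → I, X)) (v : Fin (m + 1) → Fin n → I) :
    integers.{u} ⟶ (chains X).X m :=
  SSet.ιChainComplex _ (singularSimplex (K.comp (affineSimplex v)))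

/-- The singular 2-chain of a map from the square, which is cut along its diagonal into two
triangles. -/
def squareChain (F : C(Fin 2 → I, X)) : integers.{u} ⟶ (chains X).X 2 :=
  cubeSimplex F ![![0, 0], ![1, 0], ![1, 1]] - cubeSimplex F ![![0, 0], ![0, 1], ![1, 1]]

theorem cubeSimplex_d {n m : ℕ} (K : C(Fin n → I, X)) (v : Fin (m + 2) → Fin n → I) :
    cubeSimplex K v ≫ (chains X).d (m + 1) m =
      ∑ i : Fin (m + 2), (-1) ^ i.val • cubeSimplex K (v ∘ i.succAbove) := by
  simp only [cubeSimplex]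
  rw [SSet.ιChainComplex_d]
  refine Finset.sum_congr rfl fun i _ => ?_
  rw [δ_singularSimplex, ContinuousMap.comp_assoc, affineSimplex_comp_map]

theorem cubeSimplex_congr {n k m : ℕ} {K : C(Fin n → I, X)} {L : C(Fin k → I, X)}
    {v : Fin (m + 1) → Fin n → I} {w : Fin (m + 1) → Fin k → I}
    (h : ∀ t, K (affineSimplex v t) = L (affineSimplex w t)) :
    cubeSimplex K v = cubeSimplex L w := by
  have : K.comp (affineSimplex v) = L.comp (affineSimplex w) := ContinuousMap.ext h
  rw [cubeSimplex, this, cubeSimplex]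

theorem cubeSimplex_three_d {n : ℕ} (K : C(Fin n → I, X)) (a b c e : Fin n → I) :
    cubeSimplex K ![a, b, c, e] ≫ (chains X).d 3 2 =
      cubeSimplex K ![b, c, e] - cubeSimplex K ![a, c, e] + cubeSimplex K ![a, b, e]
        - cubeSimplex K ![a, b, c] := by
  rw [cubeSimplex_d, Fin.sum_univ_four]
  have h0 : (![a, b, c, e] ∘ (0 : Fin 4).succAbove) = ![b, c, e] := by ext i j; fin_cases i <;> rfl
  have h1 : (![a, b, c, e] ∘ (1 : Fin 4).succAbove) = ![a, c, e] := by ext i j; fin_cases i <;> rfl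
  have h2 : (![a, b, c, e] ∘ (2 : Fin 4).succAbove) = ![a, b, e] := by ext i j; fin_cases i <;> rfl
  have h3 : (![a, b, c, e] ∘ (3 : Fin 4).succAbove) = ![a, b, c] := by ext i j; fin_cases i <;> rfl
  rw [h0, h1, h2, h3]
  simp [pow_succ]
  abel

theorem cubeSimplex_two_d {n : ℕ} (K : C(Fin n → I, X)) (a b c : Fin n → I) :
    cubeSimplex K ![a, b, c] ≫ (chains X).d 2 1 =
      cubeSimplex K ![b, c] - cubeSimplex K ![a, c] + cubeSimplex K ![a, b] := by
  rw [cubeSimplex_d, Fin.sum_univ_three]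
  have h0 : (![a, b, c] ∘ (0 : Fin 3).succAbove) = ![b, c] := by ext i j; fin_cases i <;> rfl
  have h1 : (![a, b, c] ∘ (1 : Fin 3).succAbove) = ![a, c] := by ext i j; fin_cases i <;> rfl
  have h2 : (![a, b, c] ∘ (2 : Fin 3).succAbove) = ![a, b] := by ext i j; fin_cases i <;> rfl
  rw [h0, h1, h2]
  simp [pow_succ]
  abel

theorem squareChain_d {x : X} (f : GenLoop (Fin 2) X x) :
    squareChain f.1 ≫ (chains X).d 2 1 = 0 := by
  have e (v w : Fin 2 → Fin 2 → I) (hv : ∃ j, v 0 j = v 1 j ∧ (v 0 j = 0 ∨ v 0 j = 1))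
      (hw : ∃ j, w 0 j = w 1 j ∧ (w 0 j = 0 ∨ w 0 j = 1)) :
      cubeSimplex f.1 v = cubeSimplex f.1 w := by
    have key (v : Fin 2 → Fin 2 → I) (hv : ∃ j, v 0 j = v 1 j ∧ (v 0 j = 0 ∨ v 0 j = 1)) (t) :
        f.1 (affineSimplex v t) = x := by
      obtain ⟨j, h, h'⟩ := hv
      refine f.2 _ ⟨j, ?_⟩
      have ht : t.1 0 + t.1 1 = 1 := by simpa using t.2.2
      refine h'.imp (fun h' => Subtype.ext ?_) (fun h' => Subtype.ext ?_)
      · simp [affineSimplex, ← h, h']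
      · have h1 : v 1 j = 1 := h ▸ h'
        simp [affineSimplex, h', h1]
        exact ht
    exact cubeSimplex_congr fun t => (key v hv t).trans (key w hw t).symm
  rw [squareChain, Preadditive.sub_comp, cubeSimplex_two_d, cubeSimplex_two_d,
    e ![![1, 0], ![1, 1]] ![![0, 0], ![0, 1]] ⟨0, by simp⟩ ⟨0, by simp⟩,
    e ![![0, 1], ![1, 1]] ![![0, 0], ![1, 0]] ⟨1, by simp⟩ ⟨1, by simp⟩]
  abel

theorem squareChain_const (x : X) : squareChain (ContinuousMap.const (Fin 2 → I) x) = 0 :=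
  sub_eq_zero.2 (cubeSimplex_congr fun _ => rfl)

/-- The singular 3-chain of a map from the cube, which is cut into six tetrahedra along its main
diagonal. -/
def cubeChain (K : C(Fin 3 → I, X)) : integers.{u} ⟶ (chains X).X 3 :=
  cubeSimplex K ![![0, 0, 0], ![1, 0, 0], ![1, 1, 0], ![1, 1, 1]]
  - cubeSimplex K ![![0, 0, 0], ![0, 1, 0], ![1, 1, 0], ![1, 1, 1]]
  + cubeSimplex K ![![0, 0, 0], ![0, 1, 0], ![0, 1, 1], ![1, 1, 1]]
  - cubeSimplex K ![![0, 0, 0], ![0, 0, 1], ![0, 1, 1], ![1, 1, 1]]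
  + cubeSimplex K ![![0, 0, 0], ![0, 0, 1], ![1, 0, 1], ![1, 1, 1]]
  - cubeSimplex K ![![0, 0, 0], ![1, 0, 0], ![1, 0, 1], ![1, 1, 1]]

theorem cubeChain_d {x : X} (K : C(Fin 3 → I, X)) (B T L : C(Fin 2 → I, X))
    (hB : ∀ p, p 2 = 0 → K p = B ![p 0, p 1]) (hT : ∀ p, p 2 = 1 → K p = T ![p 0, p 1])
    (hL : ∀ p, p 0 = 0 → K p = L ![p 2, p 1])
    (h₀ : ∀ p, p 0 = 1 → K p = x) (h₁ : ∀ p, p 1 = 0 → K p = x) (h₂ : ∀ p, p 1 = 1 → K p = x) :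
    cubeChain K ≫ (chains X).d 3 2 = squareChain T - squareChain B + squareChain L := by
  have z (v : Fin 3 → Fin 3 → I) (j : Fin 3) (hv : ∀ i, v i j = 0) (t) :
      affineSimplex v t j = 0 := Subtype.ext (by simp [affineSimplex, hv])
  have o (v : Fin 3 → Fin 3 → I) (j : Fin 3) (hv : ∀ i, v i j = 1) (t) :
      affineSimplex v t j = 1 := Subtype.ext (by simp [affineSimplex, hv])
  have p (a b : Fin 3) (v : Fin 3 → Fin 3 → I) (w : Fin 3 → Fin 2 → I)
      (h : ∀ i, w i 0 = v i a ∧ w i 1 = v i b) (t) :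
      ![affineSimplex v t a, affineSimplex v t b] = affineSimplex w t := by
    ext j
    fin_cases j <;> simp [affineSimplex, h]
  have eB (v w) (hv : ∀ i, v i 2 = 0) (h : ∀ i, w i 0 = v i 0 ∧ w i 1 = v i 1) :
      cubeSimplex K v = cubeSimplex B w :=
    cubeSimplex_congr fun t => by rw [hB _ (z v 2 hv t), p 0 1 v w h]
  have eT (v w) (hv : ∀ i, v i 2 = 1) (h : ∀ i, w i 0 = v i 0 ∧ w i 1 = v i 1) :
      cubeSimplex K v = cubeSimplex T w :=
    cubeSimplex_congr fun t => by rw [hT _ (o v 2 hv t), p 0 1 v w h]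
  have eL (v w) (hv : ∀ i, v i 0 = 0) (h : ∀ i, w i 0 = v i 2 ∧ w i 1 = v i 1) :
      cubeSimplex K v = cubeSimplex L w :=
    cubeSimplex_congr fun t => by rw [hL _ (z v 0 hv t), p 2 1 v w h]
  have e₀ (v w : Fin 3 → Fin 3 → I) (hv : ∀ i, v i 0 = 1) (hw : ∀ i, w i 0 = 1) :
      cubeSimplex K v = cubeSimplex K w :=
    cubeSimplex_congr fun t => by rw [h₀ _ (o v 0 hv t), h₀ _ (o w 0 hw t)]
  have e₁ (v w : Fin 3 → Fin 3 → I) (hv : ∀ i, v i 1 = 0) (hw : ∀ i, w i 1 = 0) :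
      cubeSimplex K v = cubeSimplex K w :=
    cubeSimplex_congr fun t => by rw [h₁ _ (z v 1 hv t), h₁ _ (z w 1 hw t)]
  have e₂ (v w : Fin 3 → Fin 3 → I) (hv : ∀ i, v i 1 = 1) (hw : ∀ i, w i 1 = 1) :
      cubeSimplex K v = cubeSimplex K w :=
    cubeSimplex_congr fun t => by rw [h₂ _ (o v 1 hv t), h₂ _ (o w 1 hw t)]
  simp only [cubeChain, Preadditive.sub_comp, Preadditive.add_comp, cubeSimplex_three_d]
  rw [eB ![![0, 0, 0], ![1, 0, 0], ![1, 1, 0]] ![![0, 0], ![1, 0], ![1, 1]]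
      (by intro i; fin_cases i <;> rfl) (by intro i; fin_cases i <;> exact ⟨rfl, rfl⟩),
    eB ![![0, 0, 0], ![0, 1, 0], ![1, 1, 0]] ![![0, 0], ![0, 1], ![1, 1]]
      (by intro i; fin_cases i <;> rfl) (by intro i; fin_cases i <;> exact ⟨rfl, rfl⟩),
    eT ![![0, 0, 1], ![1, 0, 1], ![1, 1, 1]] ![![0, 0], ![1, 0], ![1, 1]]
      (by intro i; fin_cases i <;> rfl) (by intro i; fin_cases i <;> exact ⟨rfl, rfl⟩),
    eT ![![0, 0, 1], ![0, 1, 1], ![1, 1, 1]] ![![0, 0], ![0, 1], ![1, 1]]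
      (by intro i; fin_cases i <;> rfl) (by intro i; fin_cases i <;> exact ⟨rfl, rfl⟩),
    eL ![![0, 0, 0], ![0, 0, 1], ![0, 1, 1]] ![![0, 0], ![1, 0], ![1, 1]]
      (by intro i; fin_cases i <;> rfl) (by intro i; fin_cases i <;> exact ⟨rfl, rfl⟩),
    eL ![![0, 0, 0], ![0, 1, 0], ![0, 1, 1]] ![![0, 0], ![0, 1], ![1, 1]]
      (by intro i; fin_cases i <;> rfl) (by intro i; fin_cases i <;> exact ⟨rfl, rfl⟩),
    e₀ ![![1, 0, 0], ![1, 1, 0], ![1, 1, 1]] ![![1, 0, 0], ![1, 0, 1], ![1, 1, 1]]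
      (by intro i; fin_cases i <;> rfl) (by intro i; fin_cases i <;> rfl),
    e₁ ![![0, 0, 0], ![1, 0, 0], ![1, 0, 1]] ![![0, 0, 0], ![0, 0, 1], ![1, 0, 1]]
      (by intro i; fin_cases i <;> rfl) (by intro i; fin_cases i <;> rfl),
    e₂ ![![0, 1, 0], ![1, 1, 0], ![1, 1, 1]] ![![0, 1, 0], ![0, 1, 1], ![1, 1, 1]]
      (by intro i; fin_cases i <;> rfl) (by intro i; fin_cases i <;> rfl)]
  simp only [squareChain]
  abel

/-- The homology class of a 2-dimensional loop, as a map out of `ℤ`: the push-forward of the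
fundamental class of `(I², ∂I²)`. -/
def hurewiczClass {x : X} (f : GenLoop (Fin 2) X x) :
    integers.{u} ⟶ (chains X).homology 2 :=
  (chains X).liftCycles (squareChain f.1) 1 (ChainComplex.next_nat_succ 1) (squareChain_d f) ≫
    (chains X).homologyπ 2

theorem hurewiczClass_add {x : X} (f g h : GenLoop (Fin 2) X x)
    (c : integers.{u} ⟶ (chains X).X 3)
    (hc : squareChain f.1 = squareChain g.1 + squareChain h.1 + c ≫ (chains X).d 3 2) :
    hurewiczClass f = hurewiczClass g + hurewiczClass h := by
  have h0 := (chains X).liftCycles_homologyπ_eq_zero_of_boundary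
    (c ≫ (chains X).d 3 2) 1 (ChainComplex.next_nat_succ 1) c rfl
  have h1 : (chains X).liftCycles (squareChain f.1) 1 (ChainComplex.next_nat_succ 1)
        (squareChain_d f) =
      (chains X).liftCycles (squareChain g.1) 1 (ChainComplex.next_nat_succ 1) (squareChain_d g) +
      (chains X).liftCycles (squareChain h.1) 1 (ChainComplex.next_nat_succ 1) (squareChain_d h) +
      (chains X).liftCycles (c ≫ (chains X).d 3 2) 1 (ChainComplex.next_nat_succ 1)
        (by simp) := by
    rw [← cancel_mono ((chains X).iCycles 2)]
    simp only [Preadditive.add_comp, HomologicalComplex.liftCycles_i, hc]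
  rw [hurewiczClass, h1, Preadditive.add_comp, Preadditive.add_comp, h0, add_zero]
  rfl

theorem hurewiczClass_const (x : X) :
    hurewiczClass (GenLoop.const : GenLoop (Fin 2) X x) = 0 := by
  have := hurewiczClass_add (GenLoop.const : GenLoop (Fin 2) X x) GenLoop.const GenLoop.const 0
    (by simp [GenLoop.const, squareChain_const])
  simpa using this

theorem hurewiczClass_eq_of_homotopic {x : X} (f g : GenLoop (Fin 2) X x)
    (h : GenLoop.Homotopic f g) : hurewiczClass f = hurewiczClass g := by
  obtain ⟨H⟩ := h
  let K : C(Fin 3 → I, X) :=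
    H.toContinuousMap.comp ⟨fun p => (p 2, ![p 0, p 1]), by fun_prop⟩
  have hK (p : Fin 3 → I) (j : Fin 2) (hj : ![p 0, p 1] j = 0 ∨ ![p 0, p 1] j = 1) : K p = x :=
    (H.eq_fst (p 2) (x := ![p 0, p 1]) ⟨j, hj⟩).trans (f.2 _ ⟨j, hj⟩)
  have hd := cubeChain_d (x := x) K f.1 g.1 (ContinuousMap.const _ x)
    (fun p hp => by simp [K, hp]) (fun p hp => by simp [K, hp])
    (fun p hp => hK p 0 (.inl hp)) (fun p hp => hK p 0 (.inr hp))
    (fun p hp => hK p 1 (.inl hp)) (fun p hp => hK p 1 (.inr hp))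
  rw [squareChain_const, add_zero] at hd
  have := hurewiczClass_add g f GenLoop.const (cubeChain K)
    (by rw [hd]; simp [GenLoop.const, squareChain_const])
  rw [this, hurewiczClass_const, add_zero]

theorem transAt_left {x : X} (f g : GenLoop (Fin 2) X x) (a b s : I) (h : (a : ℝ) = s / 2) :
    GenLoop.transAt 0 f g ![a, b] = f ![s, b] := by
  change (if (a : ℝ) ≤ 1 / 2 then f (Function.update ![a, b] 0 (Set.projIcc 0 1 _ (2 * (a : ℝ))))
    else g _) = _
  rw [if_pos (by rw [h]; have := s.2.2; linarith), show 2 * (a : ℝ) = s by rw [h]; ring,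
    Set.projIcc_val]
  congr 1
  ext j
  fin_cases j <;> simp

theorem transAt_right {x : X} (f g : GenLoop (Fin 2) X x) (a b s : I) (h : (a : ℝ) = (1 + s) / 2)
    (h0 : ¬ (a : ℝ) ≤ 1 / 2) : GenLoop.transAt 0 f g ![a, b] = g ![s, b] := by
  change (if (a : ℝ) ≤ 1 / 2 then f _
    else g (Function.update ![a, b] 0 (Set.projIcc 0 1 _ (2 * (a : ℝ) - 1)))) = _
  rw [if_neg h0, show 2 * (a : ℝ) - 1 = s by rw [h]; ring, Set.projIcc_val]
  congr 1
  ext j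
  fin_cases j <;> simp

theorem hurewiczClass_transAt {x : X} (f g : GenLoop (Fin 2) X x) :
    hurewiczClass (GenLoop.transAt 0 f g) = hurewiczClass f + hurewiczClass g := by
  let φ : (Fin 3 → I) → I := fun p => ⟨(p 0 : ℝ) + p 2 * (1 - p 0) / 2, by
    have := (p 0).2.1; have := (p 0).2.2; have := (p 2).2.1; have := (p 2).2.2
    constructor <;> nlinarith⟩
  have hφ : Continuous φ := by
    refine Continuous.subtype_mk ?_ _
    fun_prop
  let K : C(Fin 3 → I, X) :=
    (GenLoop.transAt 0 f g).1.comp ⟨fun p => ![φ p, p 1], by fun_prop⟩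
  have hK (p : Fin 3 → I) (j : Fin 2) (hj : ![φ p, p 1] j = 0 ∨ ![φ p, p 1] j = 1) : K p = x :=
    (GenLoop.transAt 0 f g).2 _ ⟨j, hj⟩
  have hd := cubeChain_d (x := x) K (GenLoop.transAt 0 f g).1 g.1 f.1
    (fun p hp => by
      have : φ p = p 0 := Subtype.ext (by simp [φ, hp])
      simp [K, this])
    (fun p hp => by
      have hval : (φ p : ℝ) = (1 + p 0) / 2 := by simp [φ, hp]; ring
      by_cases h0 : (φ p : ℝ) ≤ 1 / 2
      · have hp0 : p 0 = 0 := Subtype.ext (le_antisymm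
          (by change (p 0 : ℝ) ≤ 0; linarith) (p 0).2.1)
        refine (transAt_left f g _ _ 1 (by simp [hval, hp0])).trans ?_
        exact (f.2 _ ⟨0, .inr rfl⟩).trans (g.2 _ ⟨0, .inl hp0⟩).symm
      · exact transAt_right f g _ _ (p 0) hval h0)
    (fun p hp => transAt_left f g _ _ (p 2) (by simp [φ, hp]))
    (fun p hp => hK p 0 (.inr (Subtype.ext (by simp [φ, hp]))))
    (fun p hp => hK p 1 (.inl hp)) (fun p hp => hK p 1 (.inr hp))
  refine hurewiczClass_add _ _ _ (- cubeChain K) ?_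
  rw [Preadditive.neg_comp, hd]
  abel

/-- The Hurewicz homomorphism `π₂(X, x) → H₂(X; ℤ)`. -/
def hurewicz (X : Type u) [TopologicalSpace X] (x : X) :
    Additive (HomotopyGroup.Pi 2 X x) →+ singularH2 X where
  toFun a := Quotient.lift (fun f : GenLoop (Fin 2) X x => (hurewiczClass f).hom ⟨1⟩)
    (fun f g h => by rw [hurewiczClass_eq_of_homotopic f g h]) a.toMul
  map_zero' := by
    change (hurewiczClass (GenLoop.const : GenLoop (Fin 2) X x)).hom ⟨1⟩ = 0
    rw [hurewiczClass_const]
    rfl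
  map_add' a b := by
    induction a using Additive.rec with | _ a
    induction b using Additive.rec with | _ b
    induction a using Quotient.inductionOn with | _ f
    induction b using Quotient.inductionOn with | _ g
    have hm : @HMul.hMul (HomotopyGroup.Pi 2 X x) (HomotopyGroup.Pi 2 X x) (HomotopyGroup.Pi 2 X x) _
        ⟦f⟧ ⟦g⟧ = ⟦GenLoop.transAt 0 g f⟧ :=
      HomotopyGroup.mul_spec
    refine (congrArg (Quotient.lift _ _) hm).trans ?_
    change (hurewiczClass (GenLoop.transAt 0 g f)).hom ⟨1⟩ =
      (hurewiczClass f).hom ⟨1⟩ + (hurewiczClass g).hom ⟨1⟩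
    rw [hurewiczClass_transAt, add_comm]
    rfl

/-! ### Maps on second homology -/

/-- The map induced on second singular homology by a continuous map. -/
def singularH2Map {X Y : Type u} [TopologicalSpace X] [TopologicalSpace Y] (f : C(X, Y)) :
    singularH2 X →+ singularH2 Y :=
  (((AlgebraicTopology.singularHomologyFunctor AddCommGrpCat.{u} 2).obj integers.{u}).map
    (TopCat.ofHom f)).hom

/-- The map `H₂(X) → H₂(K(π₁ X, 1))` induced by the 1-truncation, with the nerve of the
fundamental groupoid as the model of `K(π₁ X, 1)`. -/
def truncationH2 (X : Type u) [TopologicalSpace X] :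
    singularH2 X →+ H2 (nerve (FundamentalGroupoid X)) :=
  (SSet.homologyMap (truncation X) integers.{u} 2).hom

end

end LoopHurewicz

/-!
Exactness at `H₂(X)` and surjectivity of `t` hold for every path-connected space (a theorem of
Hopf). The truncation is bijective on vertices and surjective on edges, and a triangle of the
nerve is determined by its edges and lifts to a singular triangle over any lifts of them
(`isTruncating_truncation`). In the chains modulo boundaries and spheres the class of a singular
triangle only depends on its edges, and these classes satisfy the cocycle condition; both facts
follow from the Kan condition in dimension three (`ContainsSpheres.class_eq`,
`ContainsSpheres.class_add_class_of_isTriangle`). Hence chosen lifts of triangles induce a map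
from the chains of the nerve which inverts the truncation modulo boundaries and spheres
(`exact_hurewicz`, `truncationH2_surjective`).

The main point is a left inverse of the Hurewicz homomorphism, which also provides the splitting
(`isSplitShortExact_of_leftInverse`). Points, paths and homotopy classes of path homotopies form a
bicategory `PathBicat X`. A framing joins each point to a base point, chooses a loop for each
element of `π₁`, and compares each path with the chosen loop in its class. It assigns to a
singular triangle an element of `π₂`, its value. The value detects 2-dimensional loops
(`rhoHom_squareElt`). If `π₁` acts trivially on `π₂`, then the values on the faces of a
tetrahedron add up to the associativity defect of the chosen loops (`Framing.value_add_value`),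
which is a 3-cocycle `k` on `π₁` with values in `π₂`. If `k` is the coboundary of a cochain `m`,
then the values corrected by `m` form a cocycle on `X`, which is the left inverse
(`exists_retraction`).

So it remains to show that `k` is a coboundary for a double loop space. The two concatenations on
`Ω²Y` give a multiplication `μ` that is homotopic to its opposite (Eckmann–Hilton,
`isHopf_concat`). The value `c(a, b)` on the square `(s, t) ↦ μ(γ_a(s), γ_b(t))` is a symmetry of
`k`: cutting a prism into tetrahedra gives the hexagon relation, and cutting the cube of a
homotopy from `μ` to its opposite gives `c(a, b) + c(b, a) = 0` (`IsHopf.isSymmetricCocycle`). A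
3-cocycle with such a symmetry is a coboundary (`IsSymmetricCocycle.exists_coboundary`). After a
change of `c` by a biadditive map one may assume `c(a, a) = 0`; then a trivialization of the pair
`(k, c)` over a subgroup of `π₁` extends to one more element, and Zorn's lemma applies. Finally
chosen loops, and with them `k` and `m`, are pushed forward along continuous maps, so the
statement is transported from `Ω²Y` to a weakly equivalent space through the common source of the
equivalences (`exists_framing`).

For another model `τ : X → K` of the truncation, the functor `Π₁(τ)` is an equivalence of
groupoids, which induces an isomorphism on the homology of nerves (`nerveH2Map_bijective`), and
the truncation of `K` is an isomorphism on second homology by the Hopf sequence of `K`, because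
`π₂(K) = 0` (`truncationH2_bijective`). By naturality the case of the nerve implies that of `τ`
(`exists_addEquiv_singularH2Map`).
-/

namespace LoopHurewicz

open CategoryTheory Simplicial Opposite
open scoped unitInterval

noncomputable section

/-! ### Canonical 2-cells: homotopies of paths that lift to a convex domain -/

/-- A continuous choice of segments, with constant segments between equal points. Convex subsets of
topological vector spaces are the examples. -/
class SegmentSpace (D : Type*) [TopologicalSpace D] where
  /-- The point of parameter `s` on the segment from `x` to `y`. -/
  seg : I → D → D → D
  continuous_seg : Continuous fun a : I × D × D => seg a.1 a.2.1 a.2.2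
  seg_zero : ∀ x y, seg 0 x y = x
  seg_one : ∀ x y, seg 1 x y = y
  seg_self : ∀ s x, seg s x x = x

namespace SegmentSpace

theorem continuous_seg' {D P : Type*} [TopologicalSpace D] [TopologicalSpace P] [SegmentSpace D]
    {s : P → I} {x y : P → D} (hs : Continuous s) (hx : Continuous x) (hy : Continuous y) :
    Continuous fun p => seg (s p) (x p) (y p) :=
  continuous_seg.comp (hs.prodMk (hx.prodMk hy))

instance : SegmentSpace I where
  seg s x y := ⟨(1 - s) * x + s * y, (convex_Icc (0 : ℝ) 1) x.2 y.2
    (sub_nonneg.2 s.2.2) s.2.1 (by ring)⟩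
  continuous_seg := by fun_prop
  seg_zero x y := Subtype.ext (by simp)
  seg_one x y := Subtype.ext (by simp)
  seg_self s x := Subtype.ext (by simp only; ring)

instance {ι : Type*} {D : ι → Type*} [∀ i, TopologicalSpace (D i)] [∀ i, SegmentSpace (D i)] :
    SegmentSpace (∀ i, D i) where
  seg s x y i := seg s (x i) (y i)
  continuous_seg := continuous_pi fun i => continuous_seg' (by fun_prop) (by fun_prop) (by fun_prop)
  seg_zero x y := funext fun _ => seg_zero _ _
  seg_one x y := funext fun _ => seg_one _ _
  seg_self s x := funext fun _ => seg_self _ _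

instance {n : ℕ} : SegmentSpace (stdSimplex ℝ (Fin n)) where
  seg s x y := ⟨fun i => (1 - s) * x i + s * y i, (convex_stdSimplex ℝ (Fin n)) x.2 y.2
    (sub_nonneg.2 s.2.2) s.2.1 (by ring)⟩
  continuous_seg := by
    refine Continuous.subtype_mk (continuous_pi fun i => ?_) _
    have h (f : I × stdSimplex ℝ (Fin n) × stdSimplex ℝ (Fin n) → stdSimplex ℝ (Fin n))
        (hf : Continuous f) : Continuous fun a => (f a) i :=
      (continuous_apply i).comp (continuous_subtype_val.comp hf)
    have h1 := h (fun a => a.2.1) (by fun_prop)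
    have h2 := h (fun a => a.2.2) (by fun_prop)
    fun_prop
  seg_zero x y := Subtype.ext (by ext i; simp; rfl)
  seg_one x y := Subtype.ext (by ext i; simp; rfl)
  seg_self s x := Subtype.ext (by ext i; change (1 - (s : ℝ)) * x i + s * x i = x i; ring)

/-- The segment between two points, as a path. -/
def segPath {D : Type*} [TopologicalSpace D] [SegmentSpace D] (x y : D) : Path x y where
  toFun s := seg s x y
  continuous_toFun := continuous_seg' (by fun_prop) (by fun_prop) (by fun_prop)
  source' := seg_zero _ _
  target' := seg_one _ _

end SegmentSpace

open SegmentSpace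

/-- The straight line between two paths with the same end points. -/
def segPaths {D : Type*} [TopologicalSpace D] [SegmentSpace D] {a b : D} (p q : Path a b) :
    Path p q where
  toFun s :=
    { toFun := fun t => seg s (p t) (q t)
      continuous_toFun := continuous_seg' (by fun_prop) (by fun_prop) (by fun_prop)
      source' := by simp [seg_self]
      target' := by simp [seg_self] }
  continuous_toFun := Path.continuous_uncurry_iff.1
    (continuous_seg' (by fun_prop) (by fun_prop) (by fun_prop))
  source' := by ext t; exact seg_zero _ _
  target' := by ext t; exact seg_one _ _

section Can

variable {D : Type*} [TopologicalSpace D] {X : Type*} [TopologicalSpace X]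

/-- The map on path spaces induced by `f`, with adjusted end points. -/
def mapPaths (f : C(D, X)) {a b : D} {x y : X} (hx : x = f a) (hy : y = f b) :
    C(Path a b, Path x y) where
  toFun p := (p.map f.continuous).cast hx hy
  continuous_toFun := Path.continuous_uncurry_iff.1 (by
    change Continuous fun z : Path a b × I => f (z.1 z.2)
    fun_prop)

/-- The fundamental groupoid of the space of paths from `x` to `y`. -/
abbrev PathGpd (x y : X) := FundamentalGroupoid (Path x y)

/-- `LiftsTo f p' p` says that `p` is the image under `f` of the path `p'`. -/
def LiftsTo (f : C(D, X)) {a b : D} {x y : X} (p' : Path a b) (p : Path x y) : Prop :=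
  ∀ t, f (p' t) = p t

theorem LiftsTo.source {f : C(D, X)} {a b : D} {x y : X} {p' : Path a b} {p : Path x y}
    (h : LiftsTo f p' p) : x = f a := by simpa using (h 0).symm

theorem LiftsTo.target {f : C(D, X)} {a b : D} {x y : X} {p' : Path a b} {p : Path x y}
    (h : LiftsTo f p' p) : y = f b := by simpa using (h 1).symm

theorem LiftsTo.mapPaths_eq {f : C(D, X)} {a b : D} {x y : X} {p' : Path a b} {p : Path x y}
    (h : LiftsTo f p' p) : p = mapPaths f h.source h.target p' := by
  ext t; exact (h t).symm

theorem LiftsTo.trans {f : C(D, X)} {a b c : D} {x y z : X} {p' : Path a b} {p : Path x y}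
    {q' : Path b c} {q : Path y z} (h : LiftsTo f p' p) (h' : LiftsTo f q' q) :
    LiftsTo f (p'.trans q') (p.trans q) := by
  intro t
  rw [Path.trans_apply, Path.trans_apply]
  split_ifs
  · exact h _
  · exact h' _

theorem LiftsTo.refl {f : C(D, X)} {a : D} {x : X} (h : f a = x) :
    LiftsTo f (Path.refl a) (Path.refl x) := fun _ => h

variable [SegmentSpace D]

/-- The canonical 2-cell between two paths that lift, with the same end points, along a map from a
space with segments: the image of the straight line between the lifts. -/
def can (f : C(D, X)) {a b : D} {x y : X} {p' q' : Path a b} {p q : Path x y}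
    (hp : LiftsTo f p' p) (hq : LiftsTo f q' q) :
    FundamentalGroupoid.mk p ⟶ FundamentalGroupoid.mk q :=
  Path.Homotopic.Quotient.mk
    (((segPaths p' q').map (mapPaths f hp.source hp.target).continuous).cast
      hp.mapPaths_eq hq.mapPaths_eq)

/-- Any path of paths that lifts represents the canonical 2-cell. -/
theorem mk_eq_can (f : C(D, X)) {a b : D} {x y : X} {p' q' : Path a b} {p q : Path x y}
    (hp : LiftsTo f p' p) (hq : LiftsTo f q' q) (Γ' : Path p' q') (Γ : Path p q)
    (h : ∀ s t, f (Γ' s t) = Γ s t) :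
    (Path.Homotopic.Quotient.mk Γ : FundamentalGroupoid.mk p ⟶ FundamentalGroupoid.mk q) =
      can f hp hq := by
  refine Path.Homotopic.Quotient.eq.2 ?_
  have e : Γ = ((Γ'.map (mapPaths f hp.source hp.target).continuous).cast
      hp.mapPaths_eq hq.mapPaths_eq) := by
    ext s t; exact (h s t).symm
  rw [e]
  let H : Path.Homotopy Γ' (segPaths p' q') :=
    { toFun := fun z => segPaths (Γ' z.2) (segPaths p' q' z.2) z.1
      continuous_toFun := Path.continuous_uncurry_iff.1 (by
        change Continuous fun z : (I × I) × I =>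
          seg z.1.1 (Γ' z.1.2 z.2) (segPaths p' q' z.1.2 z.2)
        exact continuous_seg' (by fun_prop) (by fun_prop) (by fun_prop))
      map_zero_left := fun s => by simp
      map_one_left := fun s => by simp
      prop' := by
        rintro s _ (rfl | rfl)
        · ext r; change seg s (Γ' 0 r) (segPaths p' q' 0 r) = Γ' 0 r; simp [seg_self]
        · ext r; change seg s (Γ' 1 r) (segPaths p' q' 1 r) = Γ' 1 r; simp [seg_self] }
  exact ⟨(H.map (mapPaths f hp.source hp.target)).pathCast hp.mapPaths_eq hq.mapPaths_eq⟩

theorem can_self (f : C(D, X)) {a b : D} {x y : X} {p' : Path a b} {p : Path x y}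
    (hp : LiftsTo f p' p) : can f hp hp = 𝟙 _ :=
  (mk_eq_can f hp hp (Path.refl p') (Path.refl p) fun _ t => hp t).symm

theorem can_comp_can (f : C(D, X)) {a b : D} {x y : X} {p' q' r' : Path a b} {p q r : Path x y}
    (hp : LiftsTo f p' p) (hq : LiftsTo f q' q) (hr : LiftsTo f r' r) :
    can f hp hq ≫ can f hq hr = can f hp hr := by
  refine mk_eq_can f hp hr ((segPaths p' q').trans (segPaths q' r')) (Path.trans _ _) fun s t => ?_
  rw [Path.trans_apply, Path.trans_apply]
  split_ifs <;> rfl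

/-- Canonical 2-cells do not change when the map `f` is factored through another space with
segments. -/
theorem can_restrict {D' : Type*} [TopologicalSpace D'] [SegmentSpace D'] (f : C(D, X))
    (f' : C(D', X)) (g : C(D, D')) (hg : ∀ d, f' (g d) = f d) {a b : D} {a' b' : D'} {x y : X}
    {p' q' : Path a b} {p'' q'' : Path a' b'} {p q : Path x y}
    (hp : LiftsTo f p' p) (hq : LiftsTo f q' q) (hp' : LiftsTo f' p'' p) (hq' : LiftsTo f' q'' q)
    (hgp : LiftsTo g p' p'') (hgq : LiftsTo g q' q'') :
    can f hp hq = can f' hp' hq' :=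
  mk_eq_can f' hp' hq' (((segPaths p' q').map (mapPaths g hgp.source hgp.target).continuous).cast
    hgp.mapPaths_eq hgq.mapPaths_eq) _ fun _ _ => hg _

/-- The functor on path groupoids induced by a continuous map. -/
def mapGpd {X Y : Type*} [TopologicalSpace X] [TopologicalSpace Y] (f : C(X, Y)) {x y : X} :
    PathGpd x y ⥤ PathGpd (f x) (f y) :=
  FundamentalGroupoid.map
    ⟨fun p : Path x y => p.map f.continuous, Path.continuous_uncurry_iff.1 (by
      change Continuous fun z : Path x y × I => f (z.1 z.2)
      fun_prop)⟩

theorem mapGpd_can {Y : Type*} [TopologicalSpace Y] (g : C(X, Y))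
    (f : C(D, X)) {a b : D} {x y : X} {p' q' : Path a b} {p q : Path x y}
    (hp : LiftsTo f p' p) (hq : LiftsTo f q' q) :
    (mapGpd g).map (can f hp hq) = can (g.comp f) (p := p.map g.continuous)
      (q := q.map g.continuous) (fun t => congrArg g (hp t)) (fun t => congrArg g (hq t)) :=
  mk_eq_can (g.comp f) _ _ (segPaths p' q') _ fun _ _ => rfl

end Can

/-! ### The bicategory of points, paths, and homotopy classes of path homotopies -/

section Structure

variable {X : Type*} [TopologicalSpace X]

/-- The first half of the unit interval. -/
def firstHalf : C(I, I) := ⟨fun t => ⟨t / 2, by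
  have := t.2.1; have := t.2.2; constructor <;> linarith⟩, by fun_prop⟩

/-- The second half of the unit interval. -/
def secondHalf : C(I, I) := ⟨fun t => ⟨(1 + t) / 2, by
  have := t.2.1; have := t.2.2; constructor <;> linarith⟩, by fun_prop⟩

theorem firstHalf_zero : firstHalf 0 = 0 := Subtype.ext (by simp [firstHalf])

theorem firstHalf_one : firstHalf 1 = secondHalf 0 :=
  Subtype.ext (by simp [firstHalf, secondHalf])

theorem trans_firstHalf {x y z : X} (p : Path x y) (q : Path y z) (t : I) :
    p.trans q (firstHalf t) = p t := by
  rw [Path.trans_apply, dif_pos (by have := t.2.2; simp only [firstHalf]; simp; linarith)]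
  congr 1
  exact Subtype.ext (by simp [firstHalf]; ring)

theorem trans_secondHalf {x y z : X} (p : Path x y) (q : Path y z) (t : I) :
    p.trans q (secondHalf t) = q t := by
  rw [Path.trans_apply]
  split_ifs with h
  · have h0 : t = 0 := Subtype.ext (le_antisymm (by
      have : ((secondHalf t : I) : ℝ) = (1 + t) / 2 := rfl
      rw [this] at h; simp; linarith) t.2.1)
    subst h0
    rw [Path.source]
    convert p.target using 2
    exact Subtype.ext (by simp [secondHalf])
  · congr 1
    exact Subtype.ext (by simp [secondHalf]; ring)

theorem exists_lift_one {x y : X} (p : Path x y) :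
    ∃ (f : C(I, X)) (p' : Path (0 : I) 1), LiftsTo f p' p :=
  ⟨p.toContinuousMap, Path.id, fun _ => rfl⟩

/-- A path can be put in front of a map from the unit interval. -/
theorem exists_lift_cons {x y : X} (p : Path x y) (f : C(I, X)) (h0 : f 0 = y) :
    ∃ (g : C(I, X)) (r : C(I, I)) (p' : Path (0 : I) (r 0)), g 0 = x ∧ LiftsTo g p' p ∧
      ∀ t, g (r t) = f t := by
  let q : Path y (f 1) := ⟨f, h0, rfl⟩
  exact ⟨(p.trans q).toContinuousMap, secondHalf,
    ⟨firstHalf, firstHalf_zero, firstHalf_one⟩, (p.trans q).source,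
    trans_firstHalf p q, trans_secondHalf p q⟩

theorem exists_lift_two {x y z : X} (p : Path x y) (q : Path y z) :
    ∃ (f : C(I, X)) (b c : I) (p' : Path 0 b) (q' : Path b c), f 0 = x ∧
      LiftsTo f p' p ∧ LiftsTo f q' q := by
  obtain ⟨g, r, p', h0, hp, hr⟩ := exists_lift_cons p q.toContinuousMap q.source
  exact ⟨g, r 0, r 1, p', Path.id.map r.continuous, h0, hp, hr⟩

theorem exists_lift_three {x y z w : X} (p : Path x y) (q : Path y z) (s : Path z w) :
    ∃ (f : C(I, X)) (b c d : I) (p' : Path 0 b) (q' : Path b c) (s' : Path c d), f 0 = x ∧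
      LiftsTo f p' p ∧ LiftsTo f q' q ∧ LiftsTo f s' s := by
  obtain ⟨f, b, c, q', s', h, hq, hs⟩ := exists_lift_two q s
  obtain ⟨g, r, p', h0, hp, hr⟩ := exists_lift_cons p f h
  exact ⟨g, r 0, r b, r c, p', q'.map r.continuous, s'.map r.continuous, h0, hp,
    fun t => (hr _).trans (hq t), fun t => (hr _).trans (hs t)⟩

/-- Composable paths lift to successive paths in the unit interval along one map. Hence all
structural 2-cells between their composites are canonical, which proves the coherence laws. -/
theorem exists_lift_four {x y z w v : X} (p : Path x y) (q : Path y z) (s : Path z w)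
    (u : Path w v) :
    ∃ (f : C(I, X)) (b c d e : I) (p' : Path 0 b) (q' : Path b c) (s' : Path c d)
      (u' : Path d e), LiftsTo f p' p ∧ LiftsTo f q' q ∧ LiftsTo f s' s ∧ LiftsTo f u' u := by
  obtain ⟨f, b, c, d, q', s', u', h, hq, hs, hu⟩ := exists_lift_three q s u
  obtain ⟨g, r, p', h0, hp, hr⟩ := exists_lift_cons p f h
  exact ⟨g, r 0, r b, r c, r d, p', q'.map r.continuous, s'.map r.continuous,
    u'.map r.continuous, hp, fun t => (hr _).trans (hq t), fun t => (hr _).trans (hs t),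
    fun t => (hr _).trans (hu t)⟩

/-- The reparametrization of the unit interval that turns `p.trans (q.trans r)` into
`(p.trans q).trans r`. -/
def assocPath : Path (0 : I) 1 where
  toFun t := ⟨Path.Homotopy.transAssocReparamAux t, Path.Homotopy.transAssocReparamAux_mem_I t⟩
  continuous_toFun := by fun_prop
  source' := Subtype.ext Path.Homotopy.transAssocReparamAux_zero
  target' := Subtype.ext Path.Homotopy.transAssocReparamAux_one

/-- The reparametrization of the unit interval that turns `p` into `p.trans (refl _)`. -/
def rightUnitPath : Path (0 : I) 1 where
  toFun t := ⟨Path.Homotopy.transReflReparamAux t, Path.Homotopy.transReflReparamAux_mem_I t⟩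
  continuous_toFun := by fun_prop
  source' := Subtype.ext Path.Homotopy.transReflReparamAux_zero
  target' := Subtype.ext Path.Homotopy.transReflReparamAux_one

/-- The reparametrization of the unit interval that turns `p` into `(refl _).trans p`. -/
def leftUnitPath : Path (0 : I) 1 where
  toFun t := σ (rightUnitPath (σ t))
  continuous_toFun := by fun_prop
  source' := by simp
  target' := by simp

theorem assocPath_spec {x y z w : X} (p : Path x y) (q : Path y z) (r : Path z w) :
    LiftsTo (p.trans (q.trans r)).toContinuousMap assocPath ((p.trans q).trans r) := by
  intro t
  rw [Path.Homotopy.trans_assoc_reparam]; rfl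

theorem rightUnitPath_spec {x y : X} (p : Path x y) :
    LiftsTo p.toContinuousMap rightUnitPath (p.trans (Path.refl y)) := by
  intro t
  rw [Path.Homotopy.trans_refl_reparam]; rfl

theorem leftUnitPath_spec {x y : X} (p : Path x y) :
    LiftsTo p.toContinuousMap leftUnitPath ((Path.refl x).trans p) := by
  intro t
  have h := rightUnitPath_spec p.symm (σ t)
  have e : (Path.refl x).trans p t = (p.symm.trans (Path.refl x)) (σ t) := by
    change _ = (p.symm.trans (Path.refl x)).symm t
    rw [Path.trans_symm, Path.symm_symm, Path.refl_symm]
  rw [e, ← h]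
  rfl

theorem liftsTo_id {x y : X} (p : Path x y) : LiftsTo p.toContinuousMap Path.id p := fun _ => rfl

/-- The associator as an isomorphism in the path groupoid. -/
def assocIso {x y z w : X} (p : Path x y) (q : Path y z) (r : Path z w) :
    (FundamentalGroupoid.mk ((p.trans q).trans r) : PathGpd x w) ≅
      FundamentalGroupoid.mk (p.trans (q.trans r)) where
  hom := can (p.trans (q.trans r)).toContinuousMap (assocPath_spec p q r) (liftsTo_id _)
  inv := can (p.trans (q.trans r)).toContinuousMap (liftsTo_id _) (assocPath_spec p q r)
  hom_inv_id := by rw [can_comp_can, can_self]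
  inv_hom_id := by rw [can_comp_can, can_self]

/-- The left unitor as an isomorphism in the path groupoid. -/
def leftUnitIso {x y : X} (p : Path x y) :
    (FundamentalGroupoid.mk ((Path.refl x).trans p) : PathGpd x y) ≅ FundamentalGroupoid.mk p where
  hom := can p.toContinuousMap (leftUnitPath_spec p) (liftsTo_id _)
  inv := can p.toContinuousMap (liftsTo_id _) (leftUnitPath_spec p)
  hom_inv_id := by rw [can_comp_can, can_self]
  inv_hom_id := by rw [can_comp_can, can_self]

/-- The right unitor as an isomorphism in the path groupoid. -/
def rightUnitIso {x y : X} (p : Path x y) :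
    (FundamentalGroupoid.mk (p.trans (Path.refl y)) : PathGpd x y) ≅ FundamentalGroupoid.mk p where
  hom := can p.toContinuousMap (rightUnitPath_spec p) (liftsTo_id _)
  inv := can p.toContinuousMap (liftsTo_id _) (rightUnitPath_spec p)
  hom_inv_id := by rw [can_comp_can, can_self]
  inv_hom_id := by rw [can_comp_can, can_self]

/-- Left whiskering with a path. -/
def whiskerL {x y z : X} (p : Path x y) : PathGpd y z ⥤ PathGpd x z :=
  FundamentalGroupoid.map ⟨fun q => p.trans q, by fun_prop⟩

/-- Right whiskering with a path. -/
def whiskerR {x y z : X} (q : Path y z) : PathGpd x y ⥤ PathGpd x z :=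
  FundamentalGroupoid.map ⟨fun p => p.trans q, by fun_prop⟩

section

variable {D : Type*} [TopologicalSpace D] [SegmentSpace D] (f : C(D, X)) {a b c d : D}
  {x y z w : X}

theorem whiskerL_can {u' : Path a b} {u : Path x y} {p' q' : Path b c} {p q : Path y z}
    (hu : LiftsTo f u' u) (hp : LiftsTo f p' p) (hq : LiftsTo f q' q) :
    (whiskerL u).map (can f hp hq) = can f (hu.trans hp) (hu.trans hq) :=
  mk_eq_can f _ _ ((segPaths p' q').map (f := fun q => u'.trans q) (by fun_prop)) _
    fun s => hu.trans (p' := u') (q' := segPaths p' q' s)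
      (q := ((segPaths p' q').map (mapPaths f hp.source hp.target).continuous).cast
        hp.mapPaths_eq hq.mapPaths_eq s) fun _ => rfl

theorem whiskerR_can {u' : Path b c} {u : Path y z} {p' q' : Path a b} {p q : Path x y}
    (hp : LiftsTo f p' p) (hq : LiftsTo f q' q) (hu : LiftsTo f u' u) :
    (whiskerR u).map (can f hp hq) = can f (hp.trans hu) (hq.trans hu) :=
  mk_eq_can f _ _ ((segPaths p' q').map (f := fun q => q.trans u') (by fun_prop)) _
    fun s => LiftsTo.trans (p' := segPaths p' q' s) (q' := u')
      (p := ((segPaths p' q').map (mapPaths f hp.source hp.target).continuous).cast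
        hp.mapPaths_eq hq.mapPaths_eq s) (fun _ => rfl) hu

theorem assocIso_hom_eq {p' : Path a b} {p : Path x y} {q' : Path b c} {q : Path y z}
    {r' : Path c d} {r : Path z w}
    (hp : LiftsTo f p' p) (hq : LiftsTo f q' q) (hr : LiftsTo f r' r) :
    (assocIso p q r).hom = can f ((hp.trans hq).trans hr) (hp.trans (hq.trans hr)) :=
  can_restrict _ f (p'.trans (q'.trans r')).toContinuousMap (hp.trans (hq.trans hr))
    (assocPath_spec p q r) (liftsTo_id _) ((hp.trans hq).trans hr) (hp.trans (hq.trans hr))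
    (assocPath_spec p' q' r') (liftsTo_id _)

theorem leftUnitIso_hom_eq {p' : Path a b} {p : Path x y} (hp : LiftsTo f p' p)
    (h0 : LiftsTo f (Path.refl a) (Path.refl x)) :
    (leftUnitIso p).hom = can f (h0.trans hp) hp :=
  can_restrict _ f p'.toContinuousMap hp (leftUnitPath_spec p) (liftsTo_id _) (h0.trans hp) hp
    (leftUnitPath_spec p') (liftsTo_id _)

theorem rightUnitIso_hom_eq {p' : Path a b} {p : Path x y} (hp : LiftsTo f p' p)
    (h1 : LiftsTo f (Path.refl b) (Path.refl y)) :
    (rightUnitIso p).hom = can f (hp.trans h1) hp :=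
  can_restrict _ f p'.toContinuousMap hp (rightUnitPath_spec p) (liftsTo_id _) (hp.trans h1) hp
    (rightUnitPath_spec p') (liftsTo_id _)

end

theorem pentagon_path {x y z w v : X} (p : Path x y) (q : Path y z) (r : Path z w) (s : Path w v) :
    (whiskerR s).map (assocIso p q r).hom ≫ (assocIso p (q.trans r) s).hom ≫
      (whiskerL p).map (assocIso q r s).hom =
      (assocIso (p.trans q) r s).hom ≫ (assocIso p q (r.trans s)).hom := by
  obtain ⟨f, b, c, d, e, p', q', r', s', hp, hq, hr, hs⟩ := exists_lift_four p q r s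
  refine (congrArg₂ (· ≫ ·)
    ((congrArg (whiskerR s).map (assocIso_hom_eq f hp hq hr)).trans (whiskerR_can f _ _ hs))
    (congrArg₂ (· ≫ ·) (assocIso_hom_eq f hp (hq.trans hr) hs)
      ((congrArg (whiskerL p).map (assocIso_hom_eq f hq hr hs)).trans
        (whiskerL_can f hp _ _)))).trans
    (.trans ?_ (congrArg₂ (· ≫ ·) (assocIso_hom_eq f (hp.trans hq) hr hs)
      (assocIso_hom_eq f hp hq (hr.trans hs))).symm)
  refine (congrArg (_ ≫ ·) (can_comp_can f _ _ _)).trans ?_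
  exact (can_comp_can f _ _ _).trans (can_comp_can f _ _ _).symm

theorem triangle_path {x y z : X} (p : Path x y) (q : Path y z) :
    (assocIso p (Path.refl y) q).hom ≫ (whiskerL p).map (leftUnitIso q).hom =
      (whiskerR q).map (rightUnitIso p).hom := by
  obtain ⟨f, b, c, p', q', -, hp, hq⟩ := exists_lift_two p q
  have h1 : LiftsTo f (Path.refl b) (Path.refl y) := LiftsTo.refl hq.source.symm
  refine (congrArg₂ (· ≫ ·) (assocIso_hom_eq f hp h1 hq)
    ((congrArg (whiskerL p).map (leftUnitIso_hom_eq f hq h1)).trans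
      (whiskerL_can f hp _ _))).trans
    (.trans ?_ ((congrArg (whiskerR q).map (rightUnitIso_hom_eq f hp h1)).trans
      (whiskerR_can f _ _ hq)).symm)
  exact can_comp_can f _ _ _

/-- A homotopy between maps, restricted to a path, in the form of a commutative square. -/
theorem naturality_of_homotopy {P Q : Type*} [TopologicalSpace P] [TopologicalSpace Q]
    {f g : C(P, Q)} (F : f.Homotopy g) {a b : FundamentalGroupoid P} (η : a ⟶ b) :
    (FundamentalGroupoid.map f).map η ≫
      (Path.Homotopic.Quotient.mk (F.evalAt b.as) : FundamentalGroupoid.mk (f b.as) ⟶ _) =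
    (Path.Homotopic.Quotient.mk (F.evalAt a.as) : FundamentalGroupoid.mk (f a.as) ⟶ _) ≫
      (FundamentalGroupoid.map g).map η :=
  (FundamentalGroupoidFunctor.homotopicMapsNatIso F).naturality η

/-- The homotopy between two families of reparametrized paths. -/
def reparamHomotopy {P : Type*} [TopologicalSpace P] {x y : X} (h : C(P, Path x y))
    (φ : Path (0 : I) 1) (h' : C(P, Path x y)) (hh : ∀ p, LiftsTo (h p).toContinuousMap φ (h' p)) :
    h'.Homotopy h where
  toFun z := mapPaths (h z.2).toContinuousMap (h z.2).source.symm (h z.2).target.symm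
    (segPaths φ Path.id z.1)
  continuous_toFun := Path.continuous_uncurry_iff.1 (by
    change Continuous fun z : (I × P) × I => h z.1.2 (seg z.1.1 (φ z.2) z.2)
    have : Continuous fun z : (I × P) × I => seg z.1.1 (φ z.2) z.2 :=
      continuous_seg' (by fun_prop) (by fun_prop) (by fun_prop)
    fun_prop)
  map_zero_left p := by
    ext t; simp only [Path.source]; exact hh p t
  map_one_left p := by
    ext t; simp only [Path.target]; rfl

theorem reparamHomotopy_evalAt {P : Type*} [TopologicalSpace P] {x y : X} (h : C(P, Path x y))
    (φ : Path (0 : I) 1) (h' : C(P, Path x y)) (hh : ∀ p, LiftsTo (h p).toContinuousMap φ (h' p))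
    (p : P) :
    (Path.Homotopic.Quotient.mk ((reparamHomotopy h φ h' hh).evalAt p) :
      FundamentalGroupoid.mk (h' p) ⟶ FundamentalGroupoid.mk (h p)) =
      can (h p).toContinuousMap (hh p) (liftsTo_id _) :=
  mk_eq_can _ _ _ (segPaths φ Path.id) _ fun _ _ => rfl

theorem naturality_of_reparam {P : Type*} [TopologicalSpace P] {x y : X} (h : C(P, Path x y))
    (φ : Path (0 : I) 1) (h' : C(P, Path x y)) (hh : ∀ p, LiftsTo (h p).toContinuousMap φ (h' p))
    {a b : FundamentalGroupoid P} (η : a ⟶ b) :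
    (FundamentalGroupoid.map h').map η ≫ can (h b.as).toContinuousMap (hh b.as) (liftsTo_id _) =
      can (h a.as).toContinuousMap (hh a.as) (liftsTo_id _) ≫ (FundamentalGroupoid.map h).map η := by
  have := naturality_of_homotopy (reparamHomotopy h φ h' hh) η
  rwa [reparamHomotopy_evalAt, reparamHomotopy_evalAt] at this

theorem leftUnit_naturality {x y : X} {p q : PathGpd x y} (η : p ⟶ q) :
    (whiskerL (Path.refl x)).map η ≫ (leftUnitIso q.as).hom = (leftUnitIso p.as).hom ≫ η := by
  refine (naturality_of_reparam (ContinuousMap.id _) leftUnitPath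
    ⟨fun p => (Path.refl x).trans p, by fun_prop⟩ (fun p => leftUnitPath_spec p) η).trans
    (congrArg (_ ≫ ·) ?_)
  induction η using Path.Homotopic.Quotient.ind with | mk Γ => rfl

theorem rightUnit_naturality {x y : X} {p q : PathGpd x y} (η : p ⟶ q) :
    (whiskerR (Path.refl y)).map η ≫ (rightUnitIso q.as).hom = (rightUnitIso p.as).hom ≫ η := by
  refine (naturality_of_reparam (ContinuousMap.id _) rightUnitPath
    ⟨fun p => p.trans (Path.refl y), by fun_prop⟩ (fun p => rightUnitPath_spec p) η).trans
    (congrArg (_ ≫ ·) ?_)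
  induction η using Path.Homotopic.Quotient.ind with | mk Γ => rfl

theorem assoc_naturality_right {x y z w : X} (p : PathGpd x y) (q : PathGpd y z)
    {r r' : PathGpd z w} (η : r ⟶ r') :
    (whiskerL (p.as.trans q.as)).map η ≫ (assocIso p.as q.as r'.as).hom =
      (assocIso p.as q.as r.as).hom ≫ (whiskerL p.as).map ((whiskerL q.as).map η) := by
  refine (naturality_of_reparam (P := Path z w) ⟨fun r => p.as.trans (q.as.trans r), by fun_prop⟩
    assocPath ⟨fun r => (p.as.trans q.as).trans r, by fun_prop⟩
    (fun r => assocPath_spec p.as q.as r) η).trans (congrArg (_ ≫ ·) ?_)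
  induction η using Path.Homotopic.Quotient.ind with | mk Γ => rfl

theorem assoc_naturality_middle {x y z w : X} (p : PathGpd x y) {q q' : PathGpd y z}
    (η : q ⟶ q') (r : PathGpd z w) :
    (whiskerR r.as).map ((whiskerL p.as).map η) ≫ (assocIso p.as q'.as r.as).hom =
      (assocIso p.as q.as r.as).hom ≫ (whiskerL p.as).map ((whiskerR r.as).map η) := by
  refine .trans (congrArg (· ≫ _) ?_) ((naturality_of_reparam (P := Path y z)
    ⟨fun q => p.as.trans (q.trans r.as), by fun_prop⟩
    assocPath ⟨fun q => (p.as.trans q).trans r.as, by fun_prop⟩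
    (fun q => assocPath_spec p.as q r.as) η).trans (congrArg (_ ≫ ·) ?_))
  · induction η using Path.Homotopic.Quotient.ind with | mk Γ => rfl
  · induction η using Path.Homotopic.Quotient.ind with | mk Γ => rfl

theorem assoc_naturality_left {x y z w : X} {p p' : PathGpd x y} (η : p ⟶ p') (q : PathGpd y z)
    (r : PathGpd z w) :
    (whiskerR r.as).map ((whiskerR q.as).map η) ≫ (assocIso p'.as q.as r.as).hom =
      (assocIso p.as q.as r.as).hom ≫ (whiskerR (q.as.trans r.as)).map η := by
  refine .trans (congrArg (· ≫ _) ?_) (naturality_of_reparam (P := Path x y)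
    ⟨fun p => p.trans (q.as.trans r.as), by fun_prop⟩
    assocPath ⟨fun p => (p.trans q.as).trans r.as, by fun_prop⟩
    (fun p => assocPath_spec p q.as r.as) η)
  induction η using Path.Homotopic.Quotient.ind with | mk Γ => rfl

end Structure

section PathBicategory

variable (X : Type u) [TopologicalSpace X]

/-- The points of `X` as the objects of a bicategory. Its 1-cells are the paths in `X`, its 2-cells
are the homotopy classes of homotopies between paths. -/
structure PathBicat where
  /-- The underlying point. -/
  pt : X

variable {X}

instance : CategoryStruct (PathBicat X) where
  Hom x y := PathGpd x.pt y.pt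
  id x := ⟨Path.refl x.pt⟩
  comp p q := ⟨p.as.trans q.as⟩

instance (x y : PathBicat X) : Groupoid (x ⟶ y) :=
  inferInstanceAs (Groupoid (PathGpd x.pt y.pt))

theorem whisker_exchange_path {x y z : X} {p p' : PathGpd x y} {q q' : PathGpd y z}
    (η : p ⟶ p') (θ : q ⟶ q') :
    (whiskerL p.as).map θ ≫ (whiskerR q'.as).map η =
      (whiskerR q.as).map η ≫ (whiskerL p'.as).map θ := by
  induction η using Path.Homotopic.Quotient.ind with | mk Γ =>
  let F : ContinuousMap.Homotopy (X := Path y z) (Y := Path x z)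
      ⟨fun r => p.as.trans r, by fun_prop⟩ ⟨fun r => p'.as.trans r, by fun_prop⟩ :=
    { toFun := fun a => (Γ a.1).trans a.2
      continuous_toFun := by fun_prop
      map_zero_left := fun r => by simp
      map_one_left := fun r => by simp }
  exact naturality_of_homotopy F θ

instance : Bicategory (PathBicat X) where
  homCategory _ _ := inferInstance
  whiskerLeft p _ _ η := (whiskerL p.as).map η
  whiskerRight η q := (whiskerR q.as).map η
  associator p q r := assocIso p.as q.as r.as
  leftUnitor p := leftUnitIso p.as
  rightUnitor p := rightUnitIso p.as
  whiskerLeft_id p q := (whiskerL p.as).map_id q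
  whiskerLeft_comp p _ _ _ η θ := (whiskerL p.as).map_comp η θ
  id_whiskerLeft η := (Iso.eq_comp_inv (leftUnitIso _)).2 (leftUnit_naturality η) |>.trans
    (Category.assoc _ _ _)
  comp_whiskerLeft p q _ _ η := (Iso.eq_comp_inv (assocIso _ _ _)).2
    (assoc_naturality_right p q η) |>.trans (Category.assoc _ _ _)
  id_whiskerRight p q := (whiskerR q.as).map_id p
  comp_whiskerRight η θ q := (whiskerR q.as).map_comp η θ
  whiskerRight_id η := (Iso.eq_comp_inv (rightUnitIso _)).2 (rightUnit_naturality η) |>.trans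
    (Category.assoc _ _ _)
  whiskerRight_comp η p q := (Iso.eq_inv_comp (assocIso _ _ _)).2
    (assoc_naturality_left η p q).symm
  whisker_assoc p _ _ η q := (Iso.eq_comp_inv (assocIso _ _ _)).2
    (assoc_naturality_middle p η q) |>.trans (Category.assoc _ _ _)
  whisker_exchange η θ := whisker_exchange_path η θ
  pentagon p q r s := pentagon_path p.as q.as r.as s.as
  triangle p q := triangle_path p.as q.as

end PathBicategory

/-! ### The cochain of a framing, and the homotopy addition lemma -/

section Bigroupoid

open Bicategory

variable {C : Type*} [Bicategory C]

/-- The action of an endomorphism of `𝟙 e` on a 1-cell with source `e`. -/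
def actL {e x : C} (b : 𝟙 e ⟶ 𝟙 e) (u : e ⟶ x) : u ⟶ u := (λ_ u).inv ≫ b ▷ u ≫ (λ_ u).hom

/-- The action of an endomorphism of `𝟙 x` on a 1-cell with target `x`. -/
def actR {e x : C} (u : e ⟶ x) (b : 𝟙 x ⟶ 𝟙 x) : u ⟶ u := (ρ_ u).inv ≫ u ◁ b ≫ (ρ_ u).hom

theorem actL_comp {e x : C} (b b' : 𝟙 e ⟶ 𝟙 e) (u : e ⟶ x) :
    actL (b ≫ b') u = actL b u ≫ actL b' u := by simp [actL]

theorem actL_id {e x : C} (u : e ⟶ x) : actL (𝟙 (𝟙 e)) u = 𝟙 u := by simp [actL]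

theorem actR_id {e x : C} (u : e ⟶ x) : actR u (𝟙 (𝟙 x)) = 𝟙 u := by simp [actR]

theorem actL_unit {e : C} (b : 𝟙 e ⟶ 𝟙 e) : actL b (𝟙 e) = b := by
  simp [actL, unitors_equal, unitors_inv_equal]

theorem actR_unit {e : C} (b : 𝟙 e ⟶ 𝟙 e) : actR (𝟙 e) b = b := by
  simp [actR, ← unitors_equal, ← unitors_inv_equal]

theorem actL_naturality {e x : C} (b : 𝟙 e ⟶ 𝟙 e) {u u' : e ⟶ x} (α : u ⟶ u') :
    actL b u ≫ α = α ≫ actL b u' := by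
  simp only [actL, Category.assoc]
  rw [leftUnitor_inv_naturality_assoc, ← leftUnitor_naturality, whisker_exchange_assoc]

theorem actR_naturality {e x : C} (b : 𝟙 x ⟶ 𝟙 x) {u u' : e ⟶ x} (α : u ⟶ u') :
    actR u b ≫ α = α ≫ actR u' b := by
  simp only [actR, Category.assoc]
  rw [rightUnitor_inv_naturality_assoc, ← rightUnitor_naturality, ← whisker_exchange_assoc]

theorem actL_whiskerRight {e x y : C} (b : 𝟙 e ⟶ 𝟙 e) (u : e ⟶ x) (v : x ⟶ y) :
    actL b u ▷ v = actL b (u ≫ v) := by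
  simp [actL]

theorem whiskerLeft_actR {e x y : C} (b : 𝟙 y ⟶ 𝟙 y) (u : e ⟶ x) (v : x ⟶ y) :
    u ◁ actR v b = actR (u ≫ v) b := by
  simp [actR]

theorem whiskerLeft_actL {e x y : C} (b : 𝟙 x ⟶ 𝟙 x) (u : e ⟶ x) (v : x ⟶ y) :
    u ◁ actL b v = actR u b ▷ v := by
  simp [actL, actR]

theorem comp_comm_unit {e : C} (b b' : 𝟙 e ⟶ 𝟙 e) : b ≫ b' = b' ≫ b := by
  simpa [actL_unit] using actL_naturality b b'

/-- The group of endomorphisms of the identity 1-cell, written additively. For the bicategory of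
paths in a space this is the second homotopy group. -/
@[ext]
structure TwoEnd {C : Type*} [Bicategory C] (e : C) where
  /-- The underlying 2-cell. -/
  hom : 𝟙 e ⟶ 𝟙 e

/-- The translation of a 2-cell between 1-cells with source `e` by an element of `TwoEnd e`. -/
def act {e x : C} (b : TwoEnd e) {u u' : e ⟶ x} (α : u ⟶ u') : u ⟶ u' := actL b.hom u ≫ α

section ActComp

variable {e x y : C} (b : TwoEnd e) {u u' u'' : e ⟶ x}

theorem act_comp (α : u ⟶ u') (β : u' ⟶ u'') : act b α ≫ β = act b (α ≫ β) :=
  Category.assoc _ _ _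

theorem comp_act (α : u ⟶ u') (β : u' ⟶ u'') : α ≫ act b β = act b (α ≫ β) := by
  rw [act, ← Category.assoc, ← actL_naturality, Category.assoc]; rfl

theorem act_whiskerRight (α : u ⟶ u') (v : x ⟶ y) : act b α ▷ v = act b (α ▷ v) := by
  rw [act, comp_whiskerRight, actL_whiskerRight]; rfl

theorem whiskerLeft_act {γ : e ⟶ e} (h : actR γ b.hom = actL b.hom γ) (α : u ⟶ u') :
    γ ◁ act b α = act b (γ ◁ α) := by
  rw [act, whiskerLeft_comp, whiskerLeft_actL, h, actL_whiskerRight]; rfl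

end ActComp

/-- All 2-cells are invertible and all 1-cells are invertible up to isomorphism. -/
class IsBigroupoid (C : Type*) [Bicategory C] : Prop where
  isGroupoid (x y : C) : IsGroupoid (x ⟶ y)
  exists_inv {x y : C} (u : x ⟶ y) :
    ∃ v : y ⟶ x, Nonempty (u ≫ v ≅ 𝟙 x) ∧ Nonempty (v ≫ u ≅ 𝟙 y)

attribute [instance] IsBigroupoid.isGroupoid

variable [IsBigroupoid C]

theorem whiskerRight_injective {x y z : C} {u u' : x ⟶ y} (v : y ⟶ z) :
    Function.Injective fun α : u ⟶ u' => α ▷ v := by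
  intro α β h
  obtain ⟨w, ⟨i⟩, -⟩ := IsBigroupoid.exists_inv v
  have h1 : α ▷ (v ≫ w) = β ▷ (v ≫ w) := by
    simpa using congrArg (fun t => (α_ u v w).inv ≫ t ▷ w ≫ (α_ u' v w).hom) h
  have h2 : α ▷ 𝟙 y = β ▷ 𝟙 y := by
    rw [← cancel_epi (u ◁ i.hom), whisker_exchange, whisker_exchange, h1]
  simpa using h2

theorem whiskerLeft_injective {x y z : C} {u u' : x ⟶ y} (v : z ⟶ x) :
    Function.Injective fun α : u ⟶ u' => v ◁ α := by
  intro α β h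
  obtain ⟨w, -, ⟨i⟩⟩ := IsBigroupoid.exists_inv v
  have h1 : (w ≫ v) ◁ α = (w ≫ v) ◁ β := by
    simpa using congrArg (fun t => (α_ w v u).hom ≫ w ◁ t ≫ (α_ w v u').inv) h
  have h2 : 𝟙 x ◁ α = 𝟙 x ◁ β := by
    rw [← cancel_mono (i.inv ▷ u'), whisker_exchange, whisker_exchange, h1]
  simpa using h2

theorem actL_injective {e x : C} (u : e ⟶ x) : Function.Injective fun b => actL b u := by
  intro b b' h
  apply whiskerRight_injective u
  simpa [actL] using h

theorem actR_injective {e x : C} (u : e ⟶ x) : Function.Injective fun b => actR u b := by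
  intro b b' h
  apply whiskerLeft_injective u
  simpa [actR] using h

theorem actL_surjective {e x : C} (u : e ⟶ x) : Function.Surjective fun b => actL b u := by
  intro α
  obtain ⟨v, ⟨i⟩, -⟩ := IsBigroupoid.exists_inv u
  refine ⟨i.inv ≫ α ▷ v ≫ i.hom, whiskerRight_injective v ?_⟩
  change actL _ u ▷ v = α ▷ v
  rw [actL_whiskerRight, ← cancel_mono i.hom, actL_naturality, actL_unit]
  simp

theorem actR_surjective {e x : C} (u : e ⟶ x) : Function.Surjective fun b => actR u b := by
  intro α
  obtain ⟨v, -, ⟨i⟩⟩ := IsBigroupoid.exists_inv u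
  refine ⟨i.inv ≫ v ◁ α ≫ i.hom, whiskerLeft_injective v ?_⟩
  change v ◁ actR u _ = v ◁ α
  rw [whiskerLeft_actR, ← cancel_mono i.hom, actR_naturality, actR_unit]
  simp

instance (e : C) : AddCommGroup (TwoEnd e) where
  add b b' := ⟨b.hom ≫ b'.hom⟩
  zero := ⟨𝟙 (𝟙 e)⟩
  neg b := ⟨inv b.hom⟩
  add_assoc b b' b'' := TwoEnd.ext (Category.assoc _ _ _)
  zero_add b := TwoEnd.ext (Category.id_comp _)
  add_zero b := TwoEnd.ext (Category.comp_id _)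
  nsmul := @nsmulRec _ ⟨⟨𝟙 (𝟙 e)⟩⟩ ⟨fun b b' => ⟨b.hom ≫ b'.hom⟩⟩
  nsmul_zero _ := rfl
  nsmul_succ _ _ := rfl
  zsmul := @zsmulRec _ ⟨⟨𝟙 (𝟙 e)⟩⟩ ⟨fun b b' => ⟨b.hom ≫ b'.hom⟩⟩ ⟨fun b => ⟨inv b.hom⟩⟩
    (@nsmulRec _ ⟨⟨𝟙 (𝟙 e)⟩⟩ ⟨fun b b' => ⟨b.hom ≫ b'.hom⟩⟩)
  zsmul_zero' _ := rfl
  zsmul_succ' _ _ := rfl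
  zsmul_neg' _ _ := rfl
  neg_add_cancel b := TwoEnd.ext (IsIso.inv_hom_id b.hom)
  add_comm b b' := TwoEnd.ext (comp_comm_unit b.hom b'.hom)

theorem TwoEnd.add_hom {e : C} (b b' : TwoEnd e) : (b + b').hom = b.hom ≫ b'.hom := rfl

section Act

variable {e x : C} (b b' : TwoEnd e) {u u' : e ⟶ x}

theorem act_add (α : u ⟶ u') : act (b + b') α = act b (act b' α) := by
  rw [act, TwoEnd.add_hom, actL_comp, Category.assoc]; rfl

variable {b b'} in
theorem act_injective {α : u ⟶ u'} (h : act b α = act b' α) : b = b' :=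
  TwoEnd.ext (actL_injective u ((cancel_mono α).1 h))

theorem exists_act (α β : u ⟶ u') : ∃ b : TwoEnd e, β = act b α := by
  obtain ⟨b, hb⟩ := actL_surjective u (β ≫ inv α)
  have hb' : actL b u = β ≫ inv α := hb
  exact ⟨⟨b⟩, by rw [act, hb']; simp⟩

/-- The difference of two parallel 2-cells. -/
def twoDiff (α β : u ⟶ u') : TwoEnd e := (exists_act α β).choose

theorem act_twoDiff (α β : u ⟶ u') : act (twoDiff α β) α = β := (exists_act α β).choose_spec.symm

variable {b} in
theorem twoDiff_eq {α β : u ⟶ u'} (h : act b α = β) : twoDiff α β = b :=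
  act_injective ((act_twoDiff α β).trans h.symm)

end Act

/-- A choice of loops at `e`, indexed by a group, together with 2-cells that compare composition of
loops with multiplication in the group. -/
structure LoopSystem {C : Type*} [Bicategory C] (e : C) (A : Type*) [Add A] where
  /-- The loops. -/
  loop : A → (e ⟶ e)
  /-- The comparison 2-cells. -/
  mul : ∀ a b c, a + b = c → (loop a ≫ loop b ⟶ loop c)

/-- The associativity defect of a system of loops. -/
def LoopSystem.defect {e : C} {A : Type*} [AddSemigroup A] (S : LoopSystem e A) (a b c : A) :
    TwoEnd e :=
  twoDiff ((α_ _ _ _).hom ≫ S.loop a ◁ S.mul b c _ rfl ≫ S.mul a (b + c) (a + b + c)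
    (add_assoc a b c).symm) (S.mul a b _ rfl ▷ S.loop c ≫ S.mul (a + b) c _ rfl)

theorem LoopSystem.act_defect {e : C} {A : Type*} [AddSemigroup A] (S : LoopSystem e A)
    {a b c ab bc abc : A} (h1 : a + b = ab) (h2 : b + c = bc) (h3 : ab + c = abc)
    (h4 : a + bc = abc) :
    S.mul a b ab h1 ▷ S.loop c ≫ S.mul ab c abc h3 = act (S.defect a b c)
      ((α_ _ _ _).hom ≫ S.loop a ◁ S.mul b c bc h2 ≫ S.mul a bc abc h4) := by
  subst h1 h2 h3
  exact (act_twoDiff _ _).symm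

/-- A system of loops at `e`, with a path from `e` to each object and a comparison of each 1-cell
with one of the loops. -/
structure Framing {C : Type*} [Bicategory C] (e : C) (A : Type*) [Add A] extends
    LoopSystem e A where
  /-- The path from `e` to an object. -/
  base : ∀ x, e ⟶ x
  /-- The element of the index group that belongs to a 1-cell. -/
  label : ∀ {x y : C}, (x ⟶ y) → A
  /-- The comparison of a 1-cell with the loop of its label. -/
  frame : ∀ {x y : C} (w : x ⟶ y), base x ≫ w ⟶ loop (label w) ≫ base y

namespace Framing

variable {e : C} {A : Type*} [AddSemigroup A] (S : Framing e A)

/-- The comparison of a composite of two 1-cells with the loop of the sum of the labels. -/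
def compare {x y z : C} (u : x ⟶ y) (v : y ⟶ z) {c : A} (h : S.label u + S.label v = c) :
    (S.base x ≫ u) ≫ v ⟶ S.loop c ≫ S.base z :=
  S.frame u ▷ v ≫ (α_ _ _ _).hom ≫ S.loop (S.label u) ◁ S.frame v ≫ (α_ _ _ _).inv ≫
    S.mul _ _ _ h ▷ S.base z

/-- The comparison of a composite of two 1-cells with a loop, by way of a 2-cell to a third
1-cell. -/
def compareVia {x y z : C} {u : x ⟶ y} {v : y ⟶ z} {w : x ⟶ z} (θ : u ≫ v ⟶ w) :
    (S.base x ≫ u) ≫ v ⟶ S.loop (S.label w) ≫ S.base z :=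
  (α_ _ _ _).hom ≫ S.base x ◁ θ ≫ S.frame w

/-- The value of the cochain of a framing on a triangle. -/
def value {x y z : C} {u : x ⟶ y} {v : y ⟶ z} {w : x ⟶ z} (θ : u ≫ v ⟶ w)
    (h : S.label u + S.label v = S.label w) : TwoEnd e :=
  twoDiff (S.compare u v h) (S.compareVia θ)

theorem act_value {x y z : C} {u : x ⟶ y} {v : y ⟶ z} {w : x ⟶ z} (θ : u ≫ v ⟶ w)
    (h : S.label u + S.label v = S.label w) :
    (α_ _ _ _).hom ≫ S.base x ◁ θ ≫ S.frame w = act (S.value θ h) (S.compare u v h) :=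
  (act_twoDiff _ _).symm

theorem value_act {x y z : C} {u : x ⟶ y} {v : y ⟶ z} {w : x ⟶ z} (θ : u ≫ v ⟶ w)
    (h : S.label u + S.label v = S.label w) (b : TwoEnd x) (b' : TwoEnd e)
    (hb : actR (S.base x) b.hom = actL b'.hom (S.base x)) :
    S.value (act b θ) h = b' + S.value θ h := by
  refine twoDiff_eq ?_
  rw [act_add, ← act_value, compareVia]
  simp only [act, whiskerLeft_comp, whiskerLeft_actL, hb, actL_whiskerRight, Category.assoc]
  rw [← Category.assoc, actL_naturality, Category.assoc]

/-- The homotopy addition lemma: the values on the four faces of a tetrahedron add up to the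
associativity defect of the system of loops. -/
theorem value_add_value (hS : ∀ (a : A) (b : TwoEnd e), actR (S.loop a) b.hom = actL b.hom (S.loop a))
    {x₀ x₁ x₂ x₃ : C} {w₀₁ : x₀ ⟶ x₁} {w₁₂ : x₁ ⟶ x₂} {w₂₃ : x₂ ⟶ x₃} {w₀₂ : x₀ ⟶ x₂}
    {w₁₃ : x₁ ⟶ x₃} {w₀₃ : x₀ ⟶ x₃} (θ₀₁₂ : w₀₁ ≫ w₁₂ ⟶ w₀₂) (θ₀₂₃ : w₀₂ ≫ w₂₃ ⟶ w₀₃)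
    (θ₀₁₃ : w₀₁ ≫ w₁₃ ⟶ w₀₃) (θ₁₂₃ : w₁₂ ≫ w₂₃ ⟶ w₁₃)
    (h₀₁₂ : S.label w₀₁ + S.label w₁₂ = S.label w₀₂)
    (h₀₂₃ : S.label w₀₂ + S.label w₂₃ = S.label w₀₃)
    (h₀₁₃ : S.label w₀₁ + S.label w₁₃ = S.label w₀₃)
    (h₁₂₃ : S.label w₁₂ + S.label w₂₃ = S.label w₁₃)
    (hθ : θ₀₁₂ ▷ w₂₃ ≫ θ₀₂₃ = (α_ _ _ _).hom ≫ w₀₁ ◁ θ₁₂₃ ≫ θ₀₁₃) :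
    S.value θ₀₁₂ h₀₁₂ + S.value θ₀₂₃ h₀₂₃ + S.defect (S.label w₀₁) (S.label w₁₂) (S.label w₂₃) =
      S.value θ₀₁₃ h₀₁₃ + S.value θ₁₂₃ h₁₂₃ := by
  have e₁ := S.act_value θ₀₁₂ h₀₁₂
  have e₂ := S.act_value θ₀₂₃ h₀₂₃
  have e₃ := S.act_value θ₀₁₃ h₀₁₃
  have e₄ := S.act_value θ₁₂₃ h₁₂₃
  have hk := S.act_defect h₀₁₂ h₁₂₃ h₀₂₃ h₀₁₃
  -- Both sides act in the same way on the following 2-cell.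
  let Y : ((S.base x₀ ≫ w₀₁) ≫ w₁₂) ≫ w₂₃ ⟶ S.loop (S.label w₀₃) ≫ S.base x₃ :=
    (α_ _ _ _).hom ≫ S.frame w₀₁ ▷ (w₁₂ ≫ w₂₃) ≫ (α_ _ _ _).hom ≫
      S.loop (S.label w₀₁) ◁ ((α_ _ _ _).inv ≫ S.compare w₁₂ w₂₃ h₁₂₃) ≫ (α_ _ _ _).inv ≫
        S.mul _ _ _ h₀₁₃ ▷ S.base x₃
  have way₁ : (α_ _ _ _).hom ▷ w₂₃ ≫ (α_ _ _ _).hom ≫ S.base x₀ ◁ (θ₀₁₂ ▷ w₂₃ ≫ θ₀₂₃) ≫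
      S.frame w₀₃ = act (S.value θ₀₁₂ h₀₁₂ + S.value θ₀₂₃ h₀₂₃ +
        S.defect (S.label w₀₁) (S.label w₁₂) (S.label w₂₃)) Y := by
    calc _ = ((α_ _ _ _).hom ≫ S.base x₀ ◁ θ₀₁₂) ▷ w₂₃ ≫
          ((α_ _ _ _).hom ≫ S.base x₀ ◁ θ₀₂₃ ≫ S.frame w₀₃) := by simp
      _ = act (S.value θ₀₂₃ h₀₂₃) (((α_ _ _ _).hom ≫ S.base x₀ ◁ θ₀₁₂ ≫ S.frame w₀₂) ▷ w₂₃ ≫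
          (α_ _ _ _).hom ≫ S.loop _ ◁ S.frame w₂₃ ≫ (α_ _ _ _).inv ≫
            S.mul _ _ _ h₀₂₃ ▷ S.base x₃) := by
          rw [e₂, comp_act]; simp [compare]
      _ = act (S.value θ₀₁₂ h₀₁₂ + S.value θ₀₂₃ h₀₂₃) (S.compare w₀₁ w₁₂ h₀₁₂ ▷ w₂₃ ≫
          (α_ _ _ _).hom ≫ S.loop _ ◁ S.frame w₂₃ ≫ (α_ _ _ _).inv ≫
            S.mul _ _ _ h₀₂₃ ▷ S.base x₃) := by
          rw [e₁, act_whiskerRight, act_comp, ← act_add, add_comm]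
      _ = act (S.value θ₀₁₂ h₀₁₂ + S.value θ₀₂₃ h₀₂₃) (S.frame w₀₁ ▷ w₁₂ ▷ w₂₃ ≫
          (α_ _ _ _).hom ▷ w₂₃ ≫ (S.loop _ ◁ S.frame w₁₂) ▷ w₂₃ ≫ (α_ _ _ _).inv ▷ w₂₃ ≫
          (α_ _ _ _).hom ≫ (S.loop _ ≫ S.loop _) ◁ S.frame w₂₃ ≫ (α_ _ _ _).inv ≫
            (S.mul _ _ _ h₀₁₂ ▷ S.loop _ ≫ S.mul _ _ _ h₀₂₃) ▷ S.base x₃) := by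
          congr 1
          have key : S.mul _ _ _ h₀₁₂ ▷ S.base x₂ ▷ w₂₃ ≫ (α_ _ _ _).hom ≫
              S.loop _ ◁ S.frame w₂₃ = (α_ _ _ _).hom ≫ (S.loop _ ≫ S.loop _) ◁ S.frame w₂₃ ≫
                (α_ _ _ _).inv ≫ S.mul _ _ _ h₀₁₂ ▷ S.loop _ ▷ S.base x₃ ≫ (α_ _ _ _).hom := by
            have := whisker_exchange (S.mul _ _ _ h₀₁₂) (S.frame w₂₃)
            rw [whiskerRight_comp, whiskerRight_comp] at this
            rw [this]
            simp
          simp only [compare, comp_whiskerRight, Category.assoc]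
          rw [reassoc_of% key]
          simp
      _ = act (S.value θ₀₁₂ h₀₁₂ + S.value θ₀₂₃ h₀₂₃ +
          S.defect (S.label w₀₁) (S.label w₁₂) (S.label w₂₃)) Y := by
          rw [hk, act_whiskerRight]
          simp only [comp_act, act_add]
          congr 2
          simp [Y, compare]
  have way₂ : (α_ _ _ _).hom ▷ w₂₃ ≫ (α_ _ _ _).hom ≫ S.base x₀ ◁ (θ₀₁₂ ▷ w₂₃ ≫ θ₀₂₃) ≫
      S.frame w₀₃ = act (S.value θ₀₁₃ h₀₁₃ + S.value θ₁₂₃ h₁₂₃) Y := by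
    calc _ = (α_ _ _ _).hom ≫ (S.base x₀ ≫ w₀₁) ◁ θ₁₂₃ ≫
          ((α_ _ _ _).hom ≫ S.base x₀ ◁ θ₀₁₃ ≫ S.frame w₀₃) := by
          rw [hθ]; simp
      _ = _ := ?_
    have e₄' : S.base x₁ ◁ θ₁₂₃ ≫ S.frame w₁₃ =
        act (S.value θ₁₂₃ h₁₂₃) ((α_ _ _ _).inv ≫ S.compare w₁₂ w₂₃ h₁₂₃) := by
      rw [← comp_act, ← e₄]; simp
    rw [e₃, comp_act, comp_act, compare, whisker_exchange_assoc,
      associator_naturality_right_assoc, ← whiskerLeft_comp_assoc, e₄',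
      whiskerLeft_act _ (hS _ _), act_comp, comp_act, comp_act, comp_act, ← act_add]
  exact act_injective (way₁.symm.trans way₂)

end Framing

end Bigroupoid

/-! ### Chains and homology classes as elements of groups -/

section Cycles

variable (K : ChainComplex AddCommGrpCat.{u} ℕ)

/-- The homology class of a 2-cycle of a chain complex of abelian groups. -/
def cycleClass : (K.d 2 1).hom.ker →+ (K.homology 2 : AddCommGrpCat.{u}) :=
  (K.liftCycles (AddCommGrpCat.ofHom (K.d 2 1).hom.ker.subtype) 1 (ChainComplex.next_nat_succ 1)
    (by ext z; exact z.2) ≫ K.homologyπ 2).hom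

theorem iCycles_injective : Function.Injective (K.iCycles 2).hom :=
  (AddCommGrpCat.mono_iff_injective (K.iCycles 2)).1 inferInstance

theorem cycleClass_eq {z : (K.d 2 1).hom.ker} {c : (K.cycles 2 : AddCommGrpCat.{u})}
    (h : (K.iCycles 2).hom c = z.1) : cycleClass K z = (K.homologyπ 2).hom c := by
  have : (K.liftCycles (AddCommGrpCat.ofHom (K.d 2 1).hom.ker.subtype) 1
      (ChainComplex.next_nat_succ 1) (by ext z; exact z.2)).hom z = c := by
    refine iCycles_injective K (Eq.trans ?_ h.symm)
    exact ConcreteCategory.congr_hom (K.liftCycles_i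
      (AddCommGrpCat.ofHom (K.d 2 1).hom.ker.subtype) 1 (ChainComplex.next_nat_succ 1) _) z
  rw [← this]
  rfl

theorem cycleClass_surjective : Function.Surjective (cycleClass K) := by
  intro a
  obtain ⟨c, rfl⟩ := (AddCommGrpCat.epi_iff_surjective (K.homologyπ 2)).1 inferInstance a
  exact ⟨⟨(K.iCycles 2).hom c, ConcreteCategory.congr_hom (K.iCycles_d 2 1) c⟩,
    cycleClass_eq K rfl⟩

variable {B : Type u} [AddCommGroup B]

/-- The homomorphism on homology induced by a homomorphism on chains that vanishes on
boundaries. -/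
def cycleLift (φ : K.X 2 →+ B) (hφ : ∀ c, φ ((K.d 3 2).hom c) = 0) :
    (K.homology 2 : AddCommGrpCat.{u}) →+ B :=
  (K.homologyι 2 ≫ K.descOpcycles (A := AddCommGrpCat.of B) (AddCommGrpCat.ofHom φ) 3
    (ChainComplex.prev ℕ 2) (by ext c; exact hφ c)).hom

theorem cycleLift_class (φ : K.X 2 →+ B) (hφ : ∀ c, φ ((K.d 3 2).hom c) = 0)
    (z : (K.d 2 1).hom.ker) : cycleLift K φ hφ (cycleClass K z) = φ z.1 := by
  have : K.liftCycles (AddCommGrpCat.ofHom (K.d 2 1).hom.ker.subtype) 1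
      (ChainComplex.next_nat_succ 1) (by ext z; exact z.2) ≫ K.homologyπ 2 ≫ K.homologyι 2 ≫
      K.descOpcycles (A := AddCommGrpCat.of B) (AddCommGrpCat.ofHom φ) 3
        (ChainComplex.prev ℕ 2) (by ext c; exact hφ c) =
      AddCommGrpCat.ofHom (K.d 2 1).hom.ker.subtype ≫ AddCommGrpCat.ofHom φ := by
    simp
  exact ConcreteCategory.congr_hom this z

theorem cycleClass_eq_zero (z : (K.d 2 1).hom.ker) :
    cycleClass K z = 0 ↔ ∃ c, (K.d 3 2).hom c = z.1 := by
  constructor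
  · intro h
    -- The projection to chains modulo boundaries vanishes on boundaries.
    have := cycleLift_class K (QuotientAddGroup.mk' (K.d 3 2).hom.range)
      (fun c => (QuotientAddGroup.eq_zero_iff _).2 ⟨c, rfl⟩) z
    rw [h, map_zero] at this
    exact (QuotientAddGroup.eq_zero_iff _).1 this.symm
  · rintro ⟨c, hc⟩
    refine (cycleClass_eq K (c := (K.toCycles 3 2).hom c) ?_).trans
      (ConcreteCategory.congr_hom (K.toCycles_comp_homologyπ 3 2) c)
    rw [← hc]
    exact ConcreteCategory.congr_hom (K.toCycles_i 3 2) c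

theorem homologyMap_cycleClass {K L : ChainComplex AddCommGrpCat.{u} ℕ} (f : K ⟶ L)
    (z : (K.d 2 1).hom.ker) :
    (HomologicalComplex.homologyMap f 2).hom (cycleClass K z) =
      cycleClass L ⟨(f.f 2).hom z.1, by
        have := ConcreteCategory.congr_hom (f.comm 2 1) z.1
        refine AddMonoidHom.mem_ker.2 (this.trans ?_)
        exact (congrArg (f.f 1).hom z.2).trans (map_zero _)⟩ := by
  obtain ⟨c, hc⟩ : ∃ c, (K.iCycles 2).hom c = z.1 :=
    ⟨_, ConcreteCategory.congr_hom (K.liftCycles_i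
      (AddCommGrpCat.ofHom (K.d 2 1).hom.ker.subtype) 1 (ChainComplex.next_nat_succ 1)
        (by ext z; exact z.2)) z⟩
  rw [cycleClass_eq K hc]
  refine .trans ?_ (cycleClass_eq L (c := (HomologicalComplex.cyclesMap f 2).hom c) ?_).symm
  · exact ConcreteCategory.congr_hom (HomologicalComplex.homologyπ_naturality f 2) c
  · refine (ConcreteCategory.congr_hom (HomologicalComplex.cyclesMap_i f 2) c).trans ?_
    exact congrArg (f.f 2).hom hc

end Cycles

section Chains

variable {S T : SSet.{u}} {n : ℕ} {B : Type u} [AddCommGroup B]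

/-- The group of integral `n`-chains of a simplicial set. -/
abbrev Chain (S : SSet.{u}) (n : ℕ) : Type u := ((S.chainComplex integers.{u}).X n : AddCommGrpCat.{u})

/-- The boundary homomorphism. -/
def bdry (S : SSet.{u}) (n : ℕ) : Chain S (n + 1) →+ Chain S n :=
  ((S.chainComplex integers.{u}).d (n + 1) n).hom

/-- The homomorphism on chains induced by a map of simplicial sets. -/
def chainMap (f : S ⟶ T) (n : ℕ) : Chain S n →+ Chain T n :=
  ((SSet.chainComplexMap f integers.{u}).f n).hom

/-- The generator of the group of chains that belongs to a simplex. -/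
def chainGen (x : S _⦋n⦌) : Chain S n := (S.ιChainComplex (R := integers.{u}) x).hom ⟨1⟩

/-- The element of a group that corresponds to a homomorphism out of the coefficient group. -/
def evalOne (G : AddCommGrpCat.{u}) : (integers.{u} ⟶ G) →+ G where
  toFun f := f.hom ⟨1⟩
  map_zero' := rfl
  map_add' _ _ := rfl

theorem hom_ulift_ext {f g : integers.{u} ⟶ AddCommGrpCat.of B}
    (h : f.hom ⟨1⟩ = g.hom ⟨1⟩) : f = g := by
  ext ⟨m⟩
  have e : (ULift.up m : ULift.{u} ℤ) = m • ULift.up 1 := by ext; simp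
  change f.hom ⟨m⟩ = g.hom ⟨m⟩
  rw [e, map_zsmul, map_zsmul, h]

/-- The homomorphism out of the group of chains with given values on simplices. -/
def chainLift (φ : S _⦋n⦌ → B) : Chain S n →+ B :=
  ((S.isColimitChainComplexXCofan integers.{u} n).desc (Limits.Cofan.mk (AddCommGrpCat.of B)
    fun x => AddCommGrpCat.ofHom
      ((zmultiplesHom B (φ x)).comp AddEquiv.ulift.toAddMonoidHom))).hom

@[simp]
theorem chainLift_gen (φ : S _⦋n⦌ → B) (x : S _⦋n⦌) : chainLift φ (chainGen x) = φ x := by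
  have := (S.isColimitChainComplexXCofan integers.{u} n).fac (Limits.Cofan.mk (AddCommGrpCat.of B)
    fun x => AddCommGrpCat.ofHom
      ((zmultiplesHom B (φ x)).comp AddEquiv.ulift.toAddMonoidHom)) ⟨x⟩
  have h := congrArg (fun f => f.hom (⟨1⟩ : ULift.{u} ℤ)) this
  refine h.trans ?_
  exact one_zsmul (φ x)

theorem chain_hom_ext {f g : Chain S n →+ B} (h : ∀ x, f (chainGen x) = g (chainGen x)) :
    f = g := by
  have : AddCommGrpCat.ofHom f = AddCommGrpCat.ofHom g :=
    SSet.chainComplex_hom_ext fun x => hom_ulift_ext (h x)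
  exact congrArg AddCommGrpCat.Hom.hom this

theorem chain_hom_apply_eq {f g : Chain S n →+ B} (h : ∀ x, f (chainGen x) = g (chainGen x))
    (c : Chain S n) : f c = g c := by rw [chain_hom_ext h]

theorem bdry_gen (x : S _⦋n + 1⦌) :
    bdry S n (chainGen x) = ∑ i : Fin (n + 2), (-1 : ℤ) ^ i.val • chainGen (S.δ i x) := by
  have := congrArg (evalOne _) (S.ιChainComplex_d (R := integers.{u}) x)
  rw [map_sum] at this
  refine this.trans (Finset.sum_congr rfl fun i _ => ?_)
  rw [map_zsmul]
  rfl

theorem bdry_gen_three (x : S _⦋3⦌) : bdry S 2 (chainGen x) =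
    chainGen (S.δ 0 x) - chainGen (S.δ 1 x) + chainGen (S.δ 2 x) - chainGen (S.δ 3 x) := by
  rw [bdry_gen, Fin.sum_univ_four]
  simp [pow_succ, sub_eq_add_neg]

theorem bdry_gen_two (x : S _⦋2⦌) : bdry S 1 (chainGen x) =
    chainGen (S.δ 0 x) - chainGen (S.δ 1 x) + chainGen (S.δ 2 x) := by
  rw [bdry_gen, Fin.sum_univ_three]
  simp [sub_eq_add_neg]

theorem bdry_bdry (c : Chain S (n + 2)) : bdry S n (bdry S (n + 1) c) = 0 :=
  ConcreteCategory.congr_hom ((S.chainComplex integers.{u}).d_comp_d (n + 2) (n + 1) n) c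

theorem chainMap_gen (f : S ⟶ T) (x : S _⦋n⦌) :
    chainMap f n (chainGen x) = chainGen (f.app _ x) :=
  congrArg (evalOne _) (SSet.ι_chainComplexMap_f (R := integers.{u}) (f := f) (x := x))

theorem chainMap_bdry (f : S ⟶ T) (c : Chain S (n + 1)) :
    bdry T n (chainMap f (n + 1) c) = chainMap f n (bdry S n c) :=
  ConcreteCategory.congr_hom ((SSet.chainComplexMap f integers.{u}).comm (n + 1) n) c

/-- The homology class of a 2-cycle. -/
def homologyClass (S : SSet.{u}) : (bdry S 1).ker →+ H2 S :=
  cycleClass (S.chainComplex integers.{u})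

theorem homologyClass_surjective (S : SSet.{u}) : Function.Surjective (homologyClass S) :=
  cycleClass_surjective _

theorem homologyClass_eq_zero (z : (bdry S 1).ker) :
    homologyClass S z = 0 ↔ ∃ c, bdry S 2 c = z.1 :=
  cycleClass_eq_zero _ z

/-- The homomorphism on homology induced by a homomorphism on chains that vanishes on
boundaries. -/
def homologyLift (φ : Chain S 2 →+ B) (hφ : ∀ c, φ (bdry S 2 c) = 0) : H2 S →+ B :=
  cycleLift (S.chainComplex integers.{u}) φ hφ

@[simp]
theorem homologyLift_class (φ : Chain S 2 →+ B) (hφ : ∀ c, φ (bdry S 2 c) = 0)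
    (z : (bdry S 1).ker) : homologyLift φ hφ (homologyClass S z) = φ z.1 :=
  cycleLift_class _ φ hφ z

theorem homologyMap_class (f : S ⟶ T) (z : (bdry S 1).ker) :
    (SSet.homologyMap f integers.{u} 2).hom (homologyClass S z) =
      homologyClass T ⟨chainMap f 2 z.1, by
        rw [AddMonoidHom.mem_ker, chainMap_bdry, z.2, map_zero]⟩ :=
  homologyMap_cycleClass _ z

end Chains

/-! ### The cochain of a framing on singular chains -/

section Cells

variable {X : Type u} [TopologicalSpace X]

/-- A path homotopy as a path in the space of paths. -/
def homotopyPath {x y : X} {p q : Path x y} (H : p.Homotopy q) : Path p q where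
  toFun s := H.eval s
  continuous_toFun := Path.continuous_uncurry_iff.1 (by
    change Continuous fun z : I × I => H z
    fun_prop)
  source' := by simp
  target' := by simp

/-- A path as a 1-cell. -/
abbrev arr {x y : X} (p : Path x y) : (⟨x⟩ : PathBicat X) ⟶ ⟨y⟩ := FundamentalGroupoid.mk p

/-- The 2-cell of a path homotopy. -/
def twoCell {x y : X} {p q : Path x y} (H : p.Homotopy q) : arr p ⟶ arr q :=
  Path.Homotopic.Quotient.mk (homotopyPath H)

instance : IsBigroupoid (PathBicat X) where
  isGroupoid x y := inferInstanceAs (IsGroupoid (PathGpd x.pt y.pt))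
  exists_inv u := ⟨FundamentalGroupoid.mk u.as.symm,
    ⟨Groupoid.isoEquivHom _ _ |>.symm (twoCell (Path.Homotopy.reflTransSymm u.as).symm)⟩,
    ⟨Groupoid.isoEquivHom _ _ |>.symm (twoCell (Path.Homotopy.reflSymmTrans u.as).symm)⟩⟩

theorem nonempty_twoCell {x y : PathBicat X} {u v : x ⟶ y} :
    Nonempty (u ⟶ v) ↔ Path.Homotopic u.as v.as := by
  constructor
  · rintro ⟨η⟩
    induction η using Path.Homotopic.Quotient.ind with | mk Γ =>
    exact ⟨{ toFun := fun z => Γ z.1 z.2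
             continuous_toFun := by fun_prop
             map_zero_left := fun t => by simp
             map_one_left := fun t => by simp
             prop' := by rintro s t (rfl | rfl) <;> simp }⟩
  · rintro ⟨H⟩
    exact ⟨twoCell H⟩

variable {D : Type*} [TopologicalSpace D] [SegmentSpace D] (f : C(D, X))

/-- The 2-cell of a triangle of paths that lifts to a space with segments. -/
def tri {a b c : D} {x y z : X} {u' : Path a b} {v' : Path b c} {w' : Path a c} {u : Path x y}
    {v : Path y z} {w : Path x z} (hu : LiftsTo f u' u) (hv : LiftsTo f v' v)
    (hw : LiftsTo f w' w) : arr u ≫ arr v ⟶ arr w :=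
  can f (hu.trans hv) hw

open Bicategory in
theorem tri_tetrahedron {a₀ a₁ a₂ a₃ : D} {x₀ x₁ x₂ x₃ : X}
    {w₀₁' : Path a₀ a₁} {w₁₂' : Path a₁ a₂} {w₂₃' : Path a₂ a₃} {w₀₂' : Path a₀ a₂}
    {w₁₃' : Path a₁ a₃} {w₀₃' : Path a₀ a₃}
    {w₀₁ : Path x₀ x₁} {w₁₂ : Path x₁ x₂} {w₂₃ : Path x₂ x₃} {w₀₂ : Path x₀ x₂}
    {w₁₃ : Path x₁ x₃} {w₀₃ : Path x₀ x₃}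
    (h₀₁ : LiftsTo f w₀₁' w₀₁) (h₁₂ : LiftsTo f w₁₂' w₁₂) (h₂₃ : LiftsTo f w₂₃' w₂₃)
    (h₀₂ : LiftsTo f w₀₂' w₀₂) (h₁₃ : LiftsTo f w₁₃' w₁₃) (h₀₃ : LiftsTo f w₀₃' w₀₃) :
    tri f h₀₁ h₁₂ h₀₂ ▷ arr w₂₃ ≫ tri f h₀₂ h₂₃ h₀₃ =
      (α_ _ _ _).hom ≫ arr w₀₁ ◁ tri f h₁₂ h₂₃ h₁₃ ≫ tri f h₀₁ h₁₃ h₀₃ := by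
  refine (congrArg₂ (· ≫ ·) (whiskerR_can f (h₀₁.trans h₁₂) h₀₂ h₂₃) rfl).trans
    (.trans ?_ (congrArg₂ (· ≫ ·) (assocIso_hom_eq f h₀₁ h₁₂ h₂₃)
      (congrArg₂ (· ≫ ·) (whiskerL_can f h₀₁ (h₁₂.trans h₂₃) h₁₃) rfl)).symm)
  refine .trans ?_ (congrArg (_ ≫ ·) (can_comp_can f _ _ _)).symm
  exact (can_comp_can f _ _ _).trans (can_comp_can f _ _ _).symm

end Cells

section Cochain

variable {X : Type u} [TopologicalSpace X]

/-- The singular simplicial set. -/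
abbrev Sing (X : Type u) [TopologicalSpace X] : SSet.{u} := TopCat.toSSet.obj (TopCat.of X)

/-- The standard topological simplex. -/
abbrev Simp (n : ℕ) := stdSimplex ℝ (Fin (n + 1))

/-- A vertex of the standard simplex. -/
abbrev vtx {n : ℕ} (i : Fin (n + 1)) : Simp n := stdSimplex.vertex i

/-- The continuous map of a singular simplex. -/
def simplexMap {n : ℕ} (s : (Sing X) _⦋n⦌) : C(Simp n, X) :=
  (TopCat.of X).toSSetObjEquiv (op ⦋n⦌) s

@[simp]
theorem simplexMap_singularSimplex {n : ℕ} (g : C(Simp n, X)) :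
    simplexMap (singularSimplex g) = g := Equiv.apply_symm_apply _ _

@[simp]
theorem singularSimplex_simplexMap {n : ℕ} (s : (Sing X) _⦋n⦌) :
    singularSimplex (simplexMap s) = s := Equiv.symm_apply_apply _ _

/-- The map between standard simplices given by the images of the vertices. -/
def simpMap {m n : ℕ} (φ : Fin (m + 1) → Fin (n + 1)) : C(Simp m, Simp n) :=
  ⟨_, stdSimplex.continuous_map φ⟩

theorem simpMap_vtx {m n : ℕ} (φ : Fin (m + 1) → Fin (n + 1)) (i : Fin (m + 1)) :
    simpMap φ (vtx i) = vtx (φ i) := stdSimplex.map_vertex φ i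

theorem simpMap_seg {m n : ℕ} (φ : Fin (m + 1) → Fin (n + 1)) (s : I) (x y : Simp m) :
    simpMap φ (seg s x y) = seg s (simpMap φ x) (simpMap φ y) := by
  refine Subtype.ext (funext fun j => ?_)
  change (stdSimplex.map φ (seg s x y) : Fin (n + 1) → ℝ) j =
    (1 - s) * (stdSimplex.map φ x : Fin (n + 1) → ℝ) j +
      s * (stdSimplex.map φ y : Fin (n + 1) → ℝ) j
  simp only [stdSimplex.map_coe, FunOnFinite.linearMap_apply_apply, Finset.mul_sum,
    ← Finset.sum_add_distrib]
  rfl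

theorem liftsTo_simpMap {m n : ℕ} (φ : Fin (m + 1) → Fin (n + 1)) (i j : Fin (m + 1)) :
    LiftsTo (simpMap φ) (segPath (vtx i) (vtx j)) (segPath (vtx (φ i)) (vtx (φ j))) := fun t => by
  change simpMap φ (seg t _ _) = seg t _ _
  rw [simpMap_seg, simpMap_vtx, simpMap_vtx]

/-- The edge of a singular simplex between two vertices. -/
def edge {n : ℕ} (s : C(Simp n, X)) (i j : Fin (n + 1)) : Path (s (vtx i)) (s (vtx j)) :=
  (segPath (vtx i) (vtx j)).map s.continuous

theorem liftsTo_edge {n : ℕ} (s : C(Simp n, X)) (i j : Fin (n + 1)) :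
    LiftsTo s (segPath (vtx i) (vtx j)) (edge s i j) := fun _ => rfl

variable {e : X} {A : Type*} [AddSemigroup A]

/-- The labels of a framing add up along each 2-cell. -/
def Framing.IsAdditive (S : Framing (⟨e⟩ : PathBicat X) A) : Prop :=
  ∀ ⦃x y z : PathBicat X⦄ (u : x ⟶ y) (v : y ⟶ z) (w : x ⟶ z) (_ : u ≫ v ⟶ w),
    S.label u + S.label v = S.label w

variable (S : Framing (⟨e⟩ : PathBicat X) A) (hS : S.IsAdditive)

/-- The value of the cochain of a framing on a singular 2-simplex. -/
def rho (s : C(Simp 2, X)) : TwoEnd (⟨e⟩ : PathBicat X) :=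
  S.value (tri s (liftsTo_edge s 0 1) (liftsTo_edge s 1 2) (liftsTo_edge s 0 2))
    (hS _ _ _ (tri s (liftsTo_edge s 0 1) (liftsTo_edge s 1 2) (liftsTo_edge s 0 2)))

theorem rho_eq_of_liftsTo (s : C(Simp 2, X)) {x y z : X} {u : Path x y} {v : Path y z}
    {w : Path x z} (hu : LiftsTo s (segPath (vtx 0) (vtx 1)) u)
    (hv : LiftsTo s (segPath (vtx 1) (vtx 2)) v) (hw : LiftsTo s (segPath (vtx 0) (vtx 2)) w)
    (h : S.label (arr u) + S.label (arr v) = S.label (arr w)) :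
    S.value (tri s hu hv hw) h = rho S hS s := by
  obtain rfl := hu.source
  obtain rfl := hv.source
  obtain rfl := hv.target
  obtain rfl : u = edge s 0 1 := by ext t; exact (hu t).symm
  obtain rfl : v = edge s 1 2 := by ext t; exact (hv t).symm
  obtain rfl : w = edge s 0 2 := by ext t; exact (hw t).symm
  rfl

/-- The value on a singular simplex can be computed in any space with segments through which the
simplex factors. -/
theorem value_tri_eq_rho {D : Type*} [TopologicalSpace D] [SegmentSpace D] (f : C(D, X))
    (s : C(Simp 2, X)) (g : C(Simp 2, D)) (hfg : ∀ z, f (g z) = s z) {a b c : D}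
    {u' : Path a b} {v' : Path b c} {w' : Path a c} {x y z : X} {u : Path x y} {v : Path y z}
    {w : Path x z} (hu : LiftsTo f u' u) (hv : LiftsTo f v' v) (hw : LiftsTo f w' w)
    (gu : LiftsTo g (segPath (vtx 0) (vtx 1)) u') (gv : LiftsTo g (segPath (vtx 1) (vtx 2)) v')
    (gw : LiftsTo g (segPath (vtx 0) (vtx 2)) w')
    (h : S.label (arr u) + S.label (arr v) = S.label (arr w)) :
    S.value (tri f hu hv hw) h = rho S hS s := by
  have su : LiftsTo s (segPath (vtx 0) (vtx 1)) u := fun t =>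
    (hfg _).symm.trans ((congrArg f (gu t)).trans (hu t))
  have sv : LiftsTo s (segPath (vtx 1) (vtx 2)) v := fun t =>
    (hfg _).symm.trans ((congrArg f (gv t)).trans (hv t))
  have sw : LiftsTo s (segPath (vtx 0) (vtx 2)) w := fun t =>
    (hfg _).symm.trans ((congrArg f (gw t)).trans (hw t))
  rw [← rho_eq_of_liftsTo S hS s su sv sw h]
  exact congrArg (fun θ => S.value θ h)
    (can_restrict s f g hfg (su.trans sv) sw (hu.trans hv) hw (gu.trans gv) gw).symm

/-- The cochain of a framing on singular chains. -/
def rhoHom : Chain (Sing X) 2 →+ TwoEnd (⟨e⟩ : PathBicat X) :=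
  chainLift fun s => rho S hS (simplexMap s)

theorem rhoHom_gen (s : C(Simp 2, X)) :
    rhoHom S hS (chainGen (singularSimplex s)) = rho S hS s := by
  rw [rhoHom, chainLift_gen, simplexMap_singularSimplex]

/-- The coboundary of the cochain of a framing is the associativity defect of the loops, evaluated
at the labels of the edges along the spine of a tetrahedron. -/
theorem rhoHom_bdry (hact : ∀ (a : A) (b : TwoEnd (⟨e⟩ : PathBicat X)),
      actR (S.loop a) b.hom = actL b.hom (S.loop a)) (s : C(Simp 3, X)) :
    rhoHom S hS (bdry _ 2 (chainGen (singularSimplex s))) =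
      S.defect (S.label (arr (edge s 0 1))) (S.label (arr (edge s 1 2)))
        (S.label (arr (edge s 2 3))) := by
  have hθ (i j k : Fin 4) : S.label (arr (edge s i j)) + S.label (arr (edge s j k)) =
      S.label (arr (edge s i k)) :=
    hS _ _ _ (tri s (liftsTo_edge s i j) (liftsTo_edge s j k) (liftsTo_edge s i k))
  have hf (φ : Fin 3 → Fin 4) (i j k : Fin 4) (hi : φ 0 = i) (hj : φ 1 = j) (hk : φ 2 = k) :
      S.value (tri s (liftsTo_edge s i j) (liftsTo_edge s j k) (liftsTo_edge s i k))
        (hθ i j k) = rho S hS (s.comp (simpMap φ)) := by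
    subst hi hj hk
    exact value_tri_eq_rho S hS s _ (simpMap φ) (fun _ => rfl) _ _ _ (liftsTo_simpMap φ 0 1)
      (liftsTo_simpMap φ 1 2) (liftsTo_simpMap φ 0 2) _
  have := S.value_add_value hact _ _ _ _ (hθ 0 1 2) (hθ 0 2 3) (hθ 0 1 3) (hθ 1 2 3)
    (tri_tetrahedron s (liftsTo_edge s 0 1) (liftsTo_edge s 1 2) (liftsTo_edge s 2 3)
      (liftsTo_edge s 0 2) (liftsTo_edge s 1 3) (liftsTo_edge s 0 3))
  rw [hf (Fin.succAbove 3) 0 1 2 rfl rfl rfl, hf (Fin.succAbove 1) 0 2 3 rfl rfl rfl,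
    hf (Fin.succAbove 2) 0 1 3 rfl rfl rfl, hf (Fin.succAbove 0) 1 2 3 rfl rfl rfl] at this
  rw [bdry_gen_three]
  simp only [δ_singularSimplex, map_add, map_sub, rhoHom_gen]
  change rho S hS (s.comp (simpMap _)) - rho S hS (s.comp (simpMap _)) +
    rho S hS (s.comp (simpMap _)) - rho S hS (s.comp (simpMap _)) = _
  rw [eq_sub_of_add_eq' this]
  abel

end Cochain

/-! ### Two-dimensional loops as 2-cells, and the value of the cochain on them -/

section GenLoop

variable {X : Type u} [TopologicalSpace X] {x : X}

theorem eval_boundary (f : GenLoop (Fin 2) X x) {a b : I} (h : a = 0 ∨ a = 1 ∨ b = 0 ∨ b = 1) :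
    f.1 ![a, b] = x := by
  refine f.2 _ ?_
  rcases h with h | h | h | h
  · exact ⟨0, .inl h⟩
  · exact ⟨0, .inr h⟩
  · exact ⟨1, .inl h⟩
  · exact ⟨1, .inr h⟩

/-- A 2-dimensional loop as a loop in the space of paths. -/
def genLoopPath (f : GenLoop (Fin 2) X x) : Path (Path.refl x) (Path.refl x) where
  toFun s :=
    { toFun := fun t => f.1 ![s, t]
      continuous_toFun := by fun_prop
      source' := eval_boundary f (by simp)
      target' := eval_boundary f (by simp) }
  continuous_toFun := Path.continuous_uncurry_iff.1 (by
    change Continuous fun z : I × I => f.1 ![z.1, z.2]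
    fun_prop)
  source' := by ext t; exact eval_boundary f (by simp)
  target' := by ext t; exact eval_boundary f (by simp)

/-- The 2-cell of a 2-dimensional loop. -/
def loopCell (f : GenLoop (Fin 2) X x) : TwoEnd (⟨x⟩ : PathBicat X) :=
  ⟨(Path.Homotopic.Quotient.mk (genLoopPath f) : arr (Path.refl x) ⟶ arr (Path.refl x))⟩

theorem vec_two_eta {α : Type*} (p : Fin 2 → α) : ![p 0, p 1] = p := by
  ext i; fin_cases i <;> rfl

theorem loopCell_eq_iff (f g : GenLoop (Fin 2) X x) :
    loopCell f = loopCell g ↔ GenLoop.Homotopic f g := by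
  constructor
  · intro h
    obtain ⟨H⟩ := Path.Homotopic.Quotient.eq.1 (congrArg TwoEnd.hom h)
    refine ⟨{ toFun := fun z => H (z.1, z.2 0) (z.2 1)
              continuous_toFun := by fun_prop
              map_zero_left := fun p => ?_
              map_one_left := fun p => ?_
              prop' := ?_ }⟩
    · rw [H.apply_zero]; exact congrArg f.1 (vec_two_eta p)
    · rw [H.apply_one]; exact congrArg g.1 (vec_two_eta p)
    · rintro s p ⟨i, hi⟩
      refine Eq.trans ?_ (f.2 p ⟨i, hi⟩).symm
      change H (s, p 0) (p 1) = x
      fin_cases i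
      · rcases hi with hi | hi
        · change p 0 = 0 at hi
          rw [hi, H.source]; rfl
        · change p 0 = 1 at hi
          rw [hi, H.target]; rfl
      · rcases hi with hi | hi
        · change p 1 = 0 at hi
          rw [hi, Path.source]
        · change p 1 = 1 at hi
          rw [hi, Path.target]
  · rintro ⟨H⟩
    have hb (s a b : I) (h : a = 0 ∨ a = 1 ∨ b = 0 ∨ b = 1) : H (s, ![a, b]) = x := by
      have hm : ![a, b] ∈ Cube.boundary (Fin 2) := by
        rcases h with h | h | h | h
        · exact ⟨0, .inl h⟩
        · exact ⟨0, .inr h⟩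
        · exact ⟨1, .inl h⟩
        · exact ⟨1, .inr h⟩
      exact (H.eq_fst s hm).trans (f.2 _ hm)
    refine congrArg TwoEnd.mk (Path.Homotopic.Quotient.eq.2
      ⟨{ toFun := fun z =>
          { toFun := fun t => H (z.1, ![z.2, t])
            continuous_toFun := by fun_prop
            source' := hb _ _ _ (by simp)
            target' := hb _ _ _ (by simp) }
         continuous_toFun := Path.continuous_uncurry_iff.1 (by
          change Continuous fun z : (I × I) × I => H (z.1.1, ![z.1.2, z.2])
          fun_prop)
         map_zero_left := fun s => by ext t; exact H.apply_zero _
         map_one_left := fun s => by ext t; exact H.apply_one _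
         prop' := ?_ }⟩)
    rintro s r (rfl | rfl)
    · ext t
      exact (hb _ _ _ (by simp)).trans (by simp)
    · ext t
      exact (hb _ _ _ (by simp)).trans (by simp)

theorem loopCell_surjective (b : TwoEnd (⟨x⟩ : PathBicat X)) :
    ∃ f : GenLoop (Fin 2) X x, loopCell f = b := by
  obtain ⟨b⟩ := b
  induction b using Path.Homotopic.Quotient.ind with | mk Γ =>
  refine ⟨⟨⟨fun p => Γ (p 0) (p 1), by fun_prop⟩, ?_⟩, ?_⟩
  · rintro p ⟨i, hi⟩
    change Γ (p 0) (p 1) = x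
    fin_cases i
    · rcases hi with hi | hi
      · change p 0 = 0 at hi
        rw [hi, Γ.source]; rfl
      · change p 0 = 1 at hi
        rw [hi, Γ.target]; rfl
    · rcases hi with hi | hi
      · change p 1 = 0 at hi
        rw [hi, Path.source]
      · change p 1 = 1 at hi
        rw [hi, Path.target]
  · refine congrArg TwoEnd.mk (congrArg Path.Homotopic.Quotient.mk ?_)
    ext s t
    rfl

theorem affineSimplex_vtx {N : Type*} {m : ℕ} (v : Fin (m + 1) → N → I) (i : Fin (m + 1)) :
    affineSimplex v (vtx i) = v i := by
  ext j
  simp [affineSimplex, Pi.single_apply]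

theorem affineSimplex_seg {N : Type*} {m : ℕ} (v : Fin (m + 1) → N → I) (s : I) (x y : Simp m) :
    affineSimplex v (seg s x y) = seg s (affineSimplex v x) (affineSimplex v y) := by
  ext j
  change ∑ i, ((1 - s) * x i + s * y i) * (v i j : ℝ) =
    (1 - s) * ∑ i, x i * (v i j : ℝ) + s * ∑ i, y i * (v i j : ℝ)
  rw [Finset.mul_sum, Finset.mul_sum, ← Finset.sum_add_distrib]
  exact Finset.sum_congr rfl fun i _ => by ring

theorem liftsTo_affineSimplex {N : Type*} {m : ℕ} (v : Fin (m + 1) → N → I) (i j : Fin (m + 1)) :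
    LiftsTo (affineSimplex v) (segPath (vtx i) (vtx j)) (segPath (v i) (v j)) := fun t => by
  change affineSimplex v (seg t _ _) = seg t _ _
  rw [affineSimplex_seg, affineSimplex_vtx, affineSimplex_vtx]

theorem seg_vec (s a b c d : I) : seg s ![a, b] ![c, d] = ![seg s a c, seg s b d] := by
  ext i; fin_cases i <;> rfl

open Bicategory in
theorem eq_act_of_unitors {C : Type*} [Bicategory C] {x : C} {w : x ⟶ x} (b : TwoEnd x)
    {θ θ' : 𝟙 x ≫ 𝟙 x ⟶ w} (h : (λ_ (𝟙 x ≫ 𝟙 x)).hom ≫ θ' =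
      𝟙 x ◁ (b.hom ▷ 𝟙 x) ≫ 𝟙 x ◁ (ρ_ (𝟙 x)).hom ≫ θ) : θ' = act b θ := by
  rw [← whiskerLeft_comp_assoc, id_whiskerLeft, Category.assoc, cancel_epi] at h
  rw [h, act, ← actL_whiskerRight, actL_unit, ← unitors_equal]
  simp

theorem segPath_self {D : Type*} [TopologicalSpace D] [SegmentSpace D] (a : D) :
    segPath a a = Path.refl a := by
  ext t; exact seg_self _ _

open Bicategory in
/-- The two triangles of a 2-dimensional loop differ by its 2-cell. -/
theorem tri_eq_act_loopCell (f : GenLoop (Fin 2) X x) {d : Path x x}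
    (h₁ : LiftsTo f.1 (segPath ![0, 0] ![1, 0]) (Path.refl x))
    (h₂ : LiftsTo f.1 (segPath ![1, 0] ![1, 1]) (Path.refl x))
    (h₃ : LiftsTo f.1 (segPath ![0, 0] ![0, 1]) (Path.refl x))
    (h₄ : LiftsTo f.1 (segPath ![0, 1] ![1, 1]) (Path.refl x))
    (h : LiftsTo f.1 (segPath ![0, 0] ![1, 1]) d) :
    tri f.1 h₃ h₄ h = act (loopCell f) (tri f.1 h₁ h₂ h) := by
  have h0 : LiftsTo f.1 (Path.refl ![0, 0]) (Path.refl x) := LiftsTo.refl h₁.source.symm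
  have h1 : LiftsTo f.1 (Path.refl ![1, 1]) (Path.refl x) := LiftsTo.refl h₂.target.symm
  -- Sweep the square by vertical segments, joined to the corners along the horizontal edges.
  let Γ' : Path ((Path.refl ![0, 0]).trans ((segPath (D := Fin 2 → I) ![0, 0] ![0, 1]).trans
        (segPath ![0, 1] ![1, 1])))
      ((segPath ![0, 0] ![1, 0]).trans ((segPath (D := Fin 2 → I) ![1, 0] ![1, 1]).trans
        (Path.refl ![1, 1]))) :=
    { toFun := fun s => (segPath ![0, 0] ![s, 0]).trans
        ((segPath (D := Fin 2 → I) ![s, 0] ![s, 1]).trans (segPath ![s, 1] ![1, 1]))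
      continuous_toFun := Path.continuous_uncurry_iff.1 (by
        refine Path.trans_continuous_family _ ?_ _ (Path.trans_continuous_family _ ?_ _ ?_)
        all_goals exact continuous_seg' (by fun_prop) (by fun_prop) (by fun_prop))
      source' := by simp only [segPath_self]
      target' := by simp only [segPath_self] }
  have sweep : arr (Path.refl x) ◁ ((loopCell f).hom ▷ arr (Path.refl x)) =
      can f.1 (h0.trans (h₃.trans h₄)) (h₁.trans (h₂.trans h1)) :=
    mk_eq_can f.1 (h0.trans (h₃.trans h₄)) (h₁.trans (h₂.trans h1)) Γ'
      (((genLoopPath f).map (f := fun q => (Path.refl x).trans (q.trans (Path.refl x)))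
        (by fun_prop))) fun s => LiftsTo.trans (f := f.1) (p' := segPath ![0, 0] ![s, 0])
          (p := Path.refl x)
          (fun t => by
            change f.1 (seg t ![0, 0] ![s, 0]) = x
            rw [seg_vec, seg_self]; exact eval_boundary f (by simp))
          (LiftsTo.trans (f := f.1) (p' := segPath ![s, 0] ![s, 1]) (p := genLoopPath f s)
            (q' := segPath ![s, 1] ![1, 1]) (q := Path.refl x)
            (fun t => by
              change f.1 (seg t ![s, 0] ![s, 1]) = f.1 ![s, t]
              rw [seg_vec, seg_self]
              refine congrArg f.1 (congrArg (fun r : I => ![s, r]) (Subtype.ext ?_))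
              change (1 - (t : ℝ)) * 0 + t * 1 = t
              ring)
            (fun t => by
              change f.1 (seg t ![s, 1] ![1, 1]) = x
              rw [seg_vec, seg_self]; exact eval_boundary f (by simp)))
  refine eq_act_of_unitors (C := PathBicat X) (x := ⟨x⟩) (loopCell f) ?_
  refine (congrArg (· ≫ _) (leftUnitIso_hom_eq f.1 (h₃.trans h₄) h0)).trans ?_
  refine .trans ?_ (congrArg₂ (· ≫ ·) sweep (congrArg (· ≫ _)
    ((congrArg (whiskerL (Path.refl x)).map (rightUnitIso_hom_eq f.1 h₂ h1)).trans
      (whiskerL_can f.1 h₁ _ _)))).symm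
  refine .trans ?_ (congrArg (_ ≫ ·) (can_comp_can f.1 _ _ _)).symm
  exact (can_comp_can f.1 _ _ _).trans (can_comp_can f.1 _ _ _).symm

variable {e : X} {A : Type*} [AddSemigroup A] (S : Framing (⟨e⟩ : PathBicat X) A)
  (hS : S.IsAdditive)

/-- The 2-chain of a square, as an element. -/
def squareElt (F : C(Fin 2 → I, X)) : Chain (Sing X) 2 := evalOne _ (squareChain F)

theorem squareElt_eq (F : C(Fin 2 → I, X)) : squareElt F =
    chainGen (singularSimplex (F.comp (affineSimplex ![![0, 0], ![1, 0], ![1, 1]]))) -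
      chainGen (singularSimplex (F.comp (affineSimplex ![![0, 0], ![0, 1], ![1, 1]]))) :=
  map_sub (evalOne _) _ _

/-- On the square of a 2-dimensional loop the cochain recovers the homotopy class of the loop, up to
transport to the base point and sign. -/
theorem rhoHom_squareElt (f : GenLoop (Fin 2) X x) (b : TwoEnd (⟨e⟩ : PathBicat X))
    (hb : actR (S.base ⟨x⟩) (loopCell f).hom = actL b.hom (S.base ⟨x⟩)) :
    rhoHom S hS (squareElt f.1) = -b := by
  let d : Path x x :=
    { toFun := fun t => f.1 (seg t ![0, 0] ![1, 1])
      continuous_toFun := f.1.continuous.comp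
        (continuous_seg' (by fun_prop) (by fun_prop) (by fun_prop))
      source' := by rw [seg_zero]; exact eval_boundary f (by simp)
      target' := by rw [seg_one]; exact eval_boundary f (by simp) }
  have h₁ : LiftsTo f.1 (segPath ![0, 0] ![1, 0]) (Path.refl x) := fun t => by
    change f.1 (seg t ![0, 0] ![1, 0]) = x
    rw [seg_vec, seg_self]; exact eval_boundary f (by simp)
  have h₂ : LiftsTo f.1 (segPath ![1, 0] ![1, 1]) (Path.refl x) := fun t => by
    change f.1 (seg t ![1, 0] ![1, 1]) = x
    rw [seg_vec, seg_self]; exact eval_boundary f (by simp)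
  have h₃ : LiftsTo f.1 (segPath ![0, 0] ![0, 1]) (Path.refl x) := fun t => by
    change f.1 (seg t ![0, 0] ![0, 1]) = x
    rw [seg_vec, seg_self]; exact eval_boundary f (by simp)
  have h₄ : LiftsTo f.1 (segPath ![0, 1] ![1, 1]) (Path.refl x) := fun t => by
    change f.1 (seg t ![0, 1] ![1, 1]) = x
    rw [seg_vec, seg_self]; exact eval_boundary f (by simp)
  have h : LiftsTo f.1 (segPath ![0, 0] ![1, 1]) d := fun _ => rfl
  have hl := hS _ _ _ (tri f.1 h₁ h₂ h)
  have e₁ := value_tri_eq_rho S hS f.1 (f.1.comp (affineSimplex _))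
    (affineSimplex ![![0, 0], ![1, 0], ![1, 1]])
    (fun _ => rfl) h₁ h₂ h (liftsTo_affineSimplex _ 0 1) (liftsTo_affineSimplex _ 1 2)
    (liftsTo_affineSimplex _ 0 2) hl
  have e₂ := value_tri_eq_rho S hS f.1 (f.1.comp (affineSimplex _))
    (affineSimplex ![![0, 0], ![0, 1], ![1, 1]])
    (fun _ => rfl) h₃ h₄ h (liftsTo_affineSimplex _ 0 1) (liftsTo_affineSimplex _ 1 2)
    (liftsTo_affineSimplex _ 0 2) hl
  rw [tri_eq_act_loopCell f h₁ h₂ h₃ h₄ h, S.value_act _ _ _ b hb] at e₂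
  rw [squareElt_eq, map_sub, rhoHom_gen, rhoHom_gen]
  refine (congrArg₂ (· - ·) e₁ e₂).symm.trans ?_
  abel

theorem hurewicz_mk (f : GenLoop (Fin 2) X x) (hf : bdry (Sing X) 1 (squareElt f.1) = 0) :
    hurewicz X x (Additive.ofMul ⟦f⟧) = homologyClass (Sing X) ⟨squareElt f.1, hf⟩ := by
  refine Eq.symm (cycleClass_eq _ (c := ((chains X).liftCycles (squareChain f.1) 1
    (ChainComplex.next_nat_succ 1) (squareChain_d f)).hom ⟨1⟩) ?_)
  exact congrArg (evalOne _) ((chains X).liftCycles_i (squareChain f.1) 1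
    (ChainComplex.next_nat_succ 1) (squareChain_d f))

theorem bdry_squareElt (f : GenLoop (Fin 2) X x) : bdry (Sing X) 1 (squareElt f.1) = 0 :=
  congrArg (evalOne _) (squareChain_d f)

end GenLoop

/-! ### Fundamental groups, framings, and push-forward of systems of loops -/

section PiOne

variable {X : Type u} [TopologicalSpace X]

/-- The homotopy class of a path, as a morphism of the fundamental groupoid. -/
def cls {x y : X} (p : Path x y) : FundamentalGroupoid.mk x ⟶ FundamentalGroupoid.mk y :=
  Path.Homotopic.Quotient.mk p

theorem cls_trans {x y z : X} (p : Path x y) (q : Path y z) : cls (p.trans q) = cls p ≫ cls q := rfl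

theorem cls_eq_iff {x y : X} {p q : Path x y} : cls p = cls q ↔ Path.Homotopic p q :=
  Path.Homotopic.Quotient.eq

/-- The fundamental group, written additively, with concatenation of paths as addition. -/
@[ext]
structure PiOne (e : X) where
  /-- The underlying morphism of the fundamental groupoid. -/
  hom : FundamentalGroupoid.mk e ⟶ FundamentalGroupoid.mk e

instance (e : X) : AddGroup (PiOne e) where
  add a b := ⟨a.hom ≫ b.hom⟩
  zero := ⟨𝟙 _⟩
  neg a := ⟨inv a.hom⟩
  add_assoc _ _ _ := PiOne.ext (Category.assoc _ _ _)
  zero_add _ := PiOne.ext (Category.id_comp _)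
  add_zero _ := PiOne.ext (Category.comp_id _)
  nsmul := @nsmulRec _ ⟨⟨𝟙 _⟩⟩ ⟨fun b b' => ⟨b.hom ≫ b'.hom⟩⟩
  nsmul_zero _ := rfl
  nsmul_succ _ _ := rfl
  zsmul := @zsmulRec _ ⟨⟨𝟙 _⟩⟩ ⟨fun b b' => ⟨b.hom ≫ b'.hom⟩⟩ ⟨fun b => ⟨inv b.hom⟩⟩
    (@nsmulRec _ ⟨⟨𝟙 _⟩⟩ ⟨fun b b' => ⟨b.hom ≫ b'.hom⟩⟩)
  zsmul_zero' _ := rfl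
  zsmul_succ' _ _ := rfl
  zsmul_neg' _ _ := rfl
  neg_add_cancel a := PiOne.ext (IsIso.inv_hom_id a.hom)

theorem PiOne.add_hom {e : X} (a b : PiOne e) : (a + b).hom = a.hom ≫ b.hom := rfl

variable {e : X} (p : ∀ x, Path e x)

/-- The element of the fundamental group that belongs to a path, once each point is joined to the
base point. -/
def loopLabel {x y : X} (w : Path x y) : PiOne e := ⟨cls (p x) ≫ cls w ≫ inv (cls (p y))⟩

theorem loopLabel_congr {x y : X} {w w' : Path x y} (h : Path.Homotopic w w') :
    loopLabel p w = loopLabel p w' := by rw [loopLabel, cls_eq_iff.2 h, loopLabel]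

theorem loopLabel_trans {x y z : X} (w : Path x y) (w' : Path y z) :
    loopLabel p (w.trans w') = loopLabel p w + loopLabel p w' := by
  ext
  simp [loopLabel, cls_trans, PiOne.add_hom]

variable {A : Type*} [AddGroup A]

/-- The loops of the system represent the elements of the fundamental group that correspond to
their indices. -/
def LoopSystem.Represents (L : LoopSystem (⟨e⟩ : PathBicat X) A) (ι : A ≃+ PiOne e) : Prop :=
  ∀ a, cls (L.loop a).as = (ι a).hom

theorem exists_loopSystem (ι : A ≃+ PiOne e) :
    ∃ L : LoopSystem (⟨e⟩ : PathBicat X) A, L.Represents ι := by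
  have h (a : A) : ∃ γ : Path e e, cls γ = (ι a).hom := Path.Homotopic.Quotient.mk_surjective _
  choose γ hγ using h
  have h2 (a b c : A) (hc : a + b = c) : Nonempty (arr (γ a) ≫ arr (γ b) ⟶ arr (γ c)) := by
    refine nonempty_twoCell.2 (cls_eq_iff.1 ?_)
    refine (congrArg₂ (· ≫ ·) (hγ a) (hγ b)).trans (.trans ?_ (hγ c).symm)
    rw [← PiOne.add_hom, ← map_add, hc]
  exact ⟨⟨fun a => arr (γ a), fun a b c hc => (h2 a b c hc).some⟩, hγ⟩

theorem nonempty_frame {L : LoopSystem (⟨e⟩ : PathBicat X) A} {ι : A ≃+ PiOne e}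
    (hL : L.Represents ι) {x y : PathBicat X} (w : x ⟶ y) :
    Nonempty ((arr (p x.pt) ≫ w : (⟨e⟩ : PathBicat X) ⟶ y) ⟶
      L.loop (ι.symm (loopLabel p w.as)) ≫ arr (p y.pt)) := by
  refine nonempty_twoCell.2 (cls_eq_iff.1 ?_)
  refine .trans ?_ (congrArg (· ≫ cls (p y.pt)) (hL _)).symm
  rw [AddEquiv.apply_symm_apply]
  change cls (p x.pt) ≫ cls w.as = (cls _ ≫ cls _ ≫ inv (cls _)) ≫ cls _
  simp

/-- The framing given by a system of loops that represents the fundamental group and by a path from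
the base point to each point. -/
def pathFraming {L : LoopSystem (⟨e⟩ : PathBicat X) A} {ι : A ≃+ PiOne e}
    (hL : L.Represents ι) : Framing (⟨e⟩ : PathBicat X) A where
  toLoopSystem := L
  base x := arr (p x.pt)
  label w := ι.symm (loopLabel p w.as)
  frame w := (nonempty_frame p hL w).some

theorem pathFraming_isAdditive {L : LoopSystem (⟨e⟩ : PathBicat X) A} {ι : A ≃+ PiOne e}
    (hL : L.Represents ι) : (pathFraming p hL).IsAdditive := by
  intro x y z u v w θ
  change ι.symm _ + ι.symm _ = ι.symm _
  rw [← map_add, ← loopLabel_trans]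
  exact congrArg ι.symm (loopLabel_congr p (nonempty_twoCell.1 ⟨θ⟩))

end PiOne

section Push

open Bicategory

variable {X : Type u} {Y : Type v} [TopologicalSpace X] [TopologicalSpace Y] (f : C(X, Y))

/-- The image of a 1-cell under a continuous map. -/
def map₁ {x y : X} (p : (⟨x⟩ : PathBicat X) ⟶ ⟨y⟩) : (⟨f x⟩ : PathBicat Y) ⟶ ⟨f y⟩ :=
  (mapGpd f).obj p

/-- The image of a 2-cell under a continuous map. -/
def map₂ {x y : X} {p q : (⟨x⟩ : PathBicat X) ⟶ ⟨y⟩} (θ : p ⟶ q) : map₁ f p ⟶ map₁ f q :=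
  (mapGpd f).map θ

theorem map₂_comp {x y : X} {p q r : (⟨x⟩ : PathBicat X) ⟶ ⟨y⟩} (θ : p ⟶ q) (η : q ⟶ r) :
    map₂ f (θ ≫ η) = map₂ f θ ≫ map₂ f η := (mapGpd f).map_comp θ η

theorem map₂_id {x y : X} (p : (⟨x⟩ : PathBicat X) ⟶ ⟨y⟩) : map₂ f (𝟙 p) = 𝟙 _ :=
  (mapGpd f).map_id p

theorem map₁_comp {x y z : X} (p : (⟨x⟩ : PathBicat X) ⟶ ⟨y⟩) (q : (⟨y⟩ : PathBicat X) ⟶ ⟨z⟩) :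
    map₁ f (p ≫ q) = map₁ f p ≫ map₁ f q :=
  congrArg FundamentalGroupoid.mk (Path.map_trans p.as q.as f.continuous)

theorem map₁_id_comp {x y : X} (p : (⟨x⟩ : PathBicat X) ⟶ ⟨y⟩) :
    map₁ f (𝟙 _ ≫ p) = 𝟙 _ ≫ map₁ f p := map₁_comp f _ _

theorem map₁_comp_id {x y : X} (p : (⟨x⟩ : PathBicat X) ⟶ ⟨y⟩) :
    map₁ f (p ≫ 𝟙 _) = map₁ f p ≫ 𝟙 _ := map₁_comp f _ _

theorem map₂_whiskerLeft {x y z : X} (p : (⟨x⟩ : PathBicat X) ⟶ ⟨y⟩)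
    {q r : (⟨y⟩ : PathBicat X) ⟶ ⟨z⟩} (θ : q ⟶ r) :
    map₂ f (p ◁ θ) = eqToHom (map₁_comp f p q) ≫ map₁ f p ◁ map₂ f θ ≫
      eqToHom (map₁_comp f p r).symm := by
  have e : (whiskerL p.as ⋙ mapGpd f : PathGpd y z ⥤ PathGpd (f x) (f z)) =
      mapGpd f ⋙ whiskerL (p.as.map f.continuous) := by
    refine (FundamentalGroupoid.map_comp _ _).symm.trans (.trans (congrArg _ ?_)
      (FundamentalGroupoid.map_comp _ _))
    ext1 q
    exact Path.map_trans p.as q f.continuous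
  exact Functor.congr_hom e θ

theorem map₂_whiskerRight {x y z : X} {p q : (⟨x⟩ : PathBicat X) ⟶ ⟨y⟩} (θ : p ⟶ q)
    (r : (⟨y⟩ : PathBicat X) ⟶ ⟨z⟩) :
    map₂ f (θ ▷ r) = eqToHom (map₁_comp f p r) ≫ map₂ f θ ▷ map₁ f r ≫
      eqToHom (map₁_comp f q r).symm := by
  have e : (whiskerR r.as ⋙ mapGpd f : PathGpd x y ⥤ PathGpd (f x) (f z)) =
      mapGpd f ⋙ whiskerR (r.as.map f.continuous) := by
    refine (FundamentalGroupoid.map_comp _ _).symm.trans (.trans (congrArg _ ?_)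
      (FundamentalGroupoid.map_comp _ _))
    ext1 q
    exact Path.map_trans q r.as f.continuous
  exact Functor.congr_hom e θ

theorem can_congr {D : Type*} [TopologicalSpace D] [SegmentSpace D] (g : C(D, Y)) {a b : D}
    {x y : Y} {p' q' : Path a b} {p q p₁ q₁ : Path x y} (hp : LiftsTo g p' p) (hq : LiftsTo g q' q)
    (hp₁ : LiftsTo g p' p₁) (hq₁ : LiftsTo g q' q₁) (ep : FundamentalGroupoid.mk p = .mk p₁)
    (eq : FundamentalGroupoid.mk q₁ = .mk q) :
    can g hp hq = eqToHom ep ≫ can g hp₁ hq₁ ≫ eqToHom eq := by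
  obtain rfl : p = p₁ := by ext t; exact (hp t).symm.trans (hp₁ t)
  obtain rfl : q = q₁ := by ext t; exact (hq t).symm.trans (hq₁ t)
  simp

theorem map₂_associator {x y z w : X} (p : (⟨x⟩ : PathBicat X) ⟶ ⟨y⟩)
    (q : (⟨y⟩ : PathBicat X) ⟶ ⟨z⟩) (r : (⟨z⟩ : PathBicat X) ⟶ ⟨w⟩) :
    map₂ f (α_ p q r).hom = eqToHom (by rw [map₁_comp, map₁_comp]) ≫
      (α_ (map₁ f p) (map₁ f q) (map₁ f r)).hom ≫ eqToHom (by rw [map₁_comp, map₁_comp]) := by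
  obtain ⟨g, b, c, d, p', q', r', -, hp, hq, hr⟩ := exists_lift_three p.as q.as r.as
  have hp₁ : LiftsTo (f.comp g) p' (p.as.map f.continuous) := fun t => congrArg f (hp t)
  have hq₁ : LiftsTo (f.comp g) q' (q.as.map f.continuous) := fun t => congrArg f (hq t)
  have hr₁ : LiftsTo (f.comp g) r' (r.as.map f.continuous) := fun t => congrArg f (hr t)
  refine (congrArg (mapGpd f).map (assocIso_hom_eq g hp hq hr)).trans ?_
  refine (mapGpd_can f g _ _).trans ?_
  refine (can_congr (f.comp g) _ _ ((hp₁.trans hq₁).trans hr₁) (hp₁.trans (hq₁.trans hr₁))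
    ?_ ?_).trans (congrArg (eqToHom _ ≫ · ≫ eqToHom _) (assocIso_hom_eq _ hp₁ hq₁ hr₁).symm)
  · exact congrArg FundamentalGroupoid.mk (by rw [Path.map_trans, Path.map_trans])
  · exact congrArg FundamentalGroupoid.mk (by rw [Path.map_trans, Path.map_trans])

theorem map₂_leftUnitor {x y : X} (p : (⟨x⟩ : PathBicat X) ⟶ ⟨y⟩) :
    map₂ f (λ_ p).hom = eqToHom (map₁_id_comp f p) ≫ (λ_ (map₁ f p)).hom := by
  obtain ⟨g, p', hp⟩ := exists_lift_one p.as
  have hp₁ : LiftsTo (f.comp g) p' (p.as.map f.continuous) := fun t => congrArg f (hp t)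
  have h0 : LiftsTo g (Path.refl 0) (Path.refl x) := LiftsTo.refl hp.source.symm
  have h0₁ : LiftsTo (f.comp g) (Path.refl 0) (Path.refl (f x)) := fun t => congrArg f (h0 t)
  refine (congrArg (mapGpd f).map (leftUnitIso_hom_eq g hp h0)).trans ?_
  refine (mapGpd_can f g _ _).trans ?_
  refine (can_congr (f.comp g) _ _ (h0₁.trans hp₁) hp₁
    (congrArg FundamentalGroupoid.mk (Path.map_trans _ _ _)) rfl).trans ?_
  rw [eqToHom_refl, Category.comp_id]
  exact congrArg (eqToHom _ ≫ ·) (leftUnitIso_hom_eq _ hp₁ h0₁).symm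

theorem map₂_rightUnitor {x y : X} (p : (⟨x⟩ : PathBicat X) ⟶ ⟨y⟩) :
    map₂ f (ρ_ p).hom = eqToHom (map₁_comp_id f p) ≫ (ρ_ (map₁ f p)).hom := by
  obtain ⟨g, p', hp⟩ := exists_lift_one p.as
  have hp₁ : LiftsTo (f.comp g) p' (p.as.map f.continuous) := fun t => congrArg f (hp t)
  have h0 : LiftsTo g (Path.refl 1) (Path.refl y) := LiftsTo.refl hp.target.symm
  have h0₁ : LiftsTo (f.comp g) (Path.refl 1) (Path.refl (f y)) := fun t => congrArg f (h0 t)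
  refine (congrArg (mapGpd f).map (rightUnitIso_hom_eq g hp h0)).trans ?_
  refine (mapGpd_can f g _ _).trans ?_
  refine (can_congr (f.comp g) _ _ (hp₁.trans h0₁) hp₁
    (congrArg FundamentalGroupoid.mk (Path.map_trans _ _ _)) rfl).trans ?_
  rw [eqToHom_refl, Category.comp_id]
  exact congrArg (eqToHom _ ≫ ·) (rightUnitIso_hom_eq _ hp₁ h0₁).symm

/-- The homomorphism on second homotopy groups induced by a continuous map. -/
def mapTwoEnd (x : X) : TwoEnd (⟨x⟩ : PathBicat X) →+ TwoEnd (⟨f x⟩ : PathBicat Y) where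
  toFun b := ⟨map₂ f b.hom⟩
  map_zero' := TwoEnd.ext (map₂_id f _)
  map_add' b b' := TwoEnd.ext (map₂_comp f b.hom b'.hom)

theorem map₂_actL {x y : X} (b : TwoEnd (⟨x⟩ : PathBicat X)) (u : (⟨x⟩ : PathBicat X) ⟶ ⟨y⟩) :
    map₂ f (actL b.hom u) = actL (mapTwoEnd f x b).hom (map₁ f u) := by
  have h : (λ_ u).hom ≫ actL b.hom u = b.hom ▷ u ≫ (λ_ u).hom := by simp [actL]
  have hw : map₂ f (b.hom ▷ u) = eqToHom (map₁_id_comp f u) ≫ (mapTwoEnd f x b).hom ▷ map₁ f u ≫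
        eqToHom (map₁_id_comp f u).symm :=
    map₂_whiskerRight f b.hom u
  have := congrArg (map₂ f) h
  rw [map₂_comp, map₂_comp, map₂_leftUnitor, hw, Category.assoc, Category.assoc,
    Category.assoc, cancel_epi, eqToHom_trans_assoc, eqToHom_refl, Category.id_comp] at this
  rw [← cancel_epi (λ_ (map₁ f u)).hom, this]
  simp [actL]

theorem map₂_actR {x y : X} (b : TwoEnd (⟨y⟩ : PathBicat X)) (u : (⟨x⟩ : PathBicat X) ⟶ ⟨y⟩) :
    map₂ f (actR u b.hom) = actR (map₁ f u) (mapTwoEnd f y b).hom := by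
  have h : (ρ_ u).hom ≫ actR u b.hom = u ◁ b.hom ≫ (ρ_ u).hom := by simp [actR]
  have hw : map₂ f (u ◁ b.hom) = eqToHom (map₁_comp_id f u) ≫ map₁ f u ◁ (mapTwoEnd f y b).hom ≫
        eqToHom (map₁_comp_id f u).symm :=
    map₂_whiskerLeft f u b.hom
  have := congrArg (map₂ f) h
  rw [map₂_comp, map₂_comp, map₂_rightUnitor, hw, Category.assoc, Category.assoc,
    Category.assoc, cancel_epi, eqToHom_trans_assoc, eqToHom_refl, Category.id_comp] at this
  rw [← cancel_epi (ρ_ (map₁ f u)).hom, this]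
  simp [actR]

theorem map₂_act {x y : X} (b : TwoEnd (⟨x⟩ : PathBicat X)) {u v : (⟨x⟩ : PathBicat X) ⟶ ⟨y⟩}
    (θ : u ⟶ v) : map₂ f (act b θ) = act (mapTwoEnd f x b) (map₂ f θ) := by
  rw [act, map₂_comp, map₂_actL, act]

/-- The image of a system of loops under a continuous map. -/
def LoopSystem.push {e : X} {A : Type*} [Add A] (L : LoopSystem (⟨e⟩ : PathBicat X) A) :
    LoopSystem (⟨f e⟩ : PathBicat Y) A where
  loop a := map₁ f (L.loop a)
  mul a b c h := eqToHom (map₁_comp f _ _).symm ≫ map₂ f (L.mul a b c h)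

theorem LoopSystem.defect_push {e : X} {A : Type*} [AddSemigroup A]
    (L : LoopSystem (⟨e⟩ : PathBicat X) A) (a b c : A) :
    (L.push f).defect a b c = mapTwoEnd f e (L.defect a b c) := by
  refine twoDiff_eq ?_
  have := congrArg (map₂ f) (L.act_defect (a := a) (b := b) (c := c) rfl rfl rfl
    (add_assoc a b c).symm)
  rw [map₂_act, map₂_comp, map₂_comp, map₂_comp, map₂_whiskerLeft, map₂_whiskerRight,
    map₂_associator] at this
  have e : (map₁ f (L.loop a) ≫ map₁ f (L.loop b)) ≫ map₁ f (L.loop c) =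
      map₁ f ((L.loop a ≫ L.loop b) ≫ L.loop c) := by rw [map₁_comp, map₁_comp]
  have h := congrArg (eqToHom e ≫ ·) this
  simp only [comp_act] at h
  refine Eq.trans ?_ (h.symm.trans ?_)
  · simp [LoopSystem.push, whiskerLeft_eqToHom]
  · simp [LoopSystem.push, eqToHom_whiskerRight]

end Push

/-! ### Symmetric 3-cocycles are coboundaries -/

section Algebra

/-- The coboundary of a 2-cochain. -/
def coboundary {G B : Type*} [AddCommGroup G] [AddCommGroup B] (m : G → G → B) (a b c : G) : B :=
  m b c - m (a + b) c + m a (b + c) - m a b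

/-- A 3-cocycle `k` together with a symmetry `c`: a function that satisfies the hexagon relation
relative to `k`, and is skew-symmetric. -/
structure IsSymmetricCocycle {A B : Type*} [AddCommGroup A] [AddCommGroup B]
    (k : A → A → A → B) (c : A → A → B) : Prop where
  cocycle : ∀ x y z w, k y z w - k (x + y) z w + k x (y + z) w - k x y (z + w) + k x y z = 0
  hexagon : ∀ x y z, c x (y + z) - c x y - c x z = k x y z - k y x z + k y z x
  skew : ∀ x y, c x y + c y x = 0

/-- The additional normalization: the cocycle vanishes if one argument is zero, and the symmetry is
alternating. -/
structure IsNormalizedCocycle {A B : Type*} [AddCommGroup A] [AddCommGroup B]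
    (k : A → A → A → B) (c : A → A → B) : Prop extends IsSymmetricCocycle k c where
  zero_left : ∀ y z, k 0 y z = 0
  zero_mid : ∀ x z, k x 0 z = 0
  zero_right : ∀ x y, k x y 0 = 0
  alt : ∀ x, c x x = 0

/-- A trivialization of a cocycle and its symmetry, pulled back along a homomorphism. -/
structure IsTrivialization {A B G : Type*} [AddCommGroup A] [AddCommGroup B] [AddCommGroup G]
    (k : A → A → A → B) (c : A → A → B) (θ : G →+ A) (m : G → G → B) : Prop where
  coboundary_eq : ∀ x y z, coboundary m x y z = k (θ x) (θ y) (θ z)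
  sub_swap : ∀ x y, m x y - m y x = c (θ x) (θ y)
  zero : m 0 0 = 0

section General

variable {A B : Type*} [AddCommGroup A] [AddCommGroup B]

theorem coboundary_cocycle (m : A → A → B) (x y z w : A) :
    coboundary m y z w - coboundary m (x + y) z w + coboundary m x (y + z) w -
      coboundary m x y (z + w) + coboundary m x y z = 0 := by
  simp only [coboundary, add_assoc]
  abel

theorem coboundary_hexagon (m : A → A → B) (x y z : A) :
    (m x (y + z) - m (y + z) x) - (m x y - m y x) - (m x z - m z x) =
      coboundary m x y z - coboundary m y x z + coboundary m y z x := by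
  simp only [coboundary, add_comm y x, add_comm z x]
  abel

theorem IsSymmetricCocycle.sub_coboundary {k : A → A → A → B} {c : A → A → B}
    (h : IsSymmetricCocycle k c) (m : A → A → B) :
    IsSymmetricCocycle (fun x y z => k x y z - coboundary m x y z)
      (fun x y => c x y - (m x y - m y x)) where
  cocycle x y z w := by
    have h1 := h.cocycle x y z w
    have h2 := coboundary_cocycle m x y z w
    rw [← sub_eq_zero.2 (h1.trans h2.symm)]
    abel
  hexagon x y z := by
    have h1 := h.hexagon x y z
    have h2 := coboundary_hexagon m x y z
    rw [← sub_eq_zero] at h1 h2 ⊢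
    rw [← sub_eq_zero.2 (h1.trans h2.symm)]
    abel
  skew x y := by
    have h1 := h.skew x y
    rw [← h1]
    abel

theorem IsSymmetricCocycle.exists_normalized {k : A → A → A → B} {c : A → A → B}
    (h : IsSymmetricCocycle k c) : ∃ m : A → A → B,
      (∀ y z, k 0 y z = coboundary m 0 y z) ∧ (∀ x z, k x 0 z = coboundary m x 0 z) ∧
        ∀ x y, k x y 0 = coboundary m x y 0 := by
  have h0 : k 0 0 0 = 0 := by simpa using h.cocycle 0 0 0 0
  refine ⟨fun x y => k 0 0 y - k x 0 0, fun y z => ?_, fun x z => ?_, fun x y => ?_⟩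
  · have := h.cocycle 0 0 y z
    simp only [zero_add] at this
    simp only [coboundary, zero_add, h0]
    rw [← sub_eq_zero, ← this]
    abel
  · have := h.cocycle x 0 0 z
    simp only [zero_add, add_zero] at this
    simp only [coboundary, zero_add, add_zero, h0]
    rw [← sub_eq_zero, ← sub_eq_zero.2 this]
    abel
  · have := h.cocycle x y 0 0
    simp only [add_zero] at this
    simp only [coboundary, add_zero, h0]
    rw [← sub_eq_zero, ← this]
    abel

/-- The diagonal of the symmetry is additive. -/
theorem IsSymmetricCocycle.diag_add {k : A → A → A → B} {c : A → A → B}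
    (h : IsSymmetricCocycle k c) (x y : A) : c (x + y) (x + y) = c x x + c y y := by
  have e₁ := h.hexagon (x + y) x y
  have e₂ := h.hexagon x x y
  have e₃ := h.hexagon y x y
  have s₁ := h.skew (x + y) x
  have s₂ := h.skew (x + y) y
  have s₃ := h.skew x x
  have s₄ := h.skew y y
  have s₅ := h.skew x y
  have e := h.cocycle x y x y
  rw [add_comm y x] at e
  rw [← sub_eq_zero] at e₁ e₂ e₃ ⊢
  have : c (x + y) (x + y) - (c x x + c y y) =
    (c (x + y) (x + y) - c (x + y) x - c (x + y) y - (k (x + y) x y - k x (x + y) y + k x y (x + y)))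
    - (c x (x + y) - c x x - c x y - (k x x y - k x x y + k x y x))
    - (c y (x + y) - c y x - c y y - (k y x y - k x y y + k x y y))
    + (c (x + y) x + c x (x + y)) + (c (x + y) y + c y (x + y))
    - (c x x + c x x) - (c y y + c y y) - (c x y + c y x)
    - (k y x y - k (x + y) x y + k x (x + y) y - k x y (x + y) + k x y x) := by abel
  rw [this, e₁, e₂, e₃, s₁, s₂, s₃, s₄, s₅, e]
  simp

/-- A homomorphism with values of order 2 is the diagonal of a symmetric biadditive map. -/
theorem exists_biadditive_diag (q : A →+ B) (hq : ∀ a, q a + q a = 0) :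
    ∃ ψ : A → A → B, (∀ x y z, ψ x (y + z) = ψ x y + ψ x z) ∧ (∀ x y, ψ x y = ψ y x) ∧
      (∀ x y, ψ x y + ψ x y = 0) ∧ ∀ x, ψ x x = q x := by
  let N : AddSubgroup A := (zsmulAddGroupHom (2 : ℤ) : A →+ A).range
  have hN (x : A) : x + x ∈ N := ⟨x, two_zsmul x⟩
  let _ : Module (ZMod 2) (A ⧸ N) := AddCommGroup.zmodModule (n := 2) fun x => by
    induction x using QuotientAddGroup.induction_on with | H x =>
    rw [two_nsmul]
    exact (QuotientAddGroup.eq_zero_iff _).2 (hN x)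
  let q' : A ⧸ N →+ B := QuotientAddGroup.lift N q (by
    rintro _ ⟨x, rfl⟩
    change q ((2 : ℤ) • x) = 0
    rw [two_zsmul, map_add, hq])
  let b := Module.Basis.ofVectorSpace (ZMod 2) (A ⧸ N)
  let r : A →+ (_ →₀ ZMod 2) := b.repr.toLinearMap.toAddMonoidHom.comp (QuotientAddGroup.mk' N)
  refine ⟨fun x y => q' (b.repr.symm (r x * r y)), fun x y z => ?_, fun x y => ?_, fun x y => ?_,
    fun x => ?_⟩
  · beta_reduce
    rw [map_add, mul_add, map_add, map_add]
  · beta_reduce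
    rw [mul_comm]
  · beta_reduce
    generalize b.repr.symm (r x * r y) = z
    induction z using QuotientAddGroup.induction_on with | H x =>
    exact hq x
  · have : r x * r x = r x := by
      ext i
      have h2 (t : ZMod 2) : t * t = t := by revert t; decide
      exact h2 _
    beta_reduce
    rw [this]
    change q' (b.repr.symm (b.repr (QuotientAddGroup.mk' N x))) = q x
    rw [LinearEquiv.symm_apply_apply]
    rfl

theorem exists_primitive (φ : ℤ → B) (b : B) :
    ∃ f : ℤ → B, f 0 = b ∧ ∀ i, f (i + 1) = f i + φ i := by
  refine ⟨fun i => b + (∑ j ∈ Finset.Ico 0 i, φ j - ∑ j ∈ Finset.Ico i 0, φ j), by simp, fun i => ?_⟩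
  beta_reduce
  rcases le_or_gt 0 i with h | h
  · rw [Finset.Ico_eq_empty (a := i) (by omega), Finset.Ico_eq_empty (a := i + 1) (by omega),
      ← Finset.insert_Ico_right_eq_Ico_add_one h, Finset.sum_insert (by simp)]
    simp only [Finset.sum_empty]
    abel
  · rw [Finset.Ico_eq_empty (b := i) (by omega), Finset.Ico_eq_empty (b := i + 1) (by omega),
      ← Finset.insert_Ico_add_one_left_eq_Ico h, Finset.sum_insert (by simp)]
    simp only [Finset.sum_empty]
    abel

theorem IsNormalizedCocycle.symm_zero {k : A → A → A → B} {c : A → A → B}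
    (h : IsNormalizedCocycle k c) (x : A) : c x 0 = 0 := by
  simpa [h.zero_left, h.zero_mid, h.zero_right] using h.hexagon x 0 0

theorem IsNormalizedCocycle.zero_symm {k : A → A → A → B} {c : A → A → B}
    (h : IsNormalizedCocycle k c) (x : A) : c 0 x = 0 := by
  simpa [h.symm_zero] using h.skew x 0

theorem IsTrivialization.zero_apply {G : Type*} [AddCommGroup G] {k : A → A → A → B}
    {c : A → A → B} {θ : G →+ A} {m : G → G → B} (hm : IsTrivialization k c θ m)
    (h : IsNormalizedCocycle k c) (x : G) : m 0 x = 0 := by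
  simpa [coboundary, h.zero_left, hm.zero] using hm.coboundary_eq 0 0 x

theorem IsTrivialization.apply_zero {G : Type*} [AddCommGroup G] {k : A → A → A → B}
    {c : A → A → B} {θ : G →+ A} {m : G → G → B} (hm : IsTrivialization k c θ m)
    (h : IsNormalizedCocycle k c) (x : G) : m x 0 = 0 := by
  simpa [coboundary, h.zero_right, hm.zero] using hm.coboundary_eq x 0 0

end General

theorem int_eq_of_add_one {B : Type*} {f : ℤ → B} (h : ∀ i, f (i + 1) = f i) (i : ℤ) :
    f i = f 0 := by
  induction i with
  | zero => rfl
  | succ i ih => rw [h, ih]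
  | pred i ih => rw [← ih, ← h, sub_add_cancel]

section Extension

variable {G B : Type*} [AddCommGroup G] [AddCommGroup B]

theorem eq_of_one_add {C : Type*} {f : G × ℤ → C} (h : ∀ x, f ((0, 1) + x) = f x) (g : G) (i : ℤ) :
    f (g, i) = f (g, 0) :=
  int_eq_of_add_one (f := fun i => f (g, i)) (fun i => by
    have := h (g, i)
    rwa [Prod.mk_add_mk, zero_add, add_comm 1] at this) i

theorem additive_eq_zero {f : G × ℤ → B} (h : ∀ x y, f (x + y) = f x + f y)
    (h₁ : ∀ g, f (g, 0) = 0) (h₂ : f (0, 1) = 0) (x : G × ℤ) : f x = 0 := by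
  have := eq_of_one_add (f := f) (fun y => by rw [h, h₂, zero_add]) x.1 x.2
  exact this.trans (h₁ _)

/-- A trivialization on `G` extends to `G × ℤ`. The generator of `ℤ` is taken as the first element
in a normal form, which forces the values on the generators; the relations between the cocycle and
its symmetry then propagate to all arguments. -/
theorem exists_trivialization_prod_int {k : G × ℤ → G × ℤ → G × ℤ → B} {c : G × ℤ → G × ℤ → B}
    (h : IsNormalizedCocycle k c) (m : G → G → B)
    (hm : IsTrivialization k c (AddMonoidHom.inl G ℤ) m) :
    ∃ m' : G × ℤ → G × ℤ → B, IsTrivialization k c (AddMonoidHom.id _) m' ∧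
      ∀ g g', m' (g, 0) (g', 0) = m g g' := by
  let t : G × ℤ := (0, 1)
  have ht (g : G) (i : ℤ) : t + (g, i) = (g, i + 1) := by
    rw [Prod.mk_add_mk, zero_add, add_comm 1]
  choose f hf₀ hf₁ using fun g g' => exists_primitive
    (fun j => k (g, 0) t (g', j) - k t (g, 0) (g', j) + c (g, 0) t) (m g g')
  choose F hF₀ hF₁ using fun (g : G) (y : G × ℤ) => exists_primitive
    (fun i => - k t (g, i) y) (f g y.1 y.2)
  let m' (x y : G × ℤ) : B := F x.1 y x.2
  have m₀ (g g' : G) : m' (g, 0) (g', 0) = m g g' := (hF₀ g (g', 0)).trans (hf₀ g g')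
  have m₁ (x y : G × ℤ) : m' (t + x) y = m' x y - k t x y := by
    obtain ⟨g, i⟩ := x
    rw [ht]
    exact (hF₁ g y i).trans (sub_eq_add_neg _ _).symm
  have m₂ (g : G) (y : G × ℤ) :
      m' (g, 0) (t + y) = m' (g, 0) y + k (g, 0) t y - k t (g, 0) y + c (g, 0) t := by
    obtain ⟨g', j⟩ := y
    rw [ht]
    refine (hF₀ g _).trans ((hf₁ g g' j).trans ?_)
    rw [show m' (g, 0) (g', j) = f g g' j from hF₀ g _]
    abel
  have n₀ (y : G × ℤ) : m' 0 y = 0 := by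
    refine (eq_of_one_add (f := m' 0) (fun y => ?_) y.1 y.2).trans
      ((m₀ 0 y.1).trans (hm.zero_apply h _))
    refine (m₂ 0 y).trans ?_
    change m' 0 y + k 0 t y - k t 0 y + c 0 t = _
    rw [h.zero_left, h.zero_mid, h.zero_symm]
    simp
  have n₁ (y : G × ℤ) : m' t y = 0 := by
    have := m₁ 0 y
    rwa [add_zero, n₀, h.zero_mid, sub_zero] at this
  have n₂ (g : G) : m' (g, 0) t = c (g, 0) t := by
    have := m₂ g 0
    rw [add_zero, h.zero_right, h.zero_right] at this
    refine this.trans ?_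
    rw [show m' (g, 0) 0 = 0 from (m₀ g 0).trans (hm.apply_zero h g)]
    simp
  -- The error `x` of the coboundary is again a cocycle, and `y` is its symmetry.
  let x (a b d : G × ℤ) : B := coboundary m' a b d - k a b d
  let y (a b : G × ℤ) : B := m' a b - m' b a - c a b
  have hx (a b d e : G × ℤ) :
      x b d e - x (a + b) d e + x a (b + d) e - x a b (d + e) + x a b d = 0 := by
    have h₁ := h.cocycle a b d e
    have h₂ := coboundary_cocycle m' a b d e
    simp only [x]
    rw [← sub_eq_zero.2 (h₂.trans h₁.symm)]
    abel
  have hy (a b d : G × ℤ) : y a (b + d) - y a b - y a d = x a b d - x b a d + x b d a := by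
    have h₁ := h.hexagon a b d
    have h₂ := coboundary_hexagon m' a b d
    simp only [x, y]
    rw [← sub_eq_zero] at h₁ h₂ ⊢
    rw [← sub_eq_zero.2 (h₂.trans h₁.symm)]
    abel
  have x₁ (b d : G × ℤ) : x t b d = 0 := by
    simp only [x, coboundary, m₁, n₁]
    abel
  have x₁' (a b d : G × ℤ) : x a b d = x (a.1, 0) b d := by
    refine eq_of_one_add (f := fun a => x a b d) (fun a => ?_) a.1 a.2
    have := hx t a b d
    rw [x₁, x₁, x₁, sub_zero, add_zero, add_zero] at this
    exact (sub_eq_zero.1 this).symm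
  have x₂ (a b : G × ℤ) : x a t b = 0 := by
    rw [x₁']
    simp only [x, coboundary]
    rw [add_comm _ t, m₁, m₂, n₁, n₂]
    abel
  have x₂' (a b d : G × ℤ) : x a b d = x a (b.1, 0) d := by
    refine eq_of_one_add (f := fun b => x a b d) (fun b => ?_) b.1 b.2
    have := hx a t b d
    rw [x₁, x₂, x₂, zero_sub, sub_zero, add_zero, x₁' (a + t), Prod.fst_add, add_zero, ← x₁',
      neg_add_eq_zero] at this
    exact this.symm
  have y₁ (g : G) : y t (g, 0) = 0 := by
    simp only [y]
    rw [n₁, n₂, zero_sub, ← neg_add', h.skew, neg_zero]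
  have x₃ (a b : G × ℤ) : x a b t = 0 := by
    rw [x₁', x₂']
    have := hy t (a.1, 0) (b.1, 0)
    rw [x₁, x₂, zero_sub, neg_zero, zero_add, Prod.mk_add_mk, add_zero, y₁, y₁, y₁] at this
    simpa using this.symm
  have x₃' (a b d : G × ℤ) : x a b d = 0 := by
    rw [x₁', x₂']
    refine (eq_of_one_add (f := fun d => x (a.1, 0) (b.1, 0) d) (fun d => ?_) d.1 d.2).trans ?_
    · have := hx (a.1, 0) (b.1, 0) t d
      rw [x₂, x₂, x₃, x₂', Prod.fst_add, add_zero, sub_zero, zero_add, add_zero] at this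
      exact (sub_eq_zero.1 this).symm
    · have := hm.coboundary_eq a.1 b.1 d.1
      simp only [x, coboundary, Prod.mk_add_mk, add_zero, m₀]
      exact sub_eq_zero.2 this
  have y₂ (a b d : G × ℤ) : y a (b + d) = y a b + y a d := by
    have := hy a b d
    simp only [x₃'] at this
    rw [sub_sub, sub_zero, add_zero] at this
    exact sub_eq_zero.1 this
  have y₃ (a b : G × ℤ) (hab : y a b = 0) : y b a = 0 := by
    have := h.skew a b
    simp only [y] at hab ⊢
    rw [← neg_eq_zero, ← hab, eq_comm, ← sub_eq_zero]
    rw [show c a b = - c b a from eq_neg_of_add_eq_zero_left this]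
    abel
  have y₄ : y t t = 0 := by simp only [y, h.alt, sub_self]
  have y₅ (a : G × ℤ) : y a t = 0 := y₃ _ _ (additive_eq_zero (y₂ t) y₁ y₄ a)
  have y₆ (g : G) (a : G × ℤ) : y a (g, 0) = 0 := by
    refine y₃ _ _ (additive_eq_zero (y₂ _) (fun g' => ?_) (y₅ _) a)
    have := hm.sub_swap g g'
    simp only [y, m₀]
    exact sub_eq_zero.2 this
  refine ⟨m', ⟨fun a b d => sub_eq_zero.1 (x₃' a b d), fun a b => ?_, (m₀ 0 0).trans hm.zero⟩, m₀⟩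
  exact sub_eq_zero.1 (additive_eq_zero (y₂ a) (fun g => y₆ g a) (y₅ a) b)

end Extension

section Descent

variable {A B H : Type*} [AddCommGroup A] [AddCommGroup B] [AddCommGroup H]

/-- A trivialization that is itself a coboundary on the kernel of a homomorphism descends to the
image. -/
theorem exists_trivialization_range {k : A → A → A → B} {c : A → A → B}
    (h : IsNormalizedCocycle k c) {θ : H →+ A} {m : H → H → B} (hm : IsTrivialization k c θ m)
    (U : A → H) (hU : ∀ x, θ (U (θ x)) = θ x) (hU₀ : U 0 = 0) (n : H → B)
    (hn : ∀ r s, θ r = 0 → θ s = 0 → n (r + s) = n r + n s + m r s) :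
    ∃ m' : A → A → B, IsTrivialization k c θ.range.subtype (fun x y => m' x y) ∧
      ∀ x y, θ (U x) = x → θ (U y) = y → U (x + y) = U x + U y → m' x y = m (U x) (U y) := by
  let ν (g : H) : B := m (U (θ g)) (g - U (θ g)) + n (g - U (θ g))
  let M (g g' : H) : B := m g g' - ν (g + g') + ν g + ν g'
  have hn₀ : n 0 = 0 := by simpa [hm.zero] using hn 0 0 (map_zero _) (map_zero _)
  have hν (r : H) (hr : θ r = 0) : ν r = n r := by
    simp only [ν, hr, hU₀, sub_zero, hm.zero_apply h, zero_add]
  have M₀ (g g' d : H) : coboundary M g g' d = k (θ g) (θ g') (θ d) := by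
    rw [← hm.coboundary_eq]
    simp only [coboundary, M, add_assoc]
    abel
  have M₁ (g g' : H) : M g g' - M g' g = c (θ g) (θ g') := by
    rw [← hm.sub_swap]
    simp only [M, add_comm g']
    abel
  have M₂ (g r : H) (hr : θ r = 0) : M g r = 0 := by
    obtain ⟨s, u, hs, hu, rfl⟩ : ∃ s u, θ s = 0 ∧ U (θ g) = u ∧ g = u + s :=
      ⟨g - U (θ g), _, by rw [map_sub, hU, sub_self], rfl, by abel⟩
    have h₁ := hm.coboundary_eq u s r
    rw [hs, h.zero_mid] at h₁
    have h₂ : M (u + s) r = - coboundary m u s r := by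
      simp only [M]
      rw [hν r hr]
      simp only [ν]
      rw [map_add θ _ r, hr, add_zero, hu, add_sub_cancel_left, add_assoc u,
        add_sub_cancel_left, hn _ _ hs hr, coboundary]
      abel
    rw [h₂, h₁, neg_zero]
  have M₃ (g g' r : H) (hr : θ r = 0) : M g (g' + r) = M g g' := by
    have := M₀ g g' r
    rw [hr, h.zero_right, coboundary, M₂ _ _ hr, M₂ _ _ hr] at this
    simpa [sub_eq_zero] using this
  have M₂' (r g : H) (hr : θ r = 0) : M r g = 0 := by
    have := M₁ r g
    rwa [M₂ _ _ hr, hr, h.zero_symm, sub_zero] at this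
  have M₄ (r g g' : H) (hr : θ r = 0) : M (r + g) g' = M g g' := by
    have := M₀ r g g'
    rw [hr, h.zero_left, coboundary, M₂' _ _ hr, M₂' _ _ hr, add_zero, sub_zero] at this
    exact (sub_eq_zero.1 this).symm
  have M₅ (g g' : H) : M (U (θ g)) (U (θ g')) = M g g' := by
    have e (g : H) : θ (g - U (θ g)) = 0 := by rw [map_sub, hU, sub_self]
    rw [← M₄ _ _ _ (e g), ← M₃ _ _ _ (e g'), sub_add_cancel, add_sub_cancel]
  refine ⟨fun x y => M (U x) (U y), ⟨?_, ?_, ?_⟩, fun x y hx hy hxy => ?_⟩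
  · rintro ⟨_, x, rfl⟩ ⟨_, y, rfl⟩ ⟨_, z, rfl⟩
    refine Eq.trans ?_ (M₀ x y z)
    change M (U (θ y)) (U (θ z)) - M (U (θ x + θ y)) (U (θ z)) + M (U (θ x)) (U (θ y + θ z)) -
      M (U (θ x)) (U (θ y)) = _
    rw [← map_add, ← map_add, M₅, M₅, M₅, M₅, coboundary]
  · rintro ⟨_, x, rfl⟩ ⟨_, y, rfl⟩
    change M (U (θ x)) (U (θ y)) - M (U (θ y)) (U (θ x)) = c (θ x) (θ y)
    rw [M₅, M₅, M₁]
  · change M (U 0) (U 0) = 0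
    rw [hU₀]
    exact M₂ 0 0 (map_zero _)
  · have e (g : H) (hg : U (θ g) = g) : ν g = 0 := by
      simp only [ν]
      rw [hg, sub_self, hm.apply_zero h, hn₀, add_zero]
    simp only [M]
    rw [e, e, e, sub_zero, add_zero, add_zero]
    · rw [hy]
    · rw [hx]
    · rw [map_add, hx, hy, hxy]

theorem exists_primitive_zmultiples {m : H → H → B} (hm₀ : ∀ x, m x 0 = 0) (e : H)
    (hm : ∀ i j l : ℤ, coboundary m (i • e) (j • e) (l • e) = 0) :
    ∃ n : ℤ → B, ∀ i j, n (i + j) = n i + n j + m (i • e) (j • e) := by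
  obtain ⟨n, hn₀, hn₁⟩ := exists_primitive (fun i => m (i • e) ((1 : ℤ) • e)) 0
  refine ⟨n, fun i j => ?_⟩
  have key := int_eq_of_add_one (f := fun j => n (i + j) - n j - m (i • e) (j • e)) (fun j => ?_) j
  · rw [add_zero, hn₀, zero_smul, hm₀, sub_zero, sub_zero] at key
    rw [← sub_eq_zero] at key ⊢
    rw [← key]
    abel
  · have := hm i j 1
    rw [← add_assoc, hn₁, hn₁, ← sub_eq_zero, ← neg_eq_zero, ← this, coboundary, ← add_smul,
      ← add_smul]
    abel

theorem IsNormalizedCocycle.comap {k : A → A → A → B} {c : A → A → B}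
    (h : IsNormalizedCocycle k c) (θ : H →+ A) :
    IsNormalizedCocycle (fun x y z => k (θ x) (θ y) (θ z)) (fun x y => c (θ x) (θ y)) where
  cocycle x y z w := by
    simp only [map_add]
    exact h.cocycle _ _ _ _
  hexagon x y z := by
    simp only [map_add]
    exact h.hexagon _ _ _
  skew x y := h.skew _ _
  zero_left y z := by rw [map_zero, h.zero_left]
  zero_mid x z := by rw [map_zero, h.zero_mid]
  zero_right x y := by rw [map_zero, h.zero_right]
  alt x := h.alt _

end Descent

section Zorn

variable {A B : Type*} [AddCommGroup A] [AddCommGroup B]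

theorem IsTrivialization.exists_extension {k : A → A → A → B} {c : A → A → B}
    (h : IsNormalizedCocycle k c) {S : AddSubgroup A} {m : A → A → B}
    (hm : IsTrivialization k c S.subtype fun x y => m x y) (a : A) :
    ∃ (S' : AddSubgroup A) (m' : A → A → B), S ≤ S' ∧ a ∈ S' ∧
      IsTrivialization k c S'.subtype (fun x y => m' x y) ∧
        ∀ x ∈ S, ∀ y ∈ S, m' x y = m x y := by
  classical
  let θ : S × ℤ →+ A := S.subtype.coprod (zmultiplesHom A a)
  have hθ (x : S × ℤ) : θ x = x.1 + x.2 • a := by simp [θ]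
  obtain ⟨m₁, hm₁, hmm₁⟩ := exists_trivialization_prod_int (h.comap θ) (fun x y => m x y)
    ⟨fun x y z => by simpa [hθ] using hm.coboundary_eq x y z,
      fun x y => by simpa [hθ] using hm.sub_swap x y, hm.zero⟩
  have hm₂ : IsTrivialization k c θ m₁ := ⟨hm₁.coboundary_eq, hm₁.sub_swap, hm₁.zero⟩
  let U (x : A) : S × ℤ := if hx : x ∈ S then (⟨x, hx⟩, 0) else Function.invFun θ x
  have hU₁ (x : A) (hx : x ∈ S) : U x = (⟨x, hx⟩, 0) := dif_pos hx
  have hU₂ (x : A) (hx : x ∈ S) : θ (U x) = x := by simp [hU₁ x hx, hθ]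
  have hU (x : S × ℤ) : θ (U (θ x)) = θ x := by
    by_cases hx : θ x ∈ S
    · exact hU₂ _ hx
    · rw [show U (θ x) = _ from dif_neg hx]
      exact Function.invFun_eq ⟨x, rfl⟩
  -- The kernel embeds into `ℤ`, so it is generated by one element `e`.
  obtain ⟨d, hd⟩ := Int.subgroup_cyclic (θ.ker.map (AddMonoidHom.snd S ℤ))
  obtain ⟨e, he, rfl⟩ : d ∈ θ.ker.map (AddMonoidHom.snd S ℤ) :=
    hd ▸ AddSubgroup.subset_closure rfl
  change θ e = 0 at he
  rw [hθ] at he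
  have hker (r : S × ℤ) (hr : θ r = 0) :
      ∃ i : ℤ, r = i • e ∧ r.2 / e.2 = i := by
    have hr₂ : r.2 ∈ θ.ker.map (AddMonoidHom.snd S ℤ) := ⟨r, hr, rfl⟩
    rw [hd] at hr₂
    obtain ⟨j, hj⟩ := AddSubgroup.mem_closure_singleton.1 hr₂
    have h₁ : r.2 = (r.2 / e.2) * e.2 :=
      (Int.ediv_mul_cancel ⟨j, by rw [← hj, smul_eq_mul, mul_comm]; rfl⟩).symm
    refine ⟨_, Prod.ext (Subtype.ext ?_) h₁, rfl⟩
    rw [hθ] at hr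
    change (r.1 : A) = (r.2 / e.2) • (e.1 : A)
    rw [eq_neg_of_add_eq_zero_left hr, eq_neg_of_add_eq_zero_left he, smul_neg, smul_smul, ← h₁]
  obtain ⟨N, hN⟩ := exists_primitive_zmultiples (m := m₁) (hm₂.apply_zero h) e (fun i j l => by
    have (i : ℤ) : θ (i • e) = 0 := by rw [map_zsmul, hθ, he, smul_zero]
    rw [hm₂.coboundary_eq, this, h.zero_left])
  obtain ⟨m', hm', hmm'⟩ := exists_trivialization_range h hm₂ U hU (hU₁ 0 S.zero_mem)
    (fun r => N (r.2 / e.2)) (fun r s hr hs => by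
      obtain ⟨i, hi, hi'⟩ := hker r hr
      obtain ⟨j, hj, hj'⟩ := hker s hs
      obtain ⟨l, hl, hl'⟩ := hker (r + s) (by rw [map_add, hr, hs, add_zero])
      rw [hi', hj', hl', hi, hj, ← hN]
      by_cases h0 : e.2 = 0
      · rw [h0, Int.ediv_zero] at hi' hj' hl'
        rw [← hi', ← hj', ← hl', add_zero]
      · rw [← hl', hi, hj, ← add_smul, Prod.smul_snd, smul_eq_mul, Int.mul_ediv_cancel _ h0])
  refine ⟨θ.range, m', fun x hx => ⟨_, hU₂ x hx⟩, ⟨(0, 1), by simp [hθ]⟩, hm', fun x hx y hy => ?_⟩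
  rw [hmm' x y (hU₂ x hx) (hU₂ y hy), hU₁ x hx, hU₁ y hy, hmm₁]
  rw [hU₁ x hx, hU₁ y hy, hU₁ _ (S.add_mem hx hy)]
  rfl

/-- A trivialization of a cocycle over a subgroup. The cochain is a function on the whole group, of
which only the values on the subgroup matter. -/
structure PartialTrivialization (k : A → A → A → B) (c : A → A → B) where
  carrier : AddSubgroup A
  cochain : A → A → B
  isTrivialization : IsTrivialization k c carrier.subtype fun x y => cochain x y

/-- A normalized symmetric cocycle is trivial: a maximal partial trivialization is defined
everywhere. -/
theorem IsNormalizedCocycle.exists_coboundary {k : A → A → A → B} {c : A → A → B}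
    (h : IsNormalizedCocycle k c) : ∃ m : A → A → B, ∀ x y z, k x y z = coboundary m x y z := by
  classical
  let r (p q : PartialTrivialization k c) : Prop := p.carrier ≤ q.carrier ∧
    ∀ x ∈ p.carrier, ∀ y ∈ p.carrier, q.cochain x y = p.cochain x y
  have hr₀ (p) : r p p := ⟨le_rfl, fun _ _ _ _ => rfl⟩
  have hr (p q s) (hpq : r p q) (hqs : r q s) : r p s :=
    ⟨hpq.1.trans hqs.1, fun x hx y hy =>
      (hqs.2 x (hpq.1 hx) y (hpq.1 hy)).trans (hpq.2 x hx y hy)⟩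
  have p₀ : PartialTrivialization k c := ⟨⊥, fun _ _ => 0, by
    constructor
    · rintro ⟨x, rfl⟩ ⟨y, rfl⟩ ⟨z, rfl⟩
      simp [coboundary, h.zero_left]
    · rintro ⟨x, rfl⟩ ⟨y, rfl⟩
      simp [h.symm_zero]
    · rfl⟩
  have hub (C : Set (PartialTrivialization k c)) (hC : IsChain r C) : ∃ ub, ∀ q ∈ C, r q ub := by
    rcases C.eq_empty_or_nonempty with rfl | ⟨p, hp⟩
    · exact ⟨p₀, fun _ h => h.elim⟩
    have hC' (p q) (hp : p ∈ C) (hq : q ∈ C) : ∃ s ∈ C, r p s ∧ r q s := by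
      by_cases hpq : p = q
      · exact ⟨q, hq, hpq ▸ hr₀ q, hr₀ q⟩
      · rcases hC hp hq hpq with h' | h'
        · exact ⟨q, hq, h', hr₀ q⟩
        · exact ⟨p, hp, hr₀ p, h'⟩
    have hdir : Directed (· ≤ ·) fun q : C => q.1.carrier := fun q q' => by
      obtain ⟨s, hs, h₁, h₂⟩ := hC' _ _ q.2 q'.2
      exact ⟨⟨s, hs⟩, h₁.1, h₂.1⟩
    have : Nonempty C := ⟨⟨p, hp⟩⟩
    let S : AddSubgroup A := ⨆ q : C, q.1.carrier
    have hS {x : A} (hx : x ∈ S) : ∃ q ∈ C, x ∈ q.carrier := by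
      obtain ⟨q, hq⟩ := (AddSubgroup.mem_iSup_of_directed hdir).1 hx
      exact ⟨q.1, q.2, hq⟩
    let m (x y : A) : B :=
      if hxy : ∃ q ∈ C, x ∈ q.carrier ∧ y ∈ q.carrier then hxy.choose.cochain x y else 0
    have hm (q) (hq : q ∈ C) (x y) (hx : x ∈ q.carrier) (hy : y ∈ q.carrier) :
        m x y = q.cochain x y := by
      have hxy : ∃ q ∈ C, x ∈ q.carrier ∧ y ∈ q.carrier := ⟨q, hq, hx, hy⟩
      obtain ⟨s, hs, h₁, h₂⟩ := hC' _ _ hxy.choose_spec.1 hq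
      refine (dif_pos hxy).trans ?_
      rw [← h₁.2 x hxy.choose_spec.2.1 y hxy.choose_spec.2.2, h₂.2 x hx y hy]
    refine ⟨⟨S, m, ?_, ?_, ?_⟩, fun q hq => ⟨le_iSup (fun q : C => q.1.carrier) ⟨q, hq⟩,
      fun x hx y hy => hm q hq x y hx hy⟩⟩
    · rintro ⟨x, hx⟩ ⟨y, hy⟩ ⟨z, hz⟩
      obtain ⟨q, hq, hx⟩ := hS hx
      obtain ⟨q', hq', hy⟩ := hS hy
      obtain ⟨q'', hq'', hz⟩ := hS hz
      obtain ⟨s, hs, h₁, h₂⟩ := hC' _ _ hq hq'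
      obtain ⟨s', hs', h₃, h₄⟩ := hC' _ _ hs hq''
      replace hx := h₃.1 (h₁.1 hx)
      replace hy := h₃.1 (h₂.1 hy)
      replace hz := h₄.1 hz
      refine Eq.trans ?_ (s'.isTrivialization.coboundary_eq ⟨x, hx⟩ ⟨y, hy⟩ ⟨z, hz⟩)
      simp only [coboundary, AddSubgroup.coe_add]
      rw [hm s' hs' _ _ hy hz, hm s' hs' _ _ (add_mem hx hy) hz, hm s' hs' _ _ hx (add_mem hy hz),
        hm s' hs' _ _ hx hy]
    · rintro ⟨x, hx⟩ ⟨y, hy⟩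
      obtain ⟨q, hq, hx⟩ := hS hx
      obtain ⟨q', hq', hy⟩ := hS hy
      obtain ⟨s, hs, h₁, h₂⟩ := hC' _ _ hq hq'
      replace hx := h₁.1 hx
      replace hy := h₂.1 hy
      refine Eq.trans ?_ (s.isTrivialization.sub_swap ⟨x, hx⟩ ⟨y, hy⟩)
      rw [hm s hs _ _ hx hy, hm s hs _ _ hy hx]
    · exact (hm p hp 0 0 (zero_mem _) (zero_mem _)).trans p.isTrivialization.zero
  obtain ⟨p, hp⟩ := exists_maximal_of_chains_bounded (r := r) hub (hr _ _ _)
  refine ⟨p.cochain, fun x y z => ?_⟩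
  have (a : A) : a ∈ p.carrier := by
    obtain ⟨S', m', h₁, h₂, h₃, h₄⟩ := p.isTrivialization.exists_extension h a
    exact (hp ⟨S', m', h₃⟩ ⟨h₁, h₄⟩).1 h₂
  exact (p.isTrivialization.coboundary_eq ⟨x, this x⟩ ⟨y, this y⟩ ⟨z, this z⟩).symm

/-- A symmetric 3-cocycle is a coboundary: the third symmetric cohomology group of an abelian
group is the group of homomorphisms to the 2-torsion, which is detected by the diagonal of the
symmetry, and each such homomorphism is realized with the zero cocycle. -/
theorem IsSymmetricCocycle.exists_coboundary {k : A → A → A → B} {c : A → A → B}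
    (h : IsSymmetricCocycle k c) : ∃ m : A → A → B, ∀ x y z, k x y z = coboundary m x y z := by
  obtain ⟨m₀, h₁, h₂, h₃⟩ := h.exists_normalized
  have h' := h.sub_coboundary m₀
  set k' := fun x y z => k x y z - coboundary m₀ x y z with hk'
  set c' := fun x y => c x y - (m₀ x y - m₀ y x) with hc'
  obtain ⟨ψ, ψ₁, ψ₂, ψ₃, ψ₄⟩ := exists_biadditive_diag (AddMonoidHom.mk' (fun x => c' x x) h'.diag_add)
    (fun x => h'.skew x x)
  have h'' : IsNormalizedCocycle k' (fun x y => c' x y - ψ x y) :=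
    { cocycle := h'.cocycle
      hexagon := fun x y z => by
        rw [← h'.hexagon, ψ₁]
        abel
      skew := fun x y => by
        rw [ψ₂ y x]
        refine Eq.trans ?_ (congrArg₂ (· - ·) (h'.skew x y) (ψ₃ x y)) |>.trans (sub_zero 0)
        abel
      zero_left := fun y z => sub_eq_zero.2 (h₁ y z)
      zero_mid := fun x z => sub_eq_zero.2 (h₂ x z)
      zero_right := fun x y => sub_eq_zero.2 (h₃ x y)
      alt := fun x => sub_eq_zero.2 (ψ₄ x).symm }
  obtain ⟨m₁, hm₁⟩ := h''.exists_coboundary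
  refine ⟨fun x y => m₀ x y + m₁ x y, fun x y z => ?_⟩
  have := hm₁ x y z
  rw [hk', sub_eq_iff_eq_add] at this
  rw [this]
  simp only [coboundary]
  abel

end Zorn

end Algebra

instance {D D' : Type*} [TopologicalSpace D] [TopologicalSpace D'] [SegmentSpace D]
    [SegmentSpace D'] : SegmentSpace (D × D') where
  seg s x y := (seg s x.1 y.1, seg s x.2 y.2)
  continuous_seg := (continuous_seg' (by fun_prop) (by fun_prop) (by fun_prop)).prodMk
    (continuous_seg' (by fun_prop) (by fun_prop) (by fun_prop))
  seg_zero x y := Prod.ext (seg_zero _ _) (seg_zero _ _)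
  seg_one x y := Prod.ext (seg_one _ _) (seg_one _ _)
  seg_self s x := Prod.ext (seg_self _ _) (seg_self _ _)

/-! ### Transport of second homotopy groups along paths -/

section Transport

open Bicategory

section Abstract

variable {C : Type*} [Bicategory C] {x y z : C}

/-- The elements `b` and `b'` of the second homotopy groups at the ends of `u` correspond to each
other under transport along `u`. -/
def Transports (u : x ⟶ y) (b : TwoEnd x) (b' : TwoEnd y) : Prop := actL b.hom u = actR u b'.hom

theorem Transports.comp {u : x ⟶ y} {v : y ⟶ z} {b : TwoEnd x} {b' : TwoEnd y} {b'' : TwoEnd z}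
    (h : Transports u b b') (h' : Transports v b' b'') : Transports (u ≫ v) b b'' := by
  rw [Transports, ← actL_whiskerRight, h, ← whiskerLeft_actL, h', whiskerLeft_actR]

variable [IsBigroupoid C]

theorem Transports.of_comp_right {u : x ⟶ y} {v : y ⟶ z} {b : TwoEnd x} {b' : TwoEnd y}
    {b'' : TwoEnd z} (h : Transports (u ≫ v) b b'') (h' : Transports u b b') :
    Transports v b' b'' := by
  refine whiskerLeft_injective u ?_
  beta_reduce
  rw [whiskerLeft_actR, ← h, ← actL_whiskerRight, h', whiskerLeft_actL]

theorem Transports.congr {u u' : x ⟶ y} (α : u ⟶ u') {b : TwoEnd x} {b' : TwoEnd y}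
    (h : Transports u b b') : Transports u' b b' := by
  rw [Transports, ← cancel_epi α, ← actL_naturality, ← actR_naturality, h]

theorem transports_of_square {u : x ⟶ y} {b : TwoEnd x} {b' : TwoEnd y} (τ : 𝟙 x ≫ u ⟶ u ≫ 𝟙 y)
    (h : b.hom ▷ u ≫ τ = τ ≫ u ◁ b'.hom) : Transports u b b' := by
  have h₁ : actL b.hom u ≫ (λ_ u).inv ≫ τ ≫ (ρ_ u).hom =
      ((λ_ u).inv ≫ τ ≫ (ρ_ u).hom) ≫ actR u b'.hom := by
    simp only [actL, actR, Category.assoc, Iso.hom_inv_id_assoc]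
    rw [← Category.assoc (b.hom ▷ u), h, Category.assoc]
  rw [← actR_naturality] at h₁
  exact (cancel_mono _).1 h₁

end Abstract

variable {X Y : Type*} [TopologicalSpace X] [TopologicalSpace Y]

/-- A homotopy identifies the induced maps on second homotopy groups up to transport along its
track. -/
theorem transports_evalAt {f g : C(X, Y)} (H : f.Homotopy g) {x : X}
    (b : TwoEnd (⟨x⟩ : PathBicat X)) :
    Transports (arr (H.evalAt x)) (mapTwoEnd f x b) (mapTwoEnd g x b) := by
  let P₀ : Path ((0, 0) : I × I) (1, 1) := (segPath (0, 0) (0, 1)).trans (segPath (0, 1) (1, 1))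
  let P₁ : Path ((0, 0) : I × I) (1, 1) := (segPath (0, 0) (1, 0)).trans (segPath (1, 0) (1, 1))
  let K (q : Path x x) : C(I × I, Y) := ⟨fun d => H (d.1, q d.2), by fun_prop⟩
  have e₀ (t : I) : seg t (0 : I) 1 = t := Subtype.ext (by
    change (1 - (t : ℝ)) * 0 + t * 1 = t
    ring)
  have h₀ (q : Path x x) : LiftsTo (K q) P₀ ((q.map f.continuous).trans (H.evalAt x)) :=
    LiftsTo.trans (fun t => by
        change H (seg t 0 0, q (seg t 0 1)) = f (q t)
        rw [seg_self, e₀, H.apply_zero])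
      (fun t => by
        change H (seg t 0 1, q (seg t 1 1)) = H (t, x)
        rw [seg_self, e₀, q.target])
  have h₁ (q : Path x x) : LiftsTo (K q) P₁ ((H.evalAt x).trans (q.map g.continuous)) :=
    LiftsTo.trans (fun t => by
        change H (seg t 0 1, q (seg t 0 0)) = H (t, x)
        rw [seg_self, e₀, q.source])
      (fun t => by
        change H (seg t 1 1, q (seg t 0 1)) = g (q t)
        rw [seg_self, e₀, H.apply_one])
  let F : ContinuousMap.Homotopy (X := Path x x) (Y := Path (f x) (g x))
      ((⟨fun p => p.trans (H.evalAt x), by fun_prop⟩ : C(Path (f x) (f x), _)).comp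
        ⟨fun q => q.map f.continuous, Path.continuous_uncurry_iff.1 (by
          change Continuous fun z : Path x x × I => f (z.1 z.2)
          fun_prop)⟩)
      ((⟨fun p => (H.evalAt x).trans p, by fun_prop⟩ : C(Path (g x) (g x), _)).comp
        ⟨fun q => q.map g.continuous, Path.continuous_uncurry_iff.1 (by
          change Continuous fun z : Path x x × I => g (z.1 z.2)
          fun_prop)⟩) :=
    { toFun := fun z => mapPaths (K z.2) (h₀ z.2).source (h₀ z.2).target (segPaths P₀ P₁ z.1)
      continuous_toFun := Path.continuous_uncurry_iff.1 (by
        change Continuous fun z : (I × Path x x) × I =>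
          H ((segPaths P₀ P₁ z.1.1 z.2).1, z.1.2 (segPaths P₀ P₁ z.1.1 z.2).2)
        have h : Continuous fun z : (I × Path x x) × I => segPaths P₀ P₁ z.1.1 z.2 :=
          continuous_seg' (by fun_prop) (by fun_prop) (by fun_prop)
        exact H.continuous.comp (h.fst.prodMk
          (continuous_eval.comp ((by fun_prop : Continuous fun z : (I × Path x x) × I =>
            z.1.2).prodMk h.snd))))
      map_zero_left := fun q => by
        ext t
        rw [(segPaths P₀ P₁).source]
        exact h₀ q t
      map_one_left := fun q => by
        ext t
        rw [(segPaths P₀ P₁).target]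
        exact h₁ q t }
  refine transports_of_square (C := PathBicat Y) (x := ⟨f x⟩) (y := ⟨g x⟩)
    (Path.Homotopic.Quotient.mk (F.evalAt (Path.refl x))) ?_
  obtain ⟨b⟩ := b
  have := naturality_of_homotopy F b
  induction b using Path.Homotopic.Quotient.ind with | mk Γ =>
  exact this

end Transport

/-! ### The cochain on triangles in the image of a convex domain -/

section TriangleValue

variable {X : Type*} [TopologicalSpace X] {D D' : Type*} [TopologicalSpace D] [SegmentSpace D]
  [TopologicalSpace D'] [SegmentSpace D']

/-- The image of the segment between two points. -/
def imagePath (F : C(D, X)) (a b : D) : Path (F a) (F b) := (segPath a b).map F.continuous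

theorem liftsTo_imagePath (F : C(D, X)) (a b : D) : LiftsTo F (segPath a b) (imagePath F a b) :=
  fun _ => rfl

section Labels

variable {e : X} {A : Type*} [AddGroup A] {S : Framing (⟨e⟩ : PathBicat X) A}

theorem Framing.IsAdditive.label_comp (hS : S.IsAdditive) {x y z : PathBicat X} (u : x ⟶ y)
    (v : y ⟶ z) : S.label (u ≫ v) = S.label u + S.label v := (hS u v _ (𝟙 _)).symm

theorem Framing.IsAdditive.label_id (hS : S.IsAdditive) (x : PathBicat X) :
    S.label (𝟙 x) = 0 := by
  have := hS _ _ _ (Bicategory.leftUnitor (𝟙 x)).hom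
  simpa using this

theorem Framing.IsAdditive.label_congr (hS : S.IsAdditive) {x y : PathBicat X} {u v : x ⟶ y}
    (θ : u ⟶ v) : S.label u = S.label v := by
  have := hS _ _ _ ((Bicategory.leftUnitor u).hom ≫ θ)
  rwa [hS.label_id, zero_add] at this

theorem Framing.IsAdditive.label_cls (hS : S.IsAdditive) {x y : X} {p q : Path x y}
    (h : cls p = cls q) : S.label (arr p) = S.label (arr q) :=
  hS.label_congr (nonempty_twoCell.2 (cls_eq_iff.1 h)).some

theorem Framing.IsAdditive.label_trans (hS : S.IsAdditive) {x y z : X} (p : Path x y)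
    (q : Path y z) : S.label (arr (p.trans q)) = S.label (arr p) + S.label (arr q) :=
  hS.label_comp (arr p) (arr q)

theorem label_imagePath (F : C(D, X)) (a b : D) {x y : X} (q : Path x y)
    (h : LiftsTo F (segPath a b) q) : S.label (arr (imagePath F a b)) = S.label (arr q) := by
  obtain rfl := h.source
  obtain rfl := h.target
  exact congrArg (fun p => S.label (arr p)) (Path.ext (funext fun t => h t))

end Labels

section Values

variable {e : X} {A : Type*} [AddSemigroup A] {S : Framing (⟨e⟩ : PathBicat X) A}

/-- The value of the cochain on the triangle of the images of the segments between three points. -/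
def triangleValue (hS : S.IsAdditive) (F : C(D, X)) (a b c : D) : TwoEnd (⟨e⟩ : PathBicat X) :=
  S.value (tri F (liftsTo_imagePath F a b) (liftsTo_imagePath F b c) (liftsTo_imagePath F a c))
    (hS _ _ _ (tri F (liftsTo_imagePath F a b) (liftsTo_imagePath F b c)
      (liftsTo_imagePath F a c)))

theorem value_eq_triangleValue (hS : S.IsAdditive) (F : C(D, X)) {a b c : D} {x y z : X}
    {u : Path x y} {v : Path y z} {w : Path x z} (hu : LiftsTo F (segPath a b) u)
    (hv : LiftsTo F (segPath b c) v) (hw : LiftsTo F (segPath a c) w)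
    (h : S.label (arr u) + S.label (arr v) = S.label (arr w)) :
    S.value (tri F hu hv hw) h = triangleValue hS F a b c := by
  obtain rfl := hu.source
  obtain rfl := hv.source
  obtain rfl := hv.target
  obtain rfl : u = imagePath F a b := by ext t; exact (hu t).symm
  obtain rfl : v = imagePath F b c := by ext t; exact (hv t).symm
  obtain rfl : w = imagePath F a c := by ext t; exact (hw t).symm
  rfl

theorem triangleValue_comp (hS : S.IsAdditive) (F : C(D, X)) (g : C(D', D))
    (hg : ∀ t x y, g (seg t x y) = seg t (g x) (g y)) (a b c : D') :
    triangleValue hS (F.comp g) a b c = triangleValue hS F (g a) (g b) (g c) := by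
  have h (x y : D') : LiftsTo F (segPath (g x) (g y)) (imagePath (F.comp g) x y) := fun t =>
    congrArg F (hg t x y).symm
  rw [← value_eq_triangleValue hS F (h a b) (h b c) (h a c)
    (hS _ _ _ (tri (F.comp g) (liftsTo_imagePath _ a b) (liftsTo_imagePath _ b c)
      (liftsTo_imagePath _ a c)))]
  exact congrArg (fun θ => S.value θ _) (can_restrict (F.comp g) F g (fun _ => rfl) _ _ _ _
    (LiftsTo.trans (fun t => hg t a b) fun t => hg t b c) fun t => hg t a c)

theorem triangleValue_tetrahedron (hS : S.IsAdditive)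
    (hact : ∀ (a : A) (b : TwoEnd (⟨e⟩ : PathBicat X)),
      actR (S.loop a) b.hom = actL b.hom (S.loop a)) (F : C(D, X)) (a b c d : D) :
    triangleValue hS F b c d - triangleValue hS F a c d + triangleValue hS F a b d -
      triangleValue hS F a b c = S.defect (S.label (arr (imagePath F a b)))
        (S.label (arr (imagePath F b c))) (S.label (arr (imagePath F c d))) := by
  have h := liftsTo_imagePath F
  have := S.value_add_value hact _ _ _ _ (hS _ _ _ (tri F (h a b) (h b c) (h a c)))
    (hS _ _ _ (tri F (h a c) (h c d) (h a d))) (hS _ _ _ (tri F (h a b) (h b d) (h a d)))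
    (hS _ _ _ (tri F (h b c) (h c d) (h b d)))
    (tri_tetrahedron F (h a b) (h b c) (h c d) (h a c) (h b d) (h a d))
  refine Eq.trans ?_ (eq_sub_of_add_eq' this).symm
  simp only [triangleValue]
  abel

/-- The value of the cochain on a square that is cut along its diagonal. -/
def squareValue (hS : S.IsAdditive) (F : C(I × I, X)) : TwoEnd (⟨e⟩ : PathBicat X) :=
  triangleValue hS F (0, 0) (1, 0) (1, 1) - triangleValue hS F (0, 0) (0, 1) (1, 1)

theorem squareValue_swap (hS : S.IsAdditive) (F : C(I × I, X)) :
    squareValue hS (F.comp ContinuousMap.prodSwap) = - squareValue hS F := by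
  rw [squareValue, triangleValue_comp hS F _ fun _ _ _ => rfl,
    triangleValue_comp hS F _ fun _ _ _ => rfl, squareValue, neg_sub]
  rfl

theorem squareValue_comp (hS : S.IsAdditive) (K : C(D, X)) (F : C(I × I, X)) (g : C(I × I, D))
    (hg : ∀ t x y, g (seg t x y) = seg t (g x) (g y)) (hF : ∀ z, K (g z) = F z) :
    triangleValue hS K (g (0, 0)) (g (1, 0)) (g (1, 1)) -
      triangleValue hS K (g (0, 0)) (g (0, 1)) (g (1, 1)) = squareValue hS F := by
  obtain rfl : K.comp g = F := ContinuousMap.ext hF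
  rw [squareValue, triangleValue_comp hS K g hg, triangleValue_comp hS K g hg]

/-- The associativity defect is a cocycle: it is the sum of the values on the faces of a
tetrahedron, and the boundary of the boundary of a 4-simplex is zero. -/
theorem defect_cocycle {A : Type*} [AddGroup A] {S : Framing (⟨e⟩ : PathBicat X) A}
    (hS : S.IsAdditive) (hact : ∀ (a : A) (b : TwoEnd (⟨e⟩ : PathBicat X)),
      actR (S.loop a) b.hom = actL b.hom (S.loop a)) (hlab : ∀ a, S.label (S.loop a) = a)
    (x y z w : A) :
    S.defect y z w - S.defect (x + y) z w + S.defect x (y + z) w - S.defect x y (z + w) +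
      S.defect x y z = 0 := by
  -- The 4-simplex is degenerate: it is mapped along the concatenation of the four loops.
  obtain ⟨f, b, c, d, d', p, q, r, s, hp, hq, hr, hs⟩ :=
    exists_lift_four (S.loop x).as (S.loop y).as (S.loop z).as (S.loop w).as
  have key {a b : I} {p' : Path a b} {p : Path e e} (h : LiftsTo f p' p) :
      S.label (arr (imagePath f a b)) = S.label (arr p) := by
    obtain rfl : f a = e := h.source.symm
    have h' : LiftsTo f (segPath a b) ((imagePath f a b).cast rfl h.target) := fun _ => rfl
    refine (label_imagePath f a b _ h').trans (hS.label_congr (can f h' h))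
  have e₁ : S.label (arr (imagePath f 0 b)) = x := (key hp).trans (hlab x)
  have e₂ : S.label (arr (imagePath f b c)) = y := (key hq).trans (hlab y)
  have e₃ : S.label (arr (imagePath f c d)) = z := (key hr).trans (hlab z)
  have e₄ : S.label (arr (imagePath f d d')) = w := (key hs).trans (hlab w)
  have add (a b c : I) : S.label (arr (imagePath f a c)) =
      S.label (arr (imagePath f a b)) + S.label (arr (imagePath f b c)) :=
    (hS _ _ _ (tri f (liftsTo_imagePath f a b) (liftsTo_imagePath f b c)
      (liftsTo_imagePath f a c))).symm
  have h₀ := triangleValue_tetrahedron hS hact f b c d d'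
  have h₁ := triangleValue_tetrahedron hS hact f 0 c d d'
  have h₂ := triangleValue_tetrahedron hS hact f 0 b d d'
  have h₃ := triangleValue_tetrahedron hS hact f 0 b c d'
  have h₄ := triangleValue_tetrahedron hS hact f 0 b c d
  rw [e₂, e₃, e₄] at h₀
  rw [add 0 b c, e₁, e₂, e₃, e₄] at h₁
  rw [add b c d, e₁, e₂, e₃, e₄] at h₂
  rw [add c d d', e₁, e₂, e₃, e₄] at h₃
  rw [e₁, e₂, e₃] at h₄
  rw [← h₀, ← h₁, ← h₂, ← h₃, ← h₄]
  abel

/-- The three tetrahedra of a prism: its square faces are the lower one, the right one and the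
diagonal one, and its two triangular faces are mapped in the same way and cancel. -/
theorem defect_prism (hS : S.IsAdditive) (hact : ∀ (a : A) (b : TwoEnd (⟨e⟩ : PathBicat X)),
      actR (S.loop a) b.hom = actL b.hom (S.loop a)) (K : C(I × I × I, X)) {a b d : A}
    (ha : ∀ t r, S.label (arr (imagePath K (0, t, r) (1, t, r))) = a)
    (hb : ∀ s, S.label (arr (imagePath K (s, 0, 0) (s, 1, 0))) = b)
    (hd : ∀ s, S.label (arr (imagePath K (s, 1, 0) (s, 1, 1))) = d)
    (hK : ∀ t r, K (0, t, r) = K (1, t, r)) (F₁ F₂ F₃ : C(I × I, X))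
    (h₁ : ∀ s t, K (s, t, 0) = F₁ (s, t)) (h₂ : ∀ s r, K (s, 1, r) = F₂ (s, r))
    (h₃ : ∀ s t, K (s, t, t) = F₃ (s, t)) :
    squareValue hS F₃ - squareValue hS F₁ - squareValue hS F₂ =
      S.defect a b d - S.defect b a d + S.defect b d a := by
  have T₁ := triangleValue_tetrahedron hS hact K (0, 0, 0) (1, 0, 0) (1, 1, 0) (1, 1, 1)
  have T₂ := triangleValue_tetrahedron hS hact K (0, 0, 0) (0, 1, 0) (1, 1, 0) (1, 1, 1)
  have T₃ := triangleValue_tetrahedron hS hact K (0, 0, 0) (0, 1, 0) (0, 1, 1) (1, 1, 1)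
  rw [ha, hb, hd] at T₁ T₂ T₃
  have e₁ := squareValue_comp hS K F₁ ⟨fun z => (z.1, z.2, 0), by fun_prop⟩
    (fun t x y => Prod.ext rfl (Prod.ext rfl (seg_self _ _).symm)) fun z => h₁ z.1 z.2
  have e₂ := squareValue_comp hS K F₂ ⟨fun z => (z.1, 1, z.2), by fun_prop⟩
    (fun t x y => Prod.ext rfl (Prod.ext (seg_self _ _).symm rfl)) fun z => h₂ z.1 z.2
  have e₃ := squareValue_comp hS K F₃ ⟨fun z => (z.1, z.2, z.2), by fun_prop⟩
    (fun t x y => rfl) fun z => h₃ z.1 z.2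
  have hg (s : I) := triangleValue_comp hS K (D' := I × I) ⟨fun z => (s, z.1, z.2), by fun_prop⟩
    (fun t x y => Prod.ext (seg_self _ _).symm rfl) (0, 0) (1, 0) (1, 1)
  have e₄ := (hg 0).symm.trans ((congrArg (fun F => triangleValue hS F _ _ _)
    (ContinuousMap.ext fun z => hK z.1 z.2)).trans (hg 1))
  simp only [ContinuousMap.coe_mk] at e₁ e₂ e₃ e₄
  rw [← e₁, ← e₂, ← e₃, ← T₁, ← T₂, ← T₃, e₄]
  abel

/-- The six tetrahedra of a cube with equal opposite faces in two directions: only the values on the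
bottom and on the top remain. -/
theorem defect_cube (hS : S.IsAdditive) (hact : ∀ (a : A) (b : TwoEnd (⟨e⟩ : PathBicat X)),
      actR (S.loop a) b.hom = actL b.hom (S.loop a)) (K : C(I × I × I, X)) {x y z : A}
    (hx : ∀ t r, S.label (arr (imagePath K (0, t, r) (1, t, r))) = x)
    (hy : ∀ s r, S.label (arr (imagePath K (s, 0, r) (s, 1, r))) = y)
    (hz : ∀ s t : I, (s = 0 ∨ s = 1) → (t = 0 ∨ t = 1) →
      S.label (arr (imagePath K (s, t, 0) (s, t, 1))) = z)
    (h₁ : ∀ t r, K (0, t, r) = K (1, t, r)) (h₂ : ∀ s r, K (s, 0, r) = K (s, 1, r))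
    (F₀ F₁ : C(I × I, X)) (hF₀ : ∀ s t, K (s, t, 0) = F₀ (s, t))
    (hF₁ : ∀ s t, K (s, t, 1) = F₁ (s, t)) :
    squareValue hS F₁ - squareValue hS F₀ = S.defect x y z - S.defect y x z + S.defect y z x -
      S.defect z y x + S.defect z x y - S.defect x z y := by
  have T₁ := triangleValue_tetrahedron hS hact K (0, 0, 0) (1, 0, 0) (1, 1, 0) (1, 1, 1)
  have T₂ := triangleValue_tetrahedron hS hact K (0, 0, 0) (0, 1, 0) (1, 1, 0) (1, 1, 1)
  have T₃ := triangleValue_tetrahedron hS hact K (0, 0, 0) (0, 1, 0) (0, 1, 1) (1, 1, 1)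
  have T₄ := triangleValue_tetrahedron hS hact K (0, 0, 0) (0, 0, 1) (0, 1, 1) (1, 1, 1)
  have T₅ := triangleValue_tetrahedron hS hact K (0, 0, 0) (0, 0, 1) (1, 0, 1) (1, 1, 1)
  have T₆ := triangleValue_tetrahedron hS hact K (0, 0, 0) (1, 0, 0) (1, 0, 1) (1, 1, 1)
  rw [hx, hy, hz 1 1 (.inr rfl) (.inr rfl)] at T₁ T₂
  rw [hx, hy, hz 0 1 (.inl rfl) (.inr rfl)] at T₃
  rw [hx, hy, hz 0 0 (.inl rfl) (.inl rfl)] at T₄ T₅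
  rw [hx, hy, hz 1 0 (.inr rfl) (.inl rfl)] at T₆
  have e₀ := squareValue_comp hS K F₀ ⟨fun z => (z.1, z.2, 0), by fun_prop⟩
    (fun t x y => Prod.ext rfl (Prod.ext rfl (seg_self _ _).symm)) fun z => hF₀ z.1 z.2
  have e₁ := squareValue_comp hS K F₁ ⟨fun z => (z.1, z.2, 1), by fun_prop⟩
    (fun t x y => Prod.ext rfl (Prod.ext rfl (seg_self _ _).symm)) fun z => hF₁ z.1 z.2
  let G (s : I) : C(I × I, I × I × I) := ⟨fun z => (s, z.1, z.2), by fun_prop⟩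
  let G' (t : I) : C(I × I, I × I × I) := ⟨fun z => (z.1, t, z.2), by fun_prop⟩
  have e₂ := (squareValue_comp hS K (K.comp (G 1)) (G 0)
    (fun t x y => Prod.ext (seg_self _ _).symm rfl) fun z => h₁ z.1 z.2).trans
    (squareValue_comp hS K (K.comp (G 1)) (G 1)
    (fun t x y => Prod.ext (seg_self _ _).symm rfl) fun z => rfl).symm
  have e₃ := (squareValue_comp hS K (K.comp (G' 1)) (G' 0)
    (fun t x y => Prod.ext rfl (Prod.ext (seg_self _ _).symm rfl)) fun z => h₂ z.1 z.2).trans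
    (squareValue_comp hS K (K.comp (G' 1)) (G' 1)
    (fun t x y => Prod.ext rfl (Prod.ext (seg_self _ _).symm rfl)) fun z => rfl).symm
  simp only [ContinuousMap.coe_mk, G, G'] at e₀ e₁ e₂ e₃
  rw [← e₀, ← e₁, ← T₁, ← T₂, ← T₃, ← T₄, ← T₅, ← T₆]
  rw [← sub_eq_zero] at e₂ e₃ ⊢
  refine Eq.trans ?_ ((congrArg₂ (· - ·) e₂ e₃).trans (sub_zero 0))
  abel

end Values

end TriangleValue

/-! ### Homotopy commutative multiplications -/

section Hopf

variable {W : Type*} [TopologicalSpace W]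

/-- A multiplication that is commutative up to homotopy and for which multiplication with any point
is homotopic to the identity. -/
structure IsHopf (μ : C(W × W, W)) : Prop where
  right_unit : ∀ w, (μ.comp ((ContinuousMap.id W).prodMk (ContinuousMap.const W w))).Homotopic
    (ContinuousMap.id W)
  comm : μ.Homotopic (μ.comp ContinuousMap.prodSwap)

theorem IsHopf.left_unit {μ : C(W × W, W)} (h : IsHopf μ) (w : W) :
    (μ.comp ((ContinuousMap.const W w).prodMk (ContinuousMap.id W))).Homotopic
      (ContinuousMap.id W) :=
  (h.comm.comp (.refl _)).trans (h.right_unit w)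

theorem cls_evalAt_naturality {X Y : Type*} [TopologicalSpace X] [TopologicalSpace Y] {f g : C(X, Y)}
    (H : f.Homotopy g) {x y : X} (p : Path x y) :
    cls (p.map f.continuous) ≫ cls (H.evalAt y) = cls (H.evalAt x) ≫ cls (p.map g.continuous) :=
  naturality_of_homotopy H (cls p)

theorem cls_evalAt_conj {X : Type*} [TopologicalSpace X] {f : C(X, X)}
    (H : f.Homotopy (ContinuousMap.id X)) {x : X}
    (a : FundamentalGroupoid.mk x ⟶ FundamentalGroupoid.mk x) :
    (FundamentalGroupoid.map f).map a ≫ cls (H.evalAt x) = cls (H.evalAt x) ≫ a := by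
  induction a using Path.Homotopic.Quotient.ind with | mk γ =>
  exact cls_evalAt_naturality H γ

theorem cls_eval {X : Type*} [TopologicalSpace X] {x y : X} {p q : Path x y} (H : p.Homotopy q)
    (s : I) : cls (H.eval s) = cls p :=
  cls_eq_iff.2 (Path.Homotopic.symm
    ⟨{ toFun := fun z => H (z.1 * s, z.2)
       continuous_toFun := by fun_prop
       map_zero_left := fun t => by simp
       map_one_left := fun t => by simp
       prop' := by rintro t _ (rfl | rfl) <;> simp }⟩)

theorem mapTwoEnd_id {X : Type*} [TopologicalSpace X] {x : X} (b : TwoEnd (⟨x⟩ : PathBicat X)) :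
    mapTwoEnd (ContinuousMap.id X) x b = b := by
  obtain ⟨b⟩ := b
  induction b using Path.Homotopic.Quotient.ind with | mk Γ =>
  rfl

theorem comp_comm_of_conj {C : Type*} [Groupoid C] {x y : C} (κ κ' : y ⟶ x)
    (F G : (x ⟶ x) → (y ⟶ y)) (hF : ∀ a, F a ≫ κ' = κ' ≫ a) (hG : ∀ a, G a ≫ κ = κ ≫ a)
    (h : ∀ a b, G b ≫ F a = F a ≫ G b) (a b : x ⟶ x) : a ≫ b = b ≫ a := by
  have h₁ := h a (inv κ ≫ κ' ≫ b ≫ inv κ' ≫ κ)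
  rw [(IsIso.eq_comp_inv κ').2 (hF a), (IsIso.eq_comp_inv κ).2 (hG _)] at h₁
  exact (cancel_epi κ').1 ((cancel_mono (inv κ')).1 (by simpa using h₁.symm))

theorem exists_comp_eq_of_conj {C : Type*} [Groupoid C] {x y : C} (κ κ' : y ⟶ x)
    (F : (x ⟶ x) → (y ⟶ y)) (hF : ∀ a, F a ≫ κ' = κ' ≫ a) (a : x ⟶ x) :
    ∃ b, F b ≫ κ = κ ≫ a := by
  refine ⟨inv κ' ≫ κ ≫ a ≫ inv κ ≫ κ', ?_⟩
  rw [(IsIso.eq_comp_inv κ').2 (hF _)]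
  simp

/-- Multiplication with the points of a loop, as a homotopy. -/
def translation (μ : C(W × W, W)) {e : W} (γ : Path e e) :
    (μ.comp ((ContinuousMap.const W e).prodMk (ContinuousMap.id W))).Homotopy
      (μ.comp ((ContinuousMap.const W e).prodMk (ContinuousMap.id W))) where
  toFun z := μ (γ z.1, z.2)
  continuous_toFun := by fun_prop
  map_zero_left w := by simp
  map_one_left w := by simp

/-- The homotopies from multiplication with a point on the left and on the right to the identity,
on the level of the fundamental group. -/
theorem IsHopf.exists_conj {μ : C(W × W, W)} (h : IsHopf μ) (e : W) :
    ∃ (L : (μ.comp ((ContinuousMap.const W e).prodMk (ContinuousMap.id W))).Homotopy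
        (ContinuousMap.id W)) (κ' : FundamentalGroupoid.mk (μ (e, e)) ⟶ FundamentalGroupoid.mk e)
      (F G : (FundamentalGroupoid.mk e ⟶ FundamentalGroupoid.mk e) →
        (FundamentalGroupoid.mk (μ (e, e)) ⟶ FundamentalGroupoid.mk (μ (e, e)))),
      (∀ γ : Path e e, F (cls γ) = cls ((translation μ γ).evalAt e)) ∧
      (∀ a, F a ≫ κ' = κ' ≫ a) ∧ (∀ a, G a ≫ cls (L.evalAt e) = cls (L.evalAt e) ≫ a) ∧
        ∀ a b, G b ≫ F a = F a ≫ G b := by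
  obtain ⟨R⟩ := h.right_unit e
  obtain ⟨L⟩ := h.left_unit e
  refine ⟨L, cls (R.evalAt e), fun a => (FundamentalGroupoid.map
    (μ.comp ((ContinuousMap.id W).prodMk (ContinuousMap.const W e)))).map a,
    fun a => (FundamentalGroupoid.map
    (μ.comp ((ContinuousMap.const W e).prodMk (ContinuousMap.id W)))).map a, fun γ => rfl,
    fun a => cls_evalAt_conj (x := e) R a, fun a => cls_evalAt_conj (x := e) L a, fun a b => ?_⟩
  induction a using Path.Homotopic.Quotient.ind with | mk γ =>
  exact naturality_of_homotopy (translation μ γ) b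

/-- The fundamental group is commutative. -/
theorem IsHopf.comp_comm {μ : C(W × W, W)} (h : IsHopf μ) {e : W}
    (a b : FundamentalGroupoid.mk e ⟶ FundamentalGroupoid.mk e) : a ≫ b = b ≫ a := by
  obtain ⟨L, κ', F, G, -, hF, hG, hFG⟩ := h.exists_conj e
  exact comp_comm_of_conj (cls (L.evalAt e)) κ' F G hF hG hFG a b

/-- The fundamental group acts trivially on the second homotopy group. -/
theorem IsHopf.transports_self {μ : C(W × W, W)} (h : IsHopf μ) {e : W} (u : Path e e)
    (b : TwoEnd (⟨e⟩ : PathBicat W)) : Transports (arr u) b b := by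
  obtain ⟨L, κ', F, G, hFγ, hF, -, -⟩ := h.exists_conj e
  let f : C(W, W) := μ.comp ((ContinuousMap.const W e).prodMk (ContinuousMap.id W))
  obtain ⟨γ, hγ⟩ := exists_comp_eq_of_conj (cls (L.evalAt e)) κ' F hF (cls u)
  induction γ using Path.Homotopic.Quotient.ind with | mk γ =>
  obtain ⟨θ⟩ : Nonempty (arr ((translation μ γ).evalAt e) ≫ arr (L.evalAt e) ⟶
      arr (L.evalAt e) ≫ arr u) := nonempty_twoCell.2 (cls_eq_iff.1
        ((congrArg (· ≫ cls (L.evalAt e)) (hFγ γ)).symm.trans hγ))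
  have t₁ : Transports (arr ((translation μ γ).evalAt e)) (mapTwoEnd f e b) (mapTwoEnd f e b) :=
    transports_evalAt (translation μ γ) b
  have t₂ : Transports (arr (L.evalAt e)) (mapTwoEnd f e b) b := by
    have := transports_evalAt L b
    rwa [mapTwoEnd_id] at this
  exact ((t₁.comp t₂).congr θ).of_comp_right t₂

variable {e : W} {A : Type*} [AddCommGroup A] {S : Framing (⟨e⟩ : PathBicat W) A}

theorem Framing.IsAdditive.label_map_of_homotopic {X : Type*} [TopologicalSpace X]
    (hS : S.IsAdditive) {f g : C(X, W)} (h : f.Homotopic g) {x : X} (p : Path x x) :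
    S.label (arr (p.map f.continuous)) = S.label (arr (p.map g.continuous)) := by
  obtain ⟨H⟩ := h
  have := hS.label_cls (p := (p.map f.continuous).trans (H.evalAt x))
    (q := (H.evalAt x).trans (p.map g.continuous)) (cls_evalAt_naturality H p)
  rw [hS.label_trans, hS.label_trans, add_comm] at this
  exact add_left_cancel this

theorem Framing.IsAdditive.label_map_of_homotopic_id (hS : S.IsAdditive) {f : C(W, W)}
    (h : f.Homotopic (ContinuousMap.id W)) {x : W} (p : Path x x) :
    S.label (arr (p.map f.continuous)) = S.label (arr p) :=
  hS.label_map_of_homotopic h p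

theorem seg_unit (t : I) : seg t (0 : I) 1 = t := Subtype.ext (by
  change (1 - (t : ℝ)) * 0 + t * 1 = t
  ring)

theorem label_edge_eq {D : Type*} [TopologicalSpace D] [SegmentSpace D] (hS : S.IsAdditive)
    (K : C(D, W)) (a b : D) {f : C(W, W)} (h : f.Homotopic (ContinuousMap.id W)) {x : W}
    (p : Path x x) (hp : ∀ t, K (seg t a b) = f (p t)) :
    S.label (arr (imagePath K a b)) = S.label (arr p) :=
  (label_imagePath K a b (p.map f.continuous) hp).trans (hS.label_map_of_homotopic_id h p)

/-- The product of two loops, as a map on a square. -/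
def loopSquare (μ : C(W × W, W)) (p q : Path e e) : C(I × I, W) :=
  μ.comp (p.toContinuousMap.prodMap q.toContinuousMap)

/-- The alternating sum over all permutations of the arguments vanishes for the associativity
defect, because it is the value of the cochain on the boundary of a 3-dimensional torus. -/
theorem IsHopf.defect_alternating {μ : C(W × W, W)} (h : IsHopf μ) (hS : S.IsAdditive)
    (hact : ∀ (a : A) (b : TwoEnd (⟨e⟩ : PathBicat W)),
      actR (S.loop a) b.hom = actL b.hom (S.loop a)) (hlab : ∀ a, S.label (S.loop a) = a)
    (x y z : A) : S.defect x y z - S.defect y x z + S.defect y z x -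
      S.defect z y x + S.defect z x y - S.defect x z y = 0 := by
  let p : Path e e := (S.loop x).as
  let q : Path e e := (S.loop y).as
  let r : Path e e := (S.loop z).as
  let K : C(I × I × I, W) := ⟨fun d => μ (μ (p d.1, q d.2.1), r d.2.2), by fun_prop⟩
  let F : C(I × I, W) := ⟨fun d => μ (μ (p d.1, q d.2), e), by fun_prop⟩
  have hR (w : W) := h.right_unit w
  have hL (w : W) := h.left_unit w
  rw [← defect_cube hS hact K (x := x) (y := y) (z := z) (fun t s => ?_) (fun t s => ?_)
    (fun t s _ _ => ?_) (fun t s => ?_) (fun t s => ?_) F F (fun t s => ?_) (fun t s => ?_), sub_self]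
  · refine (label_edge_eq hS K _ _ ((hR (r s)).comp (hR (q t))) p fun i => ?_).trans (hlab x)
    change μ (μ (p (seg i 0 1), q (seg i t t)), r (seg i s s)) = μ (μ (p i, q t), r s)
    rw [seg_unit, seg_self, seg_self]
  · refine (label_edge_eq hS K _ _ ((hR (r s)).comp (hL (p t))) q fun i => ?_).trans (hlab y)
    change μ (μ (p (seg i t t), q (seg i 0 1)), r (seg i s s)) = μ (μ (p t, q i), r s)
    rw [seg_unit, seg_self, seg_self]
  · refine (label_edge_eq hS K _ _ (hL (μ (p t, q s))) r fun i => ?_).trans (hlab z)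
    change μ (μ (p (seg i t t), q (seg i s s)), r (seg i 0 1)) = μ (μ (p t, q s), r i)
    rw [seg_unit, seg_self, seg_self]
  · simp [K]
  · simp [K]
  · simp [K, F]
  · simp [K, F]

/-- The value of the cochain on the product of two loops depends only on the homotopy class of the
second one. -/
theorem IsHopf.squareValue_congr {μ : C(W × W, W)} (h : IsHopf μ) (hS : S.IsAdditive)
    (hact : ∀ (a : A) (b : TwoEnd (⟨e⟩ : PathBicat W)),
      actR (S.loop a) b.hom = actL b.hom (S.loop a)) (hlab : ∀ a, S.label (S.loop a) = a)
    (p : Path e e) {q q' : Path e e} (hq : q.Homotopic q') :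
    squareValue hS (loopSquare μ p q) = squareValue hS (loopSquare μ p q') := by
  obtain ⟨H⟩ := hq
  let K : C(I × I × I, W) := ⟨fun d => μ (p d.1, H (d.2.2, d.2.1)), by fun_prop⟩
  have := defect_cube hS hact K (x := S.label (arr p)) (y := S.label (arr q)) (z := 0)
    (fun t s => ?_) (fun t s => ?_)
    (fun t s _ hs => ?_) (fun t s => ?_) (fun t s => ?_) (loopSquare μ p q) (loopSquare μ p q')
    (fun t s => ?_) (fun t s => ?_)
  · rw [h.defect_alternating hS hact hlab] at this
    exact (sub_eq_zero.1 this).symm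
  · refine label_edge_eq hS K _ _ (h.right_unit (H (s, t))) p fun i => ?_
    change μ (p (seg i 0 1), H (seg i s s, seg i t t)) = μ (p i, H (s, t))
    rw [seg_unit, seg_self, seg_self]
  · refine (label_edge_eq hS K _ _ (h.left_unit (p t)) (H.eval s) fun i => ?_).trans
      (hS.label_cls (cls_eval H s))
    change μ (p (seg i t t), H (seg i s s, seg i 0 1)) = μ (p t, H (s, i))
    rw [seg_unit, seg_self, seg_self]
  · refine (label_imagePath K _ _ (Path.refl (μ (p t, e))) fun i => ?_).trans
      (hS.label_id ⟨μ (p t, e)⟩)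
    change μ (p (seg i t t), H (seg i 0 1, seg i s s)) = μ (p t, e)
    rw [seg_unit, seg_self, seg_self]
    rcases hs with rfl | rfl <;> simp
  · simp [K]
  · simp [K]
  · simp [K, loopSquare]
  · simp [K, loopSquare]

/-- The multiplication makes the associativity defect a symmetric cocycle. -/
theorem IsHopf.isSymmetricCocycle {μ : C(W × W, W)} (h : IsHopf μ) (hS : S.IsAdditive)
    (hact : ∀ (a : A) (b : TwoEnd (⟨e⟩ : PathBicat W)),
      actR (S.loop a) b.hom = actL b.hom (S.loop a)) (hlab : ∀ a, S.label (S.loop a) = a) :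
    IsSymmetricCocycle S.defect
      fun a b => squareValue hS (loopSquare μ (S.loop a).as (S.loop b).as) where
  cocycle := defect_cocycle hS hact hlab
  hexagon x y z := by
    let p : Path e e := (S.loop x).as
    let q : Path e e := (S.loop y).as
    let r : Path e e := (S.loop z).as
    have hqr : Path.Homotopic (S.loop (y + z)).as (q.trans r) :=
      (nonempty_twoCell.1 ⟨S.mul y z _ rfl⟩).symm
    rw [h.squareValue_congr hS hact hlab _ hqr]
    -- The prism is the product of a path and of a triangle with edges `q`, `r` and `q.trans r`.
    let φ : C(I × I, I) := ⟨fun d => ⟨((d.1 : ℝ) + d.2) / 2, by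
      have := d.1.2.1; have := d.1.2.2; have := d.2.2.1; have := d.2.2.2
      constructor <;> linarith⟩, by fun_prop⟩
    have φ₁ (t : I) : φ (t, 0) = firstHalf t := Subtype.ext (by simp [φ, firstHalf])
    have φ₂ (t : I) : φ (1, t) = secondHalf t := Subtype.ext (by simp [φ, secondHalf])
    have φ₃ (t : I) : φ (t, t) = t := Subtype.ext (by simp [φ])
    let K : C(I × I × I, W) := ⟨fun d => μ (p d.1, (q.trans r) (φ d.2)), by fun_prop⟩
    refine defect_prism hS hact K (fun t s => ?_) (fun s => ?_) (fun s => ?_) (fun t s => ?_)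
      (loopSquare μ p q) (loopSquare μ p r) (loopSquare μ p (q.trans r)) (fun t s => ?_)
      (fun t s => ?_) (fun t s => ?_)
    · refine (label_edge_eq hS K _ _ (h.right_unit ((q.trans r) (φ (t, s)))) p fun i => ?_).trans
        (hlab x)
      change μ (p (seg i 0 1), (q.trans r) (φ (seg i (t, s) (t, s)))) = _
      rw [seg_unit, seg_self]
      rfl
    · refine (label_edge_eq hS K _ _ (h.left_unit (p s)) q fun i => ?_).trans (hlab y)
      change μ (p (seg i s s), (q.trans r) (φ (seg i 0 1, seg i 0 0))) = μ (p s, q i)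
      rw [seg_unit, seg_self, seg_self, φ₁, trans_firstHalf]
    · refine (label_edge_eq hS K _ _ (h.left_unit (p s)) r fun i => ?_).trans (hlab z)
      change μ (p (seg i s s), (q.trans r) (φ (seg i 1 1, seg i 0 1))) = μ (p s, r i)
      rw [seg_unit, seg_self, seg_self, φ₂, trans_secondHalf]
    · simp [K]
    · change μ (p t, (q.trans r) (φ (s, 0))) = μ (p t, q s)
      rw [φ₁, trans_firstHalf]
    · change μ (p t, (q.trans r) (φ (1, s))) = μ (p t, r s)
      rw [φ₂, trans_secondHalf]
    · change μ (p t, (q.trans r) (φ (s, s))) = μ (p t, (q.trans r) s)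
      rw [φ₃]
  skew x y := by
    -- The cube of the homotopy from `μ` to its opposite; the alternating sum of defects vanishes.
    let p : Path e e := (S.loop x).as
    let q : Path e e := (S.loop y).as
    obtain ⟨H⟩ := h.comm
    let K : C(I × I × I, W) := ⟨fun d => H (d.2.2, (p d.1, q d.2.1)), by fun_prop⟩
    have e₀ : ∀ s t : I, (s = 0 ∨ s = 1) → (t = 0 ∨ t = 1) → p s = e ∧ q t = e := by
      rintro s t (rfl | rfl) (rfl | rfl) <;> simp
    let R (s : I) : C(W × W, W) := ⟨fun w => H (s, w), by fun_prop⟩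
    have hR (s : I) : (R s).Homotopic μ := ContinuousMap.Homotopic.symm
      ⟨{ toFun := fun z => H (z.1 * s, z.2)
         continuous_toFun := by fun_prop
         map_zero_left := fun w => by simp
         map_one_left := fun w => by simp [R] }⟩
    have := defect_cube hS hact K (x := x) (y := y) (z := S.label (arr (H.evalAt (e, e))))
      (fun t s => ?_) (fun t s => ?_)
      (fun t s ht hs => ?_) (fun t s => ?_) (fun t s => ?_) (loopSquare μ p q)
      ((loopSquare μ q p).comp ContinuousMap.prodSwap)
      (fun t s => ?_) (fun t s => ?_)
    · rw [h.defect_alternating hS hact hlab, squareValue_swap, ← neg_add', neg_eq_zero,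
        add_comm] at this
      exact this
    · refine (label_edge_eq hS K _ _ (f := (R s).comp ((ContinuousMap.id W).prodMk
        (ContinuousMap.const W (q t)))) (((hR s).comp (.refl _)).trans (h.right_unit _)) p
          fun i => ?_).trans (hlab x)
      change H (seg i s s, (p (seg i 0 1), q (seg i t t))) = H (s, (p i, q t))
      rw [seg_unit, seg_self, seg_self]
    · refine (label_edge_eq hS K _ _ (f := (R s).comp ((ContinuousMap.const W (p t)).prodMk
        (ContinuousMap.id W))) (((hR s).comp (.refl _)).trans (h.left_unit _)) q
          fun i => ?_).trans (hlab y)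
      change H (seg i s s, (p (seg i t t), q (seg i 0 1))) = H (s, (p t, q i))
      rw [seg_unit, seg_self, seg_self]
    · refine label_imagePath K _ _ (H.evalAt (e, e)) fun i => ?_
      change H (seg i 0 1, (p (seg i t t), q (seg i s s))) = H (i, (e, e))
      rw [seg_unit, seg_self, seg_self, (e₀ t s ht hs).1, (e₀ t s ht hs).2]
    · simp [K]
    · simp [K]
    · simp [K, loopSquare]
    · simp [K, loopSquare]

end Hopf

/-! ### Double loop spaces -/

section DoubleLoop

variable {N Y : Type*} [DecidableEq N] [TopologicalSpace Y] {y : Y}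

/-- Concatenation of loops in direction `i`. -/
def concat (i : N) : C(GenLoop N Y y × GenLoop N Y y, GenLoop N Y y) where
  toFun f := GenLoop.transAt i f.1 f.2
  continuous_toFun := by
    have : (fun f : GenLoop N Y y × GenLoop N Y y => GenLoop.transAt i f.1 f.2) =
        fun f => GenLoop.fromLoop i ((GenLoop.toLoop i f.1).trans (GenLoop.toLoop i f.2)) :=
      funext fun f => GenLoop.fromLoop_trans_toLoop.symm
    rw [this]
    have h₁ := GenLoop.continuous_toLoop (X := Y) (x := y) i
    have h₂ := GenLoop.continuous_fromLoop (X := Y) (x := y) i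
    fun_prop

theorem toLoop_const (i : N) :
    GenLoop.toLoop i (GenLoop.const : GenLoop N Y y) = Path.refl _ := by
  ext
  rfl

theorem concat_right_unit (i : N) :
    ((concat i).comp ((ContinuousMap.id _).prodMk (ContinuousMap.const _ GenLoop.const))).Homotopic
      (ContinuousMap.id (GenLoop N Y y)) := by
  let F : C(_, GenLoop N Y y) := ⟨_, GenLoop.continuous_fromLoop i⟩
  let T : C(GenLoop N Y y, _) := ⟨_, GenLoop.continuous_toLoop i⟩
  let h' : C(GenLoop N Y y, Path (GenLoop.const : GenLoop { j // j ≠ i } Y y) GenLoop.const) :=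
    ⟨fun f => (T f).trans (Path.refl _), by fun_prop⟩
  have H := (reparamHomotopy T rightUnitPath h' fun p => rightUnitPath_spec (T p))
  have h₁ : F.comp h' = (concat i).comp ((ContinuousMap.id _).prodMk
      (ContinuousMap.const _ GenLoop.const)) := by
    ext1 f
    change GenLoop.fromLoop i ((GenLoop.toLoop i f).trans (Path.refl _)) =
      GenLoop.transAt i f GenLoop.const
    rw [← GenLoop.fromLoop_trans_toLoop, toLoop_const]
  have h₂ : F.comp T = ContinuousMap.id _ :=
    ContinuousMap.ext (GenLoop.loopHomeo i).left_inv
  rw [← h₁, ← h₂]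
  exact (ContinuousMap.Homotopic.refl F).comp ⟨H⟩

theorem concat_left_unit (i : N) :
    ((concat i).comp ((ContinuousMap.const _ GenLoop.const).prodMk (ContinuousMap.id _))).Homotopic
      (ContinuousMap.id (GenLoop N Y y)) := by
  let F : C(_, GenLoop N Y y) := ⟨_, GenLoop.continuous_fromLoop i⟩
  let T : C(GenLoop N Y y, _) := ⟨_, GenLoop.continuous_toLoop i⟩
  let h' : C(GenLoop N Y y, Path (GenLoop.const : GenLoop { j // j ≠ i } Y y) GenLoop.const) :=
    ⟨fun f => (Path.refl _).trans (T f), by fun_prop⟩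
  have H := (reparamHomotopy T leftUnitPath h' fun p => leftUnitPath_spec (T p))
  have h₁ : F.comp h' = (concat i).comp ((ContinuousMap.const _ GenLoop.const).prodMk
      (ContinuousMap.id _)) := by
    ext1 f
    change GenLoop.fromLoop i ((Path.refl _).trans (GenLoop.toLoop i f)) =
      GenLoop.transAt i GenLoop.const f
    rw [← GenLoop.fromLoop_trans_toLoop, toLoop_const]
  have h₂ : F.comp T = ContinuousMap.id _ :=
    ContinuousMap.ext (GenLoop.loopHomeo i).left_inv
  rw [← h₁, ← h₂]
  exact (ContinuousMap.Homotopic.refl F).comp ⟨H⟩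

/-- The Eckmann–Hilton argument, first half: concatenations in two directions agree up to
homotopy. -/
theorem concat_homotopic {i j : N} (hij : i ≠ j) :
    (concat i : C(GenLoop N Y y × GenLoop N Y y, _)).Homotopic (concat j) := by
  let c : GenLoop N Y y := GenLoop.const
  have h₁ := (ContinuousMap.Homotopic.refl (concat i)).comp
    ((concat_right_unit j).prodMap (concat_left_unit (y := y) j))
  have h₂ := (ContinuousMap.Homotopic.refl (concat j)).comp
    ((concat_right_unit i).prodMap (concat_left_unit (y := y) i))
  refine h₁.symm.trans (Eq.subst (motive := fun F => ContinuousMap.Homotopic F _) ?_ h₂)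
  exact ContinuousMap.ext fun f => (GenLoop.transAt_distrib hij f.1 c c f.2).symm

/-- The Eckmann–Hilton argument, second half. -/
theorem concat_homotopic_swap {i j : N} (hij : i ≠ j) :
    (concat i : C(GenLoop N Y y × GenLoop N Y y, _)).Homotopic
      ((concat j).comp ContinuousMap.prodSwap) := by
  let c : GenLoop N Y y := GenLoop.const
  have h₁ := (ContinuousMap.Homotopic.refl (concat i)).comp
    ((concat_left_unit j).prodMap (concat_right_unit (y := y) j))
  have h₂ := (ContinuousMap.Homotopic.refl (concat j)).comp
    (((concat_left_unit i).prodMap (concat_right_unit (y := y) i)).comp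
      (.refl ContinuousMap.prodSwap))
  refine h₁.symm.trans (Eq.subst (motive := fun F => ContinuousMap.Homotopic F _) ?_ h₂)
  exact ContinuousMap.ext fun f => (GenLoop.transAt_distrib hij c f.1 f.2 c).symm

/-- Concatenation with the constant loop is homotopic to the identity, and any other point is joined
to the constant loop by a path. -/
theorem isHopf_concat [PathConnectedSpace (GenLoop N Y y)] {i j : N} (hij : i ≠ j) :
    IsHopf (concat i : C(GenLoop N Y y × GenLoop N Y y, _)) where
  right_unit w := by
    refine .trans ?_ (concat_right_unit i)
    refine (ContinuousMap.Homotopic.refl _).comp (.prodMk (.refl _) ?_)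
    exact ContinuousMap.homotopic_const_iff.2 (PathConnectedSpace.joined _ _)
  comm := (concat_homotopic hij).trans (concat_homotopic_swap hij.symm)

end DoubleLoop

/-! ### Weak homotopy equivalences -/

section Weak

variable {X Y : Type*} [TopologicalSpace X] [TopologicalSpace Y] {f : C(X, Y)}

theorem pathConnectedSpace_iff_of_bijective (hf : Function.Bijective (zerothHomotopyMap f)) :
    PathConnectedSpace X ↔ PathConnectedSpace Y := by
  rw [pathConnectedSpace_iff_zerothHomotopy, pathConnectedSpace_iff_zerothHomotopy,
    (Equiv.ofBijective _ hf).nonempty_congr, (Equiv.ofBijective _ hf).subsingleton_congr]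

/-- The homomorphism on fundamental groups induced by a continuous map. -/
def mapPiOne (f : C(X, Y)) (x : X) : PiOne x →+ PiOne (f x) where
  toFun a := ⟨(FundamentalGroupoid.map f).map a.hom⟩
  map_zero' := PiOne.ext ((FundamentalGroupoid.map f).map_id _)
  map_add' a b := PiOne.ext ((FundamentalGroupoid.map f).map_comp a.hom b.hom)

theorem mapPiOne_bijective {x : X} (hf : Function.Bijective (homotopyGroupMap 1 f x)) :
    Function.Bijective (mapPiOne f x) := by
  have h : Function.Bijective fun a : FundamentalGroup X x =>
      HomotopyGroup.pi1EquivFundamentalGroup (homotopyGroupMap 1 f x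
        (HomotopyGroup.pi1EquivFundamentalGroup.symm a)) :=
    HomotopyGroup.pi1EquivFundamentalGroup.bijective.comp
      (hf.comp HomotopyGroup.pi1EquivFundamentalGroup.symm.bijective)
  have h' (a : PiOne x) : (mapPiOne f x a).hom =
      HomotopyGroup.pi1EquivFundamentalGroup (homotopyGroupMap 1 f x
        (HomotopyGroup.pi1EquivFundamentalGroup.symm a.hom)) := by
    obtain ⟨a⟩ := a
    induction a using Path.Homotopic.Quotient.ind with | mk γ =>
    rfl
  constructor
  · intro a b hab
    exact PiOne.ext (h.1 ((h' a).symm.trans ((congrArg PiOne.hom hab).trans (h' b))))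
  · intro b
    obtain ⟨a, ha⟩ := h.2 b.hom
    exact ⟨⟨a⟩, PiOne.ext ((h' ⟨a⟩).trans ha)⟩

theorem mapTwoEnd_loopCell (f : C(X, Y)) {x : X} (p : GenLoop (Fin 2) X x) :
    mapTwoEnd f x (loopCell p) = loopCell ⟨f.comp p.1, fun y hy => congrArg f (p.2 y hy)⟩ := rfl

theorem mapTwoEnd_bijective {x : X} (hf : Function.Bijective (homotopyGroupMap 2 f x)) :
    Function.Bijective (mapTwoEnd f x) := by
  constructor
  · intro a b h
    obtain ⟨p, rfl⟩ := loopCell_surjective a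
    obtain ⟨q, rfl⟩ := loopCell_surjective b
    rw [mapTwoEnd_loopCell, mapTwoEnd_loopCell, loopCell_eq_iff] at h
    exact (loopCell_eq_iff p q).2 (Quotient.exact (hf.1 (a₁ := ⟦p⟧) (a₂ := ⟦q⟧) (Quotient.sound h)))
  · intro b
    obtain ⟨q, rfl⟩ := loopCell_surjective b
    obtain ⟨p, hp⟩ := hf.2 ⟦q⟧
    induction p using Quotient.inductionOn with | _ p
    exact ⟨loopCell p, (loopCell_eq_iff _ _).2 (Quotient.exact hp)⟩

theorem LoopSystem.Represents.push {x : X} {A : Type*} [AddGroup A]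
    {L : LoopSystem (⟨x⟩ : PathBicat X) A} {ι : A ≃+ PiOne x} (hL : L.Represents ι)
    (hf : Function.Bijective (mapPiOne f x)) :
    (L.push f).Represents (ι.trans (AddEquiv.ofBijective (mapPiOne f x) hf)) :=
  fun a => congrArg (FundamentalGroupoid.map f).map (hL a)

end Weak

/-! ### Trivial action and vanishing of the invariant -/

section Simple

/-- The fundamental group acts trivially on the second homotopy group. -/
def IsSimpleAt {X : Type*} [TopologicalSpace X] (e : X) : Prop :=
  ∀ (u : (⟨e⟩ : PathBicat X) ⟶ ⟨e⟩) (b : TwoEnd (⟨e⟩ : PathBicat X)),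
    actR u b.hom = actL b.hom u

variable {X Y : Type*} [TopologicalSpace X] [TopologicalSpace Y] {f : C(X, Y)} {x : X}

theorem IsSimpleAt.of_injective (h : IsSimpleAt (f x)) (hf : Function.Injective (mapTwoEnd f x)) :
    IsSimpleAt x := by
  intro u b
  obtain ⟨b', hb'⟩ := actL_surjective u (actR u b.hom)
  have h₁ := congrArg (map₂ f) (hb'.symm)
  have h₂ : map₂ f (actL b' u) = actL (mapTwoEnd f x ⟨b'⟩).hom (map₁ f u) := map₂_actL f ⟨b'⟩ u
  rw [map₂_actR, h] at h₁
  have h₃ := actL_injective _ (h₁.trans h₂)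
  rw [← hb', hf (TwoEnd.ext h₃)]

theorem IsSimpleAt.push (h : IsSimpleAt x) (hf : Function.Surjective (mapTwoEnd f x))
    {A : Type*} [AddGroup A] (L : LoopSystem (⟨x⟩ : PathBicat X) A) (a : A)
    (b : TwoEnd (⟨f x⟩ : PathBicat Y)) :
    actR ((L.push f).loop a) b.hom = actL b.hom ((L.push f).loop a) := by
  obtain ⟨b, rfl⟩ := hf b
  refine (map₂_actR f b (L.loop a)).symm.trans (.trans ?_ (map₂_actL f b (L.loop a)))
  rw [h]

theorem IsHopf.isSimpleAt {μ : C(X × X, X)} (h : IsHopf μ) : IsSimpleAt x :=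
  fun u b => (h.transports_self u.as b).symm

theorem IsHopf.exists_coboundary [PathConnectedSpace X] {μ : C(X × X, X)} (h : IsHopf μ)
    {A : Type*} [AddCommGroup A] {L : LoopSystem (⟨x⟩ : PathBicat X) A} {ι : A ≃+ PiOne x}
    (hL : L.Represents ι) : ∃ m, ∀ a b c, L.defect a b c = coboundary m a b c := by
  let p (y : X) : Path x y := PathConnectedSpace.somePath x y
  refine (h.isSymmetricCocycle (S := pathFraming p hL) (pathFraming_isAdditive p hL)
    (fun a b => h.isSimpleAt _ b) fun a => ?_).exists_coboundary
  change ι.symm _ = a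
  rw [AddEquiv.symm_apply_eq]
  ext
  change cls (p x) ≫ cls _ ≫ inv (cls (p x)) = _
  rw [h.comp_comm, Category.assoc, IsIso.inv_hom_id, Category.comp_id]
  exact hL a

/-- On a path-connected double loop space, the obstruction to a homomorphic choice of loops is a
coboundary. Both the obstruction and the cochain are computed on the common source of two weak
homotopy equivalences and are mapped to the space from there. -/
theorem exists_framing {X : Type u} [TopologicalSpace X] [PathConnectedSpace X]
    (hX : IsDoubleLoopSpace.{u, v} X) :
    ∃ (e : X) (A : Type (max u v)) (_ : AddCommGroup A) (S : Framing (⟨e⟩ : PathBicat X) A)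
      (m : A → A → TwoEnd (⟨e⟩ : PathBicat X)), S.IsAdditive ∧
      (∀ (a : A) (b : TwoEnd (⟨e⟩ : PathBicat X)),
        actR (S.loop a) b.hom = actL b.hom (S.loop a)) ∧
      ∀ a b c, S.defect a b c = coboundary m a b c := by
  obtain ⟨Y, _, y, Z, _, f, g, hf, hg⟩ := hX
  have : PathConnectedSpace Z := (pathConnectedSpace_iff_of_bijective hf.1).2 inferInstance
  have : PathConnectedSpace (GenLoop (Fin 2) Y y) :=
    (pathConnectedSpace_iff_of_bijective hg.1).1 inferInstance
  have hW : IsHopf (concat (0 : Fin 2) : C(GenLoop (Fin 2) Y y × GenLoop (Fin 2) Y y, _)) :=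
    isHopf_concat Fin.zero_ne_one
  let z : Z := Classical.arbitrary Z
  have hf₁ := mapPiOne_bijective (hf.2 1 z le_rfl)
  have hg₁ := mapPiOne_bijective (hg.2 1 z le_rfl)
  have hf₂ := mapTwoEnd_bijective (hf.2 2 z one_le_two)
  have hg₂ := mapTwoEnd_bijective (hg.2 2 z one_le_two)
  let : AddCommGroup (PiOne z) :=
    { (inferInstance : AddGroup (PiOne z)) with
      add_comm := fun a b => hg₁.1 <| by
        rw [map_add, map_add]
        exact PiOne.ext (hW.comp_comm _ _) }
  obtain ⟨L, hL⟩ := exists_loopSystem (AddEquiv.refl (PiOne z))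
  have hz : IsSimpleAt z := hW.isSimpleAt.of_injective hg₂.1
  obtain ⟨m, hm⟩ := hW.exists_coboundary (hL.push hg₁)
  let ε := AddEquiv.ofBijective _ hg₂
  have hm' (a b c : PiOne z) : L.defect a b c = coboundary (fun a b => ε.symm (m a b)) a b c := by
    apply hg₂.1
    rw [← L.defect_push, hm]
    have h (b) : mapTwoEnd g z (ε.symm b) = b := ε.apply_symm_apply b
    simp only [coboundary, map_add, map_sub, h]
  let p (x : X) : Path (f z) x := PathConnectedSpace.somePath _ x
  refine ⟨f z, PiOne z, inferInstance, pathFraming p (hL.push hf₁),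
    fun a b => mapTwoEnd f z (ε.symm (m a b)), pathFraming_isAdditive p _,
    hz.push hf₂.2 L, fun a b c => ?_⟩
  refine (L.defect_push f a b c).trans ?_
  rw [hm']
  simp only [coboundary, map_add, map_sub]

end Simple

/-! ### The retraction of the Hurewicz homomorphism -/

section Retraction

variable {X : Type u} [TopologicalSpace X] {e : X} {A : Type*} [AddCommGroup A]
  (S : Framing (⟨e⟩ : PathBicat X) A) (hS : S.IsAdditive)

theorem label_edge (s : C(Simp 2, X)) {i j : Fin 3} {x y : X} {u : Path x y}
    (hu : LiftsTo s (segPath (vtx i) (vtx j)) u) :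
    S.label (arr (edge s i j)) = S.label (arr u) := by
  obtain rfl := hu.source
  obtain rfl := hu.target
  obtain rfl : u = edge s i j := by ext t; exact (hu t).symm
  rfl

theorem label_edge_comp {m n : ℕ} (s : C(Simp n, X)) (φ : Fin (m + 1) → Fin (n + 1))
    (i j : Fin (m + 1)) :
    S.label (arr (edge (s.comp (simpMap φ)) i j)) = S.label (arr (edge s (φ i) (φ j))) := by
  have h : LiftsTo (s.comp (simpMap φ)) (segPath (vtx i) (vtx j)) (edge s (φ i) (φ j)) :=
    fun t => congrArg s (liftsTo_simpMap φ i j t)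
  have key {x y : X} (u : Path x y)
      (hu : LiftsTo (s.comp (simpMap φ)) (segPath (vtx i) (vtx j)) u) :
      S.label (arr (edge (s.comp (simpMap φ)) i j)) = S.label (arr u) := by
    obtain rfl := hu.source
    obtain rfl := hu.target
    obtain rfl : u = edge (s.comp (simpMap φ)) i j := by ext t; exact (hu t).symm
    rfl
  exact key _ h

/-- The 2-cochain of a function of the labels of the two short edges of a simplex. -/
def labelHom (m : A → A → TwoEnd (⟨e⟩ : PathBicat X)) :
    Chain (Sing X) 2 →+ TwoEnd (⟨e⟩ : PathBicat X) :=
  chainLift fun s => m (S.label (arr (edge (simplexMap s) 0 1)))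
    (S.label (arr (edge (simplexMap s) 1 2)))

theorem labelHom_gen (m : A → A → TwoEnd (⟨e⟩ : PathBicat X)) (s : C(Simp 2, X)) :
    labelHom S m (chainGen (singularSimplex s)) =
      m (S.label (arr (edge s 0 1))) (S.label (arr (edge s 1 2))) := by
  rw [labelHom, chainLift_gen, simplexMap_singularSimplex]

/-- The coboundary of this cochain on a tetrahedron is the coboundary of `m`, evaluated at the
labels of the edges along the spine. -/
theorem labelHom_bdry (m : A → A → TwoEnd (⟨e⟩ : PathBicat X)) (s : C(Simp 3, X))
    (hS : S.IsAdditive) :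
    labelHom S m (bdry _ 2 (chainGen (singularSimplex s))) =
      coboundary m (S.label (arr (edge s 0 1))) (S.label (arr (edge s 1 2)))
        (S.label (arr (edge s 2 3))) := by
  have hθ (i j k : Fin 4) : S.label (arr (edge s i k)) =
      S.label (arr (edge s i j)) + S.label (arr (edge s j k)) :=
    (hS _ _ _ (tri s (liftsTo_edge s i j) (liftsTo_edge s j k) (liftsTo_edge s i k))).symm
  have h (i : Fin 4) : labelHom S m (chainGen ((Sing X).δ i (singularSimplex s))) =
      m (S.label (arr (edge s (i.succAbove 0) (i.succAbove 1))))
        (S.label (arr (edge s (i.succAbove 1) (i.succAbove 2)))) := by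
    rw [δ_singularSimplex, labelHom_gen]
    exact congrArg₂ m (label_edge_comp S s i.succAbove 0 1) (label_edge_comp S s i.succAbove 1 2)
  rw [bdry_gen_three]
  simp only [map_add, map_sub, h]
  change m (S.label (arr (edge s 1 2))) (S.label (arr (edge s 2 3))) -
    m (S.label (arr (edge s 0 2))) (S.label (arr (edge s 2 3))) +
    m (S.label (arr (edge s 0 1))) (S.label (arr (edge s 1 3))) -
    m (S.label (arr (edge s 0 1))) (S.label (arr (edge s 1 2))) = _
  rw [hθ 0 1 2, hθ 1 2 3, coboundary]

theorem labelHom_squareElt (m : A → A → TwoEnd (⟨e⟩ : PathBicat X)) {x : X}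
    (f : GenLoop (Fin 2) X x) : labelHom S m (squareElt f.1) = 0 := by
  have h (v : Fin 3 → Fin 2 → I) (i j : Fin 3)
      (hv : ∃ k, v i k = v j k ∧ (v i k = 0 ∨ v i k = 1)) :
      S.label (arr (edge (f.1.comp (affineSimplex v)) i j)) = S.label (arr (Path.refl x)) := by
    refine label_edge S _ fun t => ?_
    obtain ⟨k, h, h'⟩ := hv
    change f.1 (affineSimplex v (seg t _ _)) = x
    rw [affineSimplex_seg, affineSimplex_vtx, affineSimplex_vtx]
    refine f.2 _ ⟨k, ?_⟩
    change seg t (v i k) (v j k) = 0 ∨ seg t (v i k) (v j k) = 1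
    rwa [← h, seg_self]
  rw [squareElt_eq, map_sub, labelHom_gen, labelHom_gen, h _ 0 1 ⟨1, by simp⟩,
    h _ 1 2 ⟨0, by simp⟩, h _ 0 1 ⟨0, by simp⟩, h _ 1 2 ⟨1, by simp⟩, sub_self]

/-- If the defect of a framing is a coboundary, the Hurewicz homomorphism is a split injection: the
cochain of the framing, corrected by that of `m`, is a cocycle and recovers a 2-dimensional loop
from its homology class. -/
theorem exists_retraction (hact : ∀ (a : A) (b : TwoEnd (⟨e⟩ : PathBicat X)),
      actR (S.loop a) b.hom = actL b.hom (S.loop a))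
    {m : A → A → TwoEnd (⟨e⟩ : PathBicat X)} (hm : ∀ a b c, S.defect a b c = coboundary m a b c)
    (hS : S.IsAdditive) (x : X) :
    ∃ r : singularH2 X →+ TwoEnd (⟨e⟩ : PathBicat X), Function.Bijective (r.comp (hurewicz X x)) := by
  let φ := rhoHom S hS - labelHom S m
  have hφ (c) : φ (bdry (Sing X) 2 c) = 0 := by
    refine chain_hom_apply_eq (f := φ.comp (bdry (Sing X) 2)) (g := 0) (fun s => ?_) c
    obtain ⟨s, rfl⟩ : ∃ s', singularSimplex s' = s := ⟨simplexMap s, singularSimplex_simplexMap s⟩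
    change rhoHom S hS _ - labelHom S m _ = 0
    rw [rhoHom_bdry S hS hact, labelHom_bdry S m s hS, hm, sub_self]
  let r : singularH2 X →+ TwoEnd (⟨e⟩ : PathBicat X) := homologyLift φ hφ
  -- Transport of 2-dimensional loops from `x` to the base point.
  have hr (f : GenLoop (Fin 2) X x) (b : TwoEnd (⟨e⟩ : PathBicat X))
      (hb : actR (S.base ⟨x⟩) (loopCell f).hom = actL b.hom (S.base ⟨x⟩)) :
      r (hurewicz X x (Additive.ofMul ⟦f⟧)) = -b := by
    rw [hurewicz_mk f (bdry_squareElt f)]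
    refine (homologyLift_class φ hφ _).trans ?_
    change rhoHom S hS _ - labelHom S m _ = _
    rw [rhoHom_squareElt S hS f b hb, labelHom_squareElt, sub_zero]
  refine ⟨r, (injective_iff_map_eq_zero _).2 fun a ha => ?_, fun b => ?_⟩
  · induction a using Additive.rec with | _ a
    induction a using Quotient.inductionOn with | _ f
    obtain ⟨b, hb⟩ := actL_surjective (S.base ⟨x⟩) (actR (S.base ⟨x⟩) (loopCell f).hom)
    have hb0 : (⟨b⟩ : TwoEnd (⟨e⟩ : PathBicat X)) = 0 :=
      neg_eq_zero.1 ((hr f ⟨b⟩ hb.symm).symm.trans ha)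
    obtain rfl : b = 𝟙 _ := congrArg TwoEnd.hom hb0
    have h₁ : loopCell f = loopCell GenLoop.const := by
      refine TwoEnd.ext (actR_injective (S.base ⟨x⟩) (hb.symm.trans ?_))
      refine (actL_id _).trans ((actR_id _).symm.trans (congrArg (actR _) ?_))
      exact congrArg Path.Homotopic.Quotient.mk (by ext; rfl)
    exact congrArg Additive.ofMul (Quotient.sound ((loopCell_eq_iff _ _).1 h₁))
  · obtain ⟨c, hc⟩ := actR_surjective (S.base ⟨x⟩) (actL (-b).hom (S.base ⟨x⟩))
    obtain ⟨f, hf⟩ := loopCell_surjective ⟨c⟩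
    refine ⟨Additive.ofMul ⟦f⟧, (hr f (-b) ?_).trans (neg_neg b)⟩
    rw [hf]
    exact hc

end Retraction

/-- On a path-connected double loop space the Hurewicz homomorphism in degree two has a left
inverse. -/
theorem exists_leftInverse_hurewicz {X : Type u} [TopologicalSpace X] [PathConnectedSpace X]
    (hX : IsDoubleLoopSpace.{u, v} X) (x : X) :
    ∃ r : singularH2 X →+ Additive (HomotopyGroup.Pi 2 X x),
      ∀ a, r (hurewicz X x a) = a := by
  obtain ⟨e, A, _, S, m, hS, hact, hm⟩ := exists_framing hX
  obtain ⟨r, hr⟩ := exists_retraction S hact hm hS x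
  let ε := AddEquiv.ofBijective _ hr
  exact ⟨ε.symm.toAddMonoidHom.comp r, fun a => ε.symm_apply_apply a⟩

/-! ### Triangles in simplicial sets with horn fillers -/

section Triangles

variable {S : SSet.{u}}

/-- A 2-simplex with given edges from the vertex 0 to 1, from 1 to 2 and from 0 to 2. -/
structure IsTriangle (s : S _⦋2⦌) (u v w : S _⦋1⦌) : Prop where
  δ_two : S.δ 2 s = u
  δ_zero : S.δ 0 s = v
  δ_one : S.δ 1 s = w

/-- The Kan condition for 3-dimensional horns. The value of `f` at the missing face `k` is
irrelevant. -/
def HasHornFillers (S : SSet.{u}) : Prop :=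
  ∀ (k : Fin 4) (f : Fin 4 → S _⦋2⦌), (∀ i j : Fin 3, i ≤ j → i.castSucc ≠ k → j.succ ≠ k →
    S.δ i (f j.succ) = S.δ j (f i.castSucc)) → ∃ s : S _⦋3⦌, ∀ i, i ≠ k → S.δ i s = f i

/-- Four 2-simplices are the faces of a 3-simplex. -/
def IsTetrahedron (f₀ f₁ f₂ f₃ : S _⦋2⦌) : Prop :=
  ∃ s : S _⦋3⦌, S.δ 0 s = f₀ ∧ S.δ 1 s = f₁ ∧ S.δ 2 s = f₂ ∧ S.δ 3 s = f₃

variable {f₀ f₁ f₂ f₃ : S _⦋2⦌} {e₀₁ e₀₂ e₀₃ e₁₂ e₁₃ e₂₃ : S _⦋1⦌}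

theorem HasHornFillers.exists_zero (h : HasHornFillers S) (h₁ : IsTriangle f₁ e₀₂ e₂₃ e₀₃)
    (h₂ : IsTriangle f₂ e₀₁ e₁₃ e₀₃) (h₃ : IsTriangle f₃ e₀₁ e₁₂ e₀₂) :
    ∃ f₀, IsTriangle f₀ e₁₂ e₂₃ e₁₃ ∧ IsTetrahedron f₀ f₁ f₂ f₃ := by
  obtain ⟨s, hs⟩ := h 0 ![f₁, f₁, f₂, f₃] (by
    intro i j hij hi hj
    fin_cases i <;> fin_cases j <;> simp at hij hi hj
    · exact h₂.δ_one.trans h₁.δ_one.symm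
    · exact h₃.δ_one.trans h₁.δ_two.symm
    · exact h₃.δ_two.trans h₂.δ_two.symm)
  have s₁ : S.δ 1 s = f₁ := hs 1 (by decide)
  have s₂ : S.δ 2 s = f₂ := hs 2 (by decide)
  have s₃ : S.δ 3 s = f₃ := hs 3 (by decide)
  refine ⟨S.δ 0 s, ⟨?_, ?_, ?_⟩, s, rfl, s₁, s₂, s₃⟩
  · exact (S.δ_comp_δ_apply (i := 0) (j := 2) (by decide) s).symm.trans
      ((congrArg (S.δ 0) s₃).trans h₃.δ_zero)
  · exact (S.δ_comp_δ_apply (i := 0) (j := 0) (by decide) s).symm.trans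
      ((congrArg (S.δ 0) s₁).trans h₁.δ_zero)
  · exact (S.δ_comp_δ_apply (i := 0) (j := 1) (by decide) s).symm.trans
      ((congrArg (S.δ 0) s₂).trans h₂.δ_zero)

theorem HasHornFillers.exists_one (h : HasHornFillers S) (h₀ : IsTriangle f₀ e₁₂ e₂₃ e₁₃)
    (h₂ : IsTriangle f₂ e₀₁ e₁₃ e₀₃) (h₃ : IsTriangle f₃ e₀₁ e₁₂ e₀₂) :
    ∃ f₁, IsTriangle f₁ e₀₂ e₂₃ e₀₃ ∧ IsTetrahedron f₀ f₁ f₂ f₃ := by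
  obtain ⟨s, hs⟩ := h 1 ![f₀, f₀, f₂, f₃] (by
    intro i j hij hi hj
    fin_cases i <;> fin_cases j <;> simp at hij hi hj
    · exact h₂.δ_zero.trans h₀.δ_one.symm
    · exact h₃.δ_zero.trans h₀.δ_two.symm
    · exact h₃.δ_two.trans h₂.δ_two.symm)
  have s₀ : S.δ 0 s = f₀ := hs 0 (by decide)
  have s₂ : S.δ 2 s = f₂ := hs 2 (by decide)
  have s₃ : S.δ 3 s = f₃ := hs 3 (by decide)
  refine ⟨S.δ 1 s, ⟨?_, ?_, ?_⟩, s, s₀, rfl, s₂, s₃⟩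
  · exact (S.δ_comp_δ_apply (i := 1) (j := 2) (by decide) s).symm.trans
      ((congrArg (S.δ 1) s₃).trans h₃.δ_one)
  · exact (S.δ_comp_δ_apply (i := 0) (j := 0) (by decide) s).trans
      ((congrArg (S.δ 0) s₀).trans h₀.δ_zero)
  · exact (S.δ_comp_δ_apply (i := 1) (j := 1) (by decide) s).symm.trans
      ((congrArg (S.δ 1) s₂).trans h₂.δ_one)

theorem HasHornFillers.exists_two (h : HasHornFillers S) (h₀ : IsTriangle f₀ e₁₂ e₂₃ e₁₃)
    (h₁ : IsTriangle f₁ e₀₂ e₂₃ e₀₃) (h₃ : IsTriangle f₃ e₀₁ e₁₂ e₀₂) :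
    ∃ f₂, IsTriangle f₂ e₀₁ e₁₃ e₀₃ ∧ IsTetrahedron f₀ f₁ f₂ f₃ := by
  obtain ⟨s, hs⟩ := h 2 ![f₀, f₁, f₁, f₃] (by
    intro i j hij hi hj
    fin_cases i <;> fin_cases j <;> simp at hij hi hj
    · exact h₁.δ_zero.trans h₀.δ_zero.symm
    · exact h₃.δ_zero.trans h₀.δ_two.symm
    · exact h₃.δ_one.trans h₁.δ_two.symm)
  have s₀ : S.δ 0 s = f₀ := hs 0 (by decide)
  have s₁ : S.δ 1 s = f₁ := hs 1 (by decide)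
  have s₃ : S.δ 3 s = f₃ := hs 3 (by decide)
  refine ⟨S.δ 2 s, ⟨?_, ?_, ?_⟩, s, s₀, s₁, rfl, s₃⟩
  · exact (S.δ_comp_δ_apply (i := 2) (j := 2) (by decide) s).symm.trans
      ((congrArg (S.δ 2) s₃).trans h₃.δ_two)
  · exact (S.δ_comp_δ_apply (i := 0) (j := 1) (by decide) s).trans
      ((congrArg (S.δ 1) s₀).trans h₀.δ_one)
  · exact (S.δ_comp_δ_apply (i := 1) (j := 1) (by decide) s).trans
      ((congrArg (S.δ 1) s₁).trans h₁.δ_one)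

theorem HasHornFillers.exists_three (h : HasHornFillers S) (h₀ : IsTriangle f₀ e₁₂ e₂₃ e₁₃)
    (h₁ : IsTriangle f₁ e₀₂ e₂₃ e₀₃) (h₂ : IsTriangle f₂ e₀₁ e₁₃ e₀₃) :
    ∃ f₃, IsTriangle f₃ e₀₁ e₁₂ e₀₂ ∧ IsTetrahedron f₀ f₁ f₂ f₃ := by
  obtain ⟨s, hs⟩ := h 3 ![f₀, f₁, f₂, f₂] (by
    intro i j hij hi hj
    fin_cases i <;> fin_cases j <;> simp at hij hi hj
    · exact h₁.δ_zero.trans h₀.δ_zero.symm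
    · exact h₂.δ_zero.trans h₀.δ_one.symm
    · exact h₂.δ_one.trans h₁.δ_one.symm)
  have s₀ : S.δ 0 s = f₀ := hs 0 (by decide)
  have s₁ : S.δ 1 s = f₁ := hs 1 (by decide)
  have s₂ : S.δ 2 s = f₂ := hs 2 (by decide)
  refine ⟨S.δ 3 s, ⟨?_, ?_, ?_⟩, s, s₀, s₁, s₂, rfl⟩
  · exact (S.δ_comp_δ_apply (i := 2) (j := 2) (by decide) s).trans
      ((congrArg (S.δ 2) s₂).trans h₂.δ_two)
  · exact (S.δ_comp_δ_apply (i := 0) (j := 2) (by decide) s).trans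
      ((congrArg (S.δ 2) s₀).trans h₀.δ_two)
  · exact (S.δ_comp_δ_apply (i := 1) (j := 2) (by decide) s).trans
      ((congrArg (S.δ 2) s₁).trans h₁.δ_two)

/-- The degenerate edge at a vertex. -/
abbrev constEdge (x : S _⦋0⦌) : S _⦋1⦌ := S.σ 0 x

/-- The degenerate triangle at a vertex. -/
abbrev constTriangle (x : S _⦋0⦌) : S _⦋2⦌ := S.σ 0 (S.σ 0 x)

theorem isTriangle_σ_zero {u : S _⦋1⦌} {x : S _⦋0⦌} (hx : S.δ 1 u = x) :
    IsTriangle (S.σ 0 u) (constEdge x) u u := by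
  subst hx
  exact ⟨S.δ_comp_σ_of_gt_apply (i := 1) (j := 0) (by decide) u, S.δ_comp_σ_self_apply 0 u,
    S.δ_comp_σ_succ_apply 0 u⟩

theorem isTriangle_σ_one {u : S _⦋1⦌} {y : S _⦋0⦌} (hy : S.δ 0 u = y) :
    IsTriangle (S.σ 1 u) u (constEdge y) u := by
  subst hy
  exact ⟨S.δ_comp_σ_succ_apply 1 u, S.δ_comp_σ_of_le_apply (i := 0) (j := 0) le_rfl u,
    S.δ_comp_σ_self_apply 1 u⟩

theorem δ_one_constEdge (x : S _⦋0⦌) : S.δ 1 (constEdge x) = x := S.δ_comp_σ_succ_apply 0 x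

theorem isTriangle_const (x : S _⦋0⦌) :
    IsTriangle (constTriangle x) (constEdge x) (constEdge x) (constEdge x) :=
  isTriangle_σ_zero (δ_one_constEdge x)

theorem isTetrahedron_σ_zero {u : S _⦋1⦌} {x : S _⦋0⦌} (hx : S.δ 1 u = x) :
    IsTetrahedron (S.σ 0 u) (S.σ 0 u) (S.σ 0 u) (constTriangle x) := by
  subst hx
  refine ⟨S.σ 0 (S.σ 0 u), S.δ_comp_σ_self_apply 0 _, S.δ_comp_σ_succ_apply 0 _, ?_, ?_⟩
  · refine (S.δ_comp_σ_of_gt_apply (i := 1) (j := 0) (by decide) (S.σ 0 u)).trans ?_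
    exact congrArg (S.σ 0) (S.δ_comp_σ_succ_apply 0 u)
  · refine (S.δ_comp_σ_of_gt_apply (i := 2) (j := 0) (by decide) (S.σ 0 u)).trans ?_
    exact congrArg (S.σ 0) (S.δ_comp_σ_of_gt_apply (i := 1) (j := 0) (by decide) u)

theorem isTetrahedron_σ_one {u : S _⦋1⦌} {y : S _⦋0⦌} (hy : S.δ 0 u = y) :
    IsTetrahedron (constTriangle y) (S.σ 1 u) (S.σ 1 u) (S.σ 1 u) := by
  subst hy
  refine ⟨S.σ 2 (S.σ 1 u), ?_, ?_, S.δ_comp_σ_self_apply 2 _, S.δ_comp_σ_succ_apply 2 _⟩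
  · refine (S.δ_comp_σ_of_le_apply (i := 0) (j := 1) (by decide) (S.σ 1 u)).trans ?_
    refine (congrArg (S.σ 1) (S.δ_comp_σ_of_le_apply (i := 0) (j := 0) le_rfl u)).trans ?_
    exact (S.σ_comp_σ_apply (i := 0) (j := 0) le_rfl _).symm
  · refine (S.δ_comp_σ_of_le_apply (i := 1) (j := 1) (by decide) (S.σ 1 u)).trans ?_
    exact congrArg (S.σ 1) (S.δ_comp_σ_self_apply 1 u)

end Triangles

section Spherical

variable {S : SSet.{u}}

/-- A subgroup of the 2-chains that contains the boundaries and the spheres at a base point, that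
is, the 2-simplices with constant boundary, up to the constant 2-simplex. -/
structure ContainsSpheres (x₀ : S _⦋0⦌) (B : AddSubgroup (Chain S 2)) : Prop where
  bdry_mem : ∀ c, bdry S 2 c ∈ B
  sphere_mem : ∀ g, IsTriangle g (constEdge x₀) (constEdge x₀) (constEdge x₀) →
    chainGen g - chainGen (constTriangle x₀) ∈ B

/-- The class of a 2-simplex modulo a subgroup of the 2-chains. -/
def simplexClass (B : AddSubgroup (Chain S 2)) (s : S _⦋2⦌) : Chain S 2 ⧸ B :=
  QuotientAddGroup.mk (chainGen s)

variable {x₀ : S _⦋0⦌} {B : AddSubgroup (Chain S 2)}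

theorem ContainsSpheres.class_add_class (hB : ContainsSpheres x₀ B) {f₀ f₁ f₂ f₃ : S _⦋2⦌}
    (h : IsTetrahedron f₀ f₁ f₂ f₃) :
    simplexClass B f₀ + simplexClass B f₂ = simplexClass B f₁ + simplexClass B f₃ := by
  obtain ⟨s, rfl, rfl, rfl, rfl⟩ := h
  refine Eq.symm (QuotientAddGroup.eq.2 ?_)
  have e (a b c d : Chain S 2) : a - b + c - d = -(b + d) + (a + c) := by abel
  have := hB.bdry_mem (chainGen s)
  rw [bdry_gen_three, e] at this
  exact this

theorem ContainsSpheres.class_σ_zero (hB : ContainsSpheres x₀ B) {u : S _⦋1⦌} {x : S _⦋0⦌}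
    (hx : S.δ 1 u = x) : simplexClass B (S.σ 0 u) = simplexClass B (constTriangle x) :=
  add_left_cancel (hB.class_add_class (isTetrahedron_σ_zero hx))

theorem ContainsSpheres.class_σ_one (hB : ContainsSpheres x₀ B) {u : S _⦋1⦌} {y : S _⦋0⦌}
    (hy : S.δ 0 u = y) : simplexClass B (S.σ 1 u) = simplexClass B (constTriangle y) :=
  (add_right_cancel (hB.class_add_class (isTetrahedron_σ_one hy))).symm

/-- A triangle with edges `u`, constant, `u` is equivalent to a constant one, if this is so for the
triangles with constant boundary at the source of `u`: the triangle is slid back along `u`. -/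
theorem ContainsSpheres.class_of_source (hB : ContainsSpheres x₀ B) (hS : HasHornFillers S)
    {g : S _⦋2⦌} {u : S _⦋1⦌} {x y : S _⦋0⦌} (hu : S.δ 1 u = x) (hy : S.δ 0 u = y)
    (hx : ∀ g, IsTriangle g (constEdge x) (constEdge x) (constEdge x) →
      simplexClass B g = simplexClass B (constTriangle x))
    (hg : IsTriangle g u (constEdge y) u) :
    simplexClass B g = simplexClass B (constTriangle y) := by
  obtain ⟨g₁, hg₁, t₁⟩ := hS.exists_three hg (isTriangle_σ_one hy) (isTriangle_σ_zero hu)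
  obtain ⟨g₂, hg₂, t₂⟩ := hS.exists_three hg₁ (isTriangle_σ_zero hu) (isTriangle_σ_zero hu)
  have h₁ := hB.class_add_class t₁
  have h₂ := hB.class_add_class t₂
  rw [hB.class_σ_zero hu, add_comm, hx g₂ hg₂] at h₂
  rw [hB.class_σ_zero hu, hB.class_σ_one hy, add_left_cancel h₂] at h₁
  exact add_right_cancel h₁

theorem ContainsSpheres.class_of_const (hB : ContainsSpheres x₀ B) (hS : HasHornFillers S)
    {g : S _⦋2⦌} {y : S _⦋0⦌} {p : S _⦋1⦌} (hx : S.δ 1 p = x₀) (hy : S.δ 0 p = y)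
    (hg : IsTriangle g (constEdge y) (constEdge y) (constEdge y)) :
    simplexClass B g = simplexClass B (constTriangle y) := by
  obtain ⟨g₁, hg₁, t₁⟩ := hS.exists_three hg (isTriangle_σ_one hy) (isTriangle_σ_one hy)
  have h₁ := hB.class_add_class t₁
  rw [add_comm, hB.class_σ_one hy] at h₁
  refine (add_left_cancel h₁).trans (hB.class_of_source hS hx hy (fun g hg => ?_) hg₁)
  refine Eq.symm (QuotientAddGroup.eq.2 ?_)
  rw [neg_add_eq_sub]
  exact hB.sphere_mem g hg

/-- The class of a triangle modulo boundaries and spheres only depends on its edges. -/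
theorem ContainsSpheres.class_eq (hB : ContainsSpheres x₀ B) (hS : HasHornFillers S)
    (hconn : ∀ y : S _⦋0⦌, ∃ p : S _⦋1⦌, S.δ 1 p = x₀ ∧ S.δ 0 p = y) {f g : S _⦋2⦌}
    {u v w : S _⦋1⦌} (hf : IsTriangle f u v w) (hg : IsTriangle g u v w) :
    simplexClass B f = simplexClass B g := by
  have hw : S.δ 0 w = S.δ 0 v := by
    rw [← hf.δ_one, ← hf.δ_zero]
    exact (S.δ_comp_δ_apply (i := 0) (j := 0) le_rfl f)
  obtain ⟨k, hk, t⟩ := hS.exists_zero (isTriangle_σ_one (y := S.δ 0 v) hw) hf hg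
  have h := hB.class_add_class t
  obtain ⟨p, hp, hp'⟩ := hconn (S.δ 1 v)
  have hk' := hB.class_of_source hS rfl rfl (fun g hg => hB.class_of_const hS hp hp' hg) hk
  rw [hk', hB.class_σ_one hw] at h
  exact add_left_cancel h

/-- The cocycle condition: the alternating sum of four triangles that fit together vanishes modulo
boundaries and spheres, even if they are not the faces of a 3-simplex. -/
theorem ContainsSpheres.class_add_class_of_isTriangle (hB : ContainsSpheres x₀ B)
    (hS : HasHornFillers S)
    (hconn : ∀ y : S _⦋0⦌, ∃ p : S _⦋1⦌, S.δ 1 p = x₀ ∧ S.δ 0 p = y) {f₀ f₁ f₂ f₃ : S _⦋2⦌}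
    {e₀₁ e₀₂ e₀₃ e₁₂ e₁₃ e₂₃ : S _⦋1⦌} (h₀ : IsTriangle f₀ e₁₂ e₂₃ e₁₃)
    (h₁ : IsTriangle f₁ e₀₂ e₂₃ e₀₃) (h₂ : IsTriangle f₂ e₀₁ e₁₃ e₀₃)
    (h₃ : IsTriangle f₃ e₀₁ e₁₂ e₀₂) :
    simplexClass B f₀ + simplexClass B f₂ = simplexClass B f₁ + simplexClass B f₃ := by
  obtain ⟨f, hf, t⟩ := hS.exists_three h₀ h₁ h₂
  rw [hB.class_add_class t, hB.class_eq hS hconn hf h₃]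

end Spherical

section Truncation

variable {S T : SSet.{u}}

/-- A map of simplicial sets is 1-truncating if it is bijective on vertices and surjective on edges,
if triangles of the target are determined by their edges and if each of them lifts to a triangle
with any given edges over its edges. -/
structure IsTruncating (t : S ⟶ T) : Prop where
  bijective_vertex : Function.Bijective (t.app (op ⦋0⦌))
  surjective_edge : Function.Surjective (t.app (op ⦋1⦌))
  triangle_ext : ∀ ⦃a b : T _⦋2⦌⦄, (∀ i, T.δ i a = T.δ i b) → a = b
  exists_triangle : ∀ (a : T _⦋2⦌) (u v w : S _⦋1⦌), t.app _ u = T.δ 2 a → t.app _ v = T.δ 0 a →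
    t.app _ w = T.δ 1 a → ∃ s, IsTriangle s u v w

variable {t : S ⟶ T}

theorem IsTriangle.map {s : S _⦋2⦌} {u v w : S _⦋1⦌} (h : IsTriangle s u v w) (t : S ⟶ T) :
    IsTriangle (t.app _ s) (t.app _ u) (t.app _ v) (t.app _ w) :=
  ⟨(SSet.δ_naturality_apply t 2 s).symm.trans (congrArg _ h.δ_two),
    (SSet.δ_naturality_apply t 0 s).symm.trans (congrArg _ h.δ_zero),
    (SSet.δ_naturality_apply t 1 s).symm.trans (congrArg _ h.δ_one)⟩

theorem IsTruncating.eq_of_isTriangle (ht : IsTruncating t) {a b : T _⦋2⦌} {u v w : T _⦋1⦌}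
    (ha : IsTriangle a u v w) (hb : IsTriangle b u v w) : a = b := by
  refine ht.triangle_ext fun i => ?_
  fin_cases i
  · exact ha.δ_zero.trans hb.δ_zero.symm
  · exact ha.δ_one.trans hb.δ_one.symm
  · exact ha.δ_two.trans hb.δ_two.symm

/-- A choice of an edge over each edge of the target. -/
def IsTruncating.liftEdge (ht : IsTruncating t) : T _⦋1⦌ → S _⦋1⦌ :=
  Function.surjInv ht.surjective_edge

theorem IsTruncating.map_liftEdge (ht : IsTruncating t) (u : T _⦋1⦌) :
    t.app _ (ht.liftEdge u) = u := Function.surjInv_eq ht.surjective_edge u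

theorem IsTruncating.exists_liftTriangle (ht : IsTruncating t) (a : T _⦋2⦌) :
    ∃ s, IsTriangle s (ht.liftEdge (T.δ 2 a)) (ht.liftEdge (T.δ 0 a)) (ht.liftEdge (T.δ 1 a)) :=
  ht.exists_triangle a _ _ _ (ht.map_liftEdge _) (ht.map_liftEdge _) (ht.map_liftEdge _)

/-- A choice of a triangle over each triangle of the target, compatible with the choice of edges. -/
def IsTruncating.liftTriangle (ht : IsTruncating t) (a : T _⦋2⦌) : S _⦋2⦌ :=
  (ht.exists_liftTriangle a).choose

theorem IsTruncating.isTriangle_liftTriangle (ht : IsTruncating t) (a : T _⦋2⦌) :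
    IsTriangle (ht.liftTriangle a) (ht.liftEdge (T.δ 2 a)) (ht.liftEdge (T.δ 0 a))
      (ht.liftEdge (T.δ 1 a)) := (ht.exists_liftTriangle a).choose_spec

theorem IsTruncating.map_liftTriangle (ht : IsTruncating t) (a : T _⦋2⦌) :
    t.app _ (ht.liftTriangle a) = a := by
  have h := (ht.isTriangle_liftTriangle a).map t
  simp only [ht.map_liftEdge] at h
  exact ht.eq_of_isTriangle h ⟨rfl, rfl, rfl⟩

/-- The lift of chains that belongs to the chosen lifts of triangles. -/
def IsTruncating.liftChain (ht : IsTruncating t) : Chain T 2 →+ Chain S 2 :=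
  chainLift fun a => chainGen (ht.liftTriangle a)

theorem IsTruncating.bdry_liftChain (ht : IsTruncating t) (c : Chain T 2) :
    bdry S 1 (ht.liftChain c) =
      chainLift (fun u : T _⦋1⦌ => chainGen (ht.liftEdge u)) (bdry T 1 c) := by
  refine chain_hom_apply_eq (f := (bdry S 1).comp ht.liftChain)
    (g := (chainLift fun u : T _⦋1⦌ => chainGen (ht.liftEdge u)).comp (bdry T 1)) (fun a => ?_) c
  have h := ht.isTriangle_liftTriangle a
  simp only [AddMonoidHom.comp_apply, IsTruncating.liftChain, chainLift_gen, bdry_gen_two,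
    map_add, map_sub, h.δ_zero, h.δ_one, h.δ_two]

theorem IsTruncating.chainMap_liftChain (ht : IsTruncating t) (c : Chain T 2) :
    chainMap t 2 (ht.liftChain c) = c := by
  refine chain_hom_apply_eq (f := (chainMap t 2).comp ht.liftChain) (g := AddMonoidHom.id _)
    (fun a => ?_) c
  simp [IsTruncating.liftChain, chainMap_gen, ht.map_liftTriangle]

theorem IsTruncating.surjective_homologyMap (ht : IsTruncating t) :
    Function.Surjective (SSet.homologyMap t integers.{u} 2).hom := by
  intro a
  obtain ⟨z, rfl⟩ := homologyClass_surjective T a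
  have hz : bdry S 1 (ht.liftChain z.1) = 0 := by
    rw [ht.bdry_liftChain, z.2, map_zero]
  refine ⟨homologyClass S ⟨ht.liftChain z.1, hz⟩, ?_⟩
  rw [homologyMap_class]
  exact congrArg (homologyClass T) (Subtype.ext (ht.chainMap_liftChain z.1))

variable {x₀ : S _⦋0⦌} {B : AddSubgroup (Chain S 2)}

/-- The lift of a boundary vanishes modulo boundaries and spheres. -/
theorem IsTruncating.liftChain_bdry_mem (ht : IsTruncating t) (hB : ContainsSpheres x₀ B)
    (hS : HasHornFillers S)
    (hconn : ∀ y : S _⦋0⦌, ∃ p : S _⦋1⦌, S.δ 1 p = x₀ ∧ S.δ 0 p = y) (c : Chain T 3) :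
    ht.liftChain (bdry T 2 c) ∈ B := by
  rw [← QuotientAddGroup.eq_zero_iff]
  refine chain_hom_apply_eq (f := ((QuotientAddGroup.mk' B).comp ht.liftChain).comp (bdry T 2))
    (g := 0) (fun s => ?_) c
  have d₀₁ : T.δ 0 (T.δ 1 s) = T.δ 0 (T.δ 0 s) := T.δ_comp_δ_apply (i := 0) (j := 0) le_rfl s
  have d₀₂ : T.δ 0 (T.δ 2 s) = T.δ 1 (T.δ 0 s) := T.δ_comp_δ_apply (i := 0) (j := 1) (by decide) s
  have d₀₃ : T.δ 0 (T.δ 3 s) = T.δ 2 (T.δ 0 s) := T.δ_comp_δ_apply (i := 0) (j := 2) (by decide) s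
  have d₁₂ : T.δ 1 (T.δ 2 s) = T.δ 1 (T.δ 1 s) := T.δ_comp_δ_apply (i := 1) (j := 1) le_rfl s
  have d₁₃ : T.δ 1 (T.δ 3 s) = T.δ 2 (T.δ 1 s) := T.δ_comp_δ_apply (i := 1) (j := 2) (by decide) s
  have d₂₃ : T.δ 2 (T.δ 3 s) = T.δ 2 (T.δ 2 s) := T.δ_comp_δ_apply (i := 2) (j := 2) le_rfl s
  have h := hB.class_add_class_of_isTriangle hS hconn (ht.isTriangle_liftTriangle (T.δ 0 s))
    (f₁ := ht.liftTriangle (T.δ 1 s)) (f₂ := ht.liftTriangle (T.δ 2 s))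
    (f₃ := ht.liftTriangle (T.δ 3 s)) (e₀₁ := ht.liftEdge (T.δ 2 (T.δ 3 s)))
    (e₀₂ := ht.liftEdge (T.δ 1 (T.δ 3 s))) (e₀₃ := ht.liftEdge (T.δ 1 (T.δ 2 s)))
    (by rw [d₁₃, d₁₂, ← d₀₁]; exact ht.isTriangle_liftTriangle _)
    (by rw [d₂₃, ← d₀₂]; exact ht.isTriangle_liftTriangle _)
    (by rw [← d₀₃]; exact ht.isTriangle_liftTriangle _)
  simp only [AddMonoidHom.comp_apply, bdry_gen_three, map_add, map_sub, IsTruncating.liftChain,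
    chainLift_gen]
  rw [AddMonoidHom.zero_apply, sub_eq_zero, sub_add_eq_add_sub, sub_eq_iff_eq_add']
  exact h

/-- The homotopy that compares an edge with the chosen edge with the same image. -/
theorem IsTruncating.exists_compare (ht : IsTruncating t) (u : S _⦋1⦌) :
    ∃ s, IsTriangle s (constEdge (S.δ 1 u)) u (ht.liftEdge (t.app _ u)) := by
  have h := (isTriangle_σ_zero (u := u) rfl).map t
  exact ht.exists_triangle _ _ _ _ h.δ_two.symm h.δ_zero.symm
    ((ht.map_liftEdge _).trans h.δ_one.symm)

/-- The comparison of an edge `u` with the chosen edge over its image, as a class modulo boundaries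
and spheres. -/
def IsTruncating.compareClass (ht : IsTruncating t) (B : AddSubgroup (Chain S 2)) (u : S _⦋1⦌) :
    Chain S 2 ⧸ B :=
  simplexClass B (ht.exists_compare u).choose - simplexClass B (constTriangle (S.δ 0 u))

/-- The chosen lift of the image of a triangle is equivalent to the triangle, up to a correction
that only depends on the edges. -/
theorem IsTruncating.simplexClass_eq (ht : IsTruncating t) (hB : ContainsSpheres x₀ B)
    (hS : HasHornFillers S)
    (hconn : ∀ y : S _⦋0⦌, ∃ p : S _⦋1⦌, S.δ 1 p = x₀ ∧ S.δ 0 p = y) {s : S _⦋2⦌}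
    {u v w : S _⦋1⦌} (hs : IsTriangle s u v w) :
    simplexClass B s = simplexClass B (ht.liftTriangle (t.app _ s)) +
      (ht.compareClass B v - ht.compareClass B w + ht.compareClass B u) := by
  have hvw : S.δ 0 w = S.δ 0 v := by
    rw [← hs.δ_one, ← hs.δ_zero]
    exact S.δ_comp_δ_apply (i := 0) (j := 0) le_rfl s
  have huv : S.δ 0 u = S.δ 1 v := by
    rw [← hs.δ_two, ← hs.δ_zero]
    exact S.δ_comp_δ_apply (i := 0) (j := 1) (by decide) s
  have huw : S.δ 1 w = S.δ 1 u := by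
    rw [← hs.δ_one, ← hs.δ_two]
    exact (S.δ_comp_δ_apply (i := 1) (j := 1) le_rfl s).symm
  have hu : S.δ 0 (ht.liftEdge (t.app _ u)) = S.δ 1 v := by
    refine ht.bijective_vertex.1 ?_
    rw [SSet.δ_naturality_apply, ht.map_liftEdge, ← SSet.δ_naturality_apply, huv]
  have hts := hs.map t
  have hl := ht.isTriangle_liftTriangle (t.app _ s)
  rw [hts.δ_zero, hts.δ_one, hts.δ_two] at hl
  obtain ⟨m, hm⟩ := ht.exists_triangle (t.app _ s) (ht.liftEdge (t.app _ u)) v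
    (ht.liftEdge (t.app _ w)) ((ht.map_liftEdge _).trans hts.δ_two.symm) hts.δ_zero.symm
    ((ht.map_liftEdge _).trans hts.δ_one.symm)
  have cu := (ht.exists_compare u).choose_spec
  have cv := (ht.exists_compare v).choose_spec
  have cw : IsTriangle (ht.exists_compare w).choose (constEdge (S.δ 1 u)) w
      (ht.liftEdge (t.app _ w)) := by
    simpa only [huw] using (ht.exists_compare w).choose_spec
  -- The middle triangle has the edges of `s`, with the first and the last one replaced.
  have h₁ := hB.class_add_class_of_isTriangle hS hconn hs hm cw cu
  have h₂ := hB.class_add_class_of_isTriangle hS hconn cv hm hl (isTriangle_σ_one hu)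
  rw [hB.class_σ_one hu] at h₂
  rw [compareClass, compareClass, compareClass, hvw, huv, eq_sub_of_add_eq h₁,
    eq_sub_of_add_eq h₂.symm]
  abel

/-- The kernel of a 1-truncating map on second homology consists of the classes of spheres. -/
theorem IsTruncating.mem_of_homologyMap_eq_zero (ht : IsTruncating t) (hB : ContainsSpheres x₀ B)
    (hS : HasHornFillers S)
    (hconn : ∀ y : S _⦋0⦌, ∃ p : S _⦋1⦌, S.δ 1 p = x₀ ∧ S.δ 0 p = y) (z : (bdry S 1).ker)
    (hz : (SSet.homologyMap t integers.{u} 2).hom (homologyClass S z) = 0) : z.1 ∈ B := by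
  have key (c : Chain S 2) : QuotientAddGroup.mk' B c =
      QuotientAddGroup.mk' B (ht.liftChain (chainMap t 2 c)) +
        chainLift (ht.compareClass B) (bdry S 1 c) := by
    refine chain_hom_apply_eq (f := QuotientAddGroup.mk' B)
      (g := ((QuotientAddGroup.mk' B).comp ht.liftChain).comp (chainMap t 2) +
        (chainLift (ht.compareClass B)).comp (bdry S 1)) (fun s => ?_) c
    simp only [AddMonoidHom.add_apply, AddMonoidHom.comp_apply, chainMap_gen, bdry_gen_two, map_add,
      map_sub, IsTruncating.liftChain, chainLift_gen]
    exact ht.simplexClass_eq hB hS hconn ⟨rfl, rfl, rfl⟩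
  rw [homologyMap_class, homologyClass_eq_zero] at hz
  obtain ⟨c, hc : bdry T 2 c = chainMap t 2 z.1⟩ := hz
  rw [← QuotientAddGroup.eq_zero_iff]
  refine (key z.1).trans ?_
  rw [← hc, z.2, map_zero, add_zero]
  exact (QuotientAddGroup.eq_zero_iff _).2 (ht.liftChain_bdry_mem hB hS hconn c)

end Truncation

/-! ### Horn fillers of the singular simplicial set -/

section HornFillers

theorem simpMap_succAbove_apply {n : ℕ} (i : Fin (n + 2)) (y : Simp n) (k : Fin (n + 1)) :
    (simpMap i.succAbove y).1 (i.succAbove k) = y.1 k := by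
  change (stdSimplex.map i.succAbove y : Fin (n + 2) → ℝ) _ = _
  simp only [stdSimplex.map_coe, FunOnFinite.linearMap_apply_apply]
  rw [Finset.sum_eq_single k]
  · rfl
  · intro l hl hlk
    exact absurd (Fin.succAbove_right_injective (Finset.mem_filter.1 hl).2) hlk
  · exact fun hk => absurd (by simp) hk

theorem simpMap_succAbove_self {n : ℕ} (i : Fin (n + 2)) (y : Simp n) :
    (simpMap i.succAbove y).1 i = 0 := by
  change (stdSimplex.map i.succAbove y : Fin (n + 2) → ℝ) _ = _
  simp only [stdSimplex.map_coe, FunOnFinite.linearMap_apply_apply]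
  exact Finset.sum_eq_zero fun l hl =>
    absurd (Finset.mem_filter.1 hl).2 (Fin.succAbove_ne _ _)

theorem exists_simpMap_succAbove {n : ℕ} {i : Fin (n + 2)} {x : Simp (n + 1)} (h : x.1 i = 0) :
    ∃ y, simpMap i.succAbove y = x := by
  have hs : ∑ j, x.1 (i.succAbove j) = 1 := by
    have := x.2.2
    rw [Fin.sum_univ_succAbove _ i] at this
    rwa [h, zero_add] at this
  refine ⟨⟨fun j => x.1 (i.succAbove j), fun j => x.2.1 _, hs⟩, Subtype.ext (funext fun j => ?_)⟩
  rcases Fin.eq_self_or_eq_succAbove i j with rfl | ⟨k, rfl⟩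
  · exact (simpMap_succAbove_self _ _).trans h.symm
  · exact simpMap_succAbove_apply _ _ _

theorem simpMap_simpMap {l m n : ℕ} (φ : Fin (m + 1) → Fin (n + 1)) (ψ : Fin (l + 1) → Fin (m + 1))
    (x : Simp l) : simpMap φ (simpMap ψ x) = simpMap (φ ∘ ψ) x :=
  (stdSimplex.map_comp_apply ψ φ x)

theorem simpMap_id {n : ℕ} (x : Simp n) : simpMap id x = x := stdSimplex.map_id_apply x

/-- The push of a point of the simplex along the direction of the vertex `k` to the face opposite to
the vertex `i`. It is the identity on that face. -/
def pushToFace {n : ℕ} (k i : Fin (n + 1)) : C(Simp n, Simp n) where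
  toFun x := ⟨fun j => if j = k then 1 - ∑ l ∈ Finset.univ.erase k, (x.1 l - min (x.1 i) (x.1 l))
      else x.1 j - min (x.1 i) (x.1 j), by
    constructor
    · intro j
      dsimp only
      split_ifs
      · have h : ∑ l ∈ Finset.univ.erase k, (x.1 l - min (x.1 i) (x.1 l)) ≤ ∑ l, x.1 l := by
          refine (Finset.sum_le_sum fun l _ => sub_le_self _ (le_min (x.2.1 i) (x.2.1 l))).trans ?_
          exact Finset.sum_le_sum_of_subset_of_nonneg (Finset.erase_subset _ _)
            fun l _ _ => x.2.1 l
        have h1 : ∑ l, x.1 l = 1 := x.2.2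
        linarith
      · exact sub_nonneg.2 (min_le_right _ _)
    · rw [← Finset.add_sum_erase _ _ (Finset.mem_univ k), if_pos rfl,
        Finset.sum_congr rfl fun l hl => if_neg (Finset.ne_of_mem_erase hl)]
      ring⟩
  continuous_toFun := by
    refine Continuous.subtype_mk (continuous_pi fun j => ?_) _
    have hc (l : Fin (n + 1)) : Continuous fun x : Simp n => x.1 l :=
      (continuous_apply l).comp continuous_subtype_val
    by_cases hj : j = k
    · simp only [hj, if_true]
      exact continuous_const.sub (continuous_finsetSum _ fun l _ =>
        (hc l).sub ((hc i).min (hc l)))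
    · simp only [hj, if_false]
      exact (hc j).sub ((hc i).min (hc j))

theorem pushToFace_apply {n : ℕ} {k i j : Fin (n + 1)} (hj : j ≠ k) (x : Simp n) :
    (pushToFace k i x).1 j = x.1 j - min (x.1 i) (x.1 j) := if_neg hj

theorem pushToFace_ext {n : ℕ} {k : Fin (n + 1)} {x y : Simp n} (h : ∀ j, j ≠ k → x.1 j = y.1 j) :
    x = y := by
  refine Subtype.ext (funext fun j => ?_)
  by_cases hj : j = k
  · subst hj
    have hx := x.2.2
    have hy := y.2.2
    rw [← Finset.add_sum_erase _ _ (Finset.mem_univ j)] at hx hy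
    have : ∑ l ∈ Finset.univ.erase j, x.1 l =
        ∑ l ∈ Finset.univ.erase j, y.1 l :=
      Finset.sum_congr rfl fun l hl => h l (Finset.ne_of_mem_erase hl)
    linarith
  · exact h j hj

theorem pushToFace_of_zero {n : ℕ} {k i : Fin (n + 1)} {x : Simp n} (h : x.1 i = 0) :
    pushToFace k i x = x := by
  refine pushToFace_ext (k := k) fun j hj => ?_
  rw [pushToFace_apply hj, h, min_eq_left (x.2.1 j), sub_zero]

theorem pushToFace_congr {n : ℕ} {k i j : Fin (n + 1)} {x : Simp n} (h : x.1 i = x.1 j) :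
    pushToFace k i x = pushToFace k j x := by
  refine pushToFace_ext (k := k) fun l hl => ?_
  rw [pushToFace_apply hl, pushToFace_apply hl, h]

theorem pushToFace_self {n : ℕ} {k i j : Fin (n + 1)} (hj : j ≠ k) {x : Simp n} (h : x.1 i = x.1 j) :
    (pushToFace k i x).1 j = 0 := by
  rw [pushToFace_apply hj, h, min_self, sub_self]

variable {X : Type u} [TopologicalSpace X]

/-- Three maps on the 3-simplex that agree on the intersections of the faces `a`, `b`, `c` can be
replaced by one map. -/
theorem exists_extension_of_faces {k a b c : Fin 4} (ha : a ≠ k) (hb : b ≠ k) (hc : c ≠ k)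
    (G : Fin 4 → C(Simp 3, X))
    (hab : ∀ x : Simp 3, x.1 a = 0 → x.1 b = 0 → G a x = G b x)
    (hac : ∀ x : Simp 3, x.1 a = 0 → x.1 c = 0 → G a x = G c x)
    (hbc : ∀ x : Simp 3, x.1 b = 0 → x.1 c = 0 → G b x = G c x) :
    ∃ s : C(Simp 3, X), ∀ x : Simp 3, (x.1 a = 0 → s x = G a x) ∧ (x.1 b = 0 → s x = G b x) ∧
      (x.1 c = 0 → s x = G c x) := by
  have hcont (l : Fin 4) : Continuous fun x : Simp 3 => x.1 l :=
    (continuous_apply l).comp continuous_subtype_val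
  have key {i j : Fin 4} (hi : i ≠ k) (hj : j ≠ k)
      (hij : ∀ x : Simp 3, x.1 i = 0 → x.1 j = 0 → G i x = G j x) (x : Simp 3) (h : x.1 i = x.1 j) :
      G i (pushToFace k i x) = G j (pushToFace k j x) := by
    rw [← pushToFace_congr h]
    exact hij _ (pushToFace_self hi rfl) (pushToFace_self hj h)
  have hin : Continuous fun x : Simp 3 =>
      if x.1 b ≤ x.1 c then G b (pushToFace k b x) else G c (pushToFace k c x) :=
    Continuous.if_le (by fun_prop) (by fun_prop) (hcont b) (hcont c) (key hb hc hbc)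
  have hout : Continuous fun x : Simp 3 =>
      if x.1 a ≤ min (x.1 b) (x.1 c) then G a (pushToFace k a x) else
        if x.1 b ≤ x.1 c then G b (pushToFace k b x) else G c (pushToFace k c x) := by
    refine Continuous.if_le (by fun_prop) hin (hcont a) ((hcont b).min (hcont c)) fun x h => ?_
    split_ifs with hx
    · rw [min_eq_left hx] at h
      exact key ha hb hab x h
    · rw [min_eq_right (le_of_not_ge hx)] at h
      exact key ha hc hac x h
  refine ⟨⟨_, hout⟩, fun x => ⟨fun h => ?_, fun h => ?_, fun h => ?_⟩⟩
  · have h' : x.1 a ≤ min (x.1 b) (x.1 c) := by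
      rw [h]; exact le_min (x.2.1 b) (x.2.1 c)
    change ite _ _ _ = _
    rw [if_pos h', pushToFace_of_zero h]
  · have h' : x.1 b ≤ x.1 c := by rw [h]; exact x.2.1 c
    change ite _ _ (ite _ _ _) = _
    rw [if_pos h', pushToFace_of_zero h]
    split_ifs with h''
    · have ha0 : x.1 a = 0 := le_antisymm (h''.trans (min_le_left _ _ |>.trans h.le)) (x.2.1 a)
      rw [pushToFace_of_zero ha0]
      exact hab x ha0 h
    · rfl
  · change ite _ _ (ite _ _ _) = _
    split_ifs with h₁ h₂
    · have ha0 : x.1 a = 0 := le_antisymm (h₁.trans (min_le_right _ _ |>.trans h.le)) (x.2.1 a)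
      rw [pushToFace_of_zero ha0]
      exact hac x ha0 h
    · have hb0 : x.1 b = 0 := le_antisymm (h₂.trans h.le) (x.2.1 b)
      rw [pushToFace_of_zero hb0]
      exact hbc x hb0 h
    · rw [pushToFace_of_zero h]

theorem hasHornFillers_sing (X : Type u) [TopologicalSpace X] : HasHornFillers (Sing X) := by
  intro k f hf
  -- The faces as maps on the whole simplex, by means of retractions onto the faces.
  have hr (i : Fin 4) : ∃ r : Fin 4 → Fin 3, ∀ j, r (i.succAbove j) = j :=
    (Fin.succAbove_right_injective (p := i)).hasLeftInverse
  choose r hr using hr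
  let G (i : Fin 4) : C(Simp 3, X) := (simplexMap (f i)).comp (simpMap (r i))
  have hG (i : Fin 4) (y : Simp 2) : G i (simpMap i.succAbove y) = simplexMap (f i) y := by
    change simplexMap (f i) (simpMap (r i) (simpMap i.succAbove y)) = _
    rw [simpMap_simpMap, show r i ∘ i.succAbove = id from funext (hr i), simpMap_id]
  have hlt {i j : Fin 3} (hij : i ≤ j) (hi : i.castSucc ≠ k) (hj : j.succ ≠ k) (x : Simp 3)
      (hxi : x.1 i.castSucc = 0) (hxj : x.1 j.succ = 0) : G i.castSucc x = G j.succ x := by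
    obtain ⟨y, rfl⟩ := exists_simpMap_succAbove hxj
    have hs : (j.succ.succAbove i : Fin 4) = i.castSucc :=
      Fin.succAbove_of_castSucc_lt _ _ (Fin.castSucc_lt_succ_iff.2 hij)
    have hyi : y.1 i = 0 := by
      rw [← simpMap_succAbove_apply j.succ, hs, hxi]
    obtain ⟨z, rfl⟩ := exists_simpMap_succAbove hyi
    have h₁ : simplexMap (f j.succ) (simpMap i.succAbove z) =
        simplexMap (f i.castSucc) (simpMap j.succAbove z) :=
      congrArg (fun s => simplexMap s z) (hf i j hij hi hj)
    rw [hG, h₁, ← hG, simpMap_simpMap, simpMap_simpMap]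
    refine congrArg (fun φ => G i.castSucc (simpMap φ z)) (funext fun l => ?_)
    clear * - hij
    revert i j l
    decide
  have hne {a b : Fin 4} (hab : a < b) (ha : a ≠ k) (hb : b ≠ k) (x : Simp 3) (hxa : x.1 a = 0)
      (hxb : x.1 b = 0) : G a x = G b x := by
    obtain ⟨i, rfl⟩ := Fin.exists_castSucc_eq.2 (Fin.ne_last_of_lt hab)
    obtain ⟨j, rfl⟩ := Fin.exists_succ_eq.2 (Fin.ne_zero_of_lt hab)
    exact hlt (Fin.castSucc_lt_succ_iff.1 hab) ha hb x hxa hxb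
  have hk : ∃ a b c : Fin 4, a < b ∧ b < c ∧ a ≠ k ∧ b ≠ k ∧ c ≠ k ∧
      ∀ i, i ≠ k → i = a ∨ i = b ∨ i = c := by
    clear hne hlt hf
    revert k
    decide
  obtain ⟨a, b, c, hab, hbc, ha, hb, hc, hi⟩ := hk
  obtain ⟨s, hs⟩ := exists_extension_of_faces ha hb hc G (hne hab ha hb) (hne (hab.trans hbc) ha hc)
    (hne hbc hb hc)
  refine ⟨singularSimplex s, fun i hik => ?_⟩
  have hsG (x : Simp 3) (hx : x.1 i = 0) : s x = G i x := by
    rcases hi i hik with rfl | rfl | rfl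
    exacts [(hs x).1 hx, (hs x).2.1 hx, (hs x).2.2 hx]
  rw [δ_singularSimplex, ← singularSimplex_simplexMap (f i)]
  refine congrArg singularSimplex (ContinuousMap.ext fun y => ?_)
  exact (hsG _ (simpMap_succAbove_self i y)).trans (hG i y)

end HornFillers

/-! ### Triangles of paths, and the truncation map -/

section PathEdges

variable {X : Type u} [TopologicalSpace X]

/-- The point of a singular 0-simplex, as a vertex of the singular simplicial set. -/
def ptVertex (x : X) : (Sing X) _⦋0⦌ := singularSimplex (ContinuousMap.const _ x)

theorem exists_ptVertex (s : (Sing X) _⦋0⦌) : ∃ x, ptVertex x = s := by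
  refine ⟨simplexMap s (vtx 0), ?_⟩
  rw [← singularSimplex_simplexMap s]
  refine congrArg singularSimplex (ContinuousMap.ext fun z => ?_)
  change _ = simplexMap s z
  rw [Subsingleton.elim z (vtx 0), simplexMap_singularSimplex]
  rfl

/-- The sum of the barycentric coordinates of a point of a simplex over a set of vertices. -/
def coordSum {n : ℕ} (s : Finset (Fin (n + 1))) : C(Simp n, I) where
  toFun x := ⟨∑ i ∈ s, x.1 i, Finset.sum_nonneg fun i _ => x.2.1 i,
    (Finset.sum_le_sum_of_subset_of_nonneg (Finset.subset_univ s) fun i _ _ => x.2.1 i).trans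
      x.2.2.le⟩
  continuous_toFun := by
    refine Continuous.subtype_mk ?_ _
    exact continuous_finsetSum _ fun i _ => (continuous_apply i).comp continuous_subtype_val

/-- The edge of the singular simplicial set given by a path. -/
def pathEdge {x y : X} (p : Path x y) : (Sing X) _⦋1⦌ :=
  singularSimplex (p.toContinuousMap.comp (coordSum {1}))

theorem δ_one_pathEdge {x y : X} (p : Path x y) : (Sing X).δ 1 (pathEdge p) = ptVertex x := by
  rw [pathEdge, δ_singularSimplex]
  refine congrArg singularSimplex (ContinuousMap.ext fun z => ?_)
  change p (coordSum {1} (simpMap (Fin.succAbove 1) z)) = x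
  have : coordSum {1} (simpMap (Fin.succAbove 1) z) = 0 := Subtype.ext (by
    change ∑ i ∈ {1}, _ = (0 : ℝ)
    rw [Finset.sum_singleton, simpMap_succAbove_self])
  rw [this, p.source]

theorem δ_zero_pathEdge {x y : X} (p : Path x y) : (Sing X).δ 0 (pathEdge p) = ptVertex y := by
  rw [pathEdge, δ_singularSimplex]
  refine congrArg singularSimplex (ContinuousMap.ext fun z => ?_)
  change p (coordSum {1} (simpMap (Fin.succAbove 0) z)) = y
  have : coordSum {1} (simpMap (Fin.succAbove 0) z) = 1 := Subtype.ext (by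
    change ∑ i ∈ {1}, _ = (1 : ℝ)
    rw [Finset.sum_singleton]
    refine (simpMap_succAbove_apply 0 z 0).trans ?_
    simpa using z.2.2)
  rw [this, p.target]

/-- The triangle given by a map from the square: the 2-simplex with corners `(0, 0)`, `(1, 0)`,
`(1, 1)`. -/
def squareTriangle (F : C(I × I, X)) : (Sing X) _⦋2⦌ :=
  singularSimplex (F.comp ((coordSum {1, 2}).prodMk (coordSum {2})))

theorem isTriangle_squareTriangle {F : C(I × I, X)} {x y z : X} {p : Path x y} {q : Path y z}
    {r : Path x z} (hp : ∀ t, F (t, 0) = p t) (hq : ∀ t, F (1, t) = q t) (hr : ∀ t, F (t, t) = r t) :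
    IsTriangle (squareTriangle F) (pathEdge p) (pathEdge q) (pathEdge r) := by
  have h₁ (s : Simp 2) : (coordSum {1, 2} s : ℝ) = s.1 1 + s.1 2 := by
    change ∑ i ∈ ({1, 2} : Finset (Fin 3)), s.1 i = _
    rw [Finset.sum_pair (by decide)]
  have h₂ (s : Simp 2) : (coordSum {2} s : ℝ) = s.1 2 := Finset.sum_singleton _ _
  have h₃ (s : Simp 1) : (coordSum {1} s : ℝ) = s.1 1 := Finset.sum_singleton _ _
  have key (i : Fin 3) (g : C(I, X)) (h : ∀ s : Simp 1,
      F (coordSum {1, 2} (simpMap i.succAbove s), coordSum {2} (simpMap i.succAbove s)) =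
        g (coordSum {1} s)) :
      (Sing X).δ i (squareTriangle F) = singularSimplex (g.comp (coordSum {1})) := by
    rw [squareTriangle, δ_singularSimplex]
    exact congrArg singularSimplex (ContinuousMap.ext h)
  refine ⟨key 2 p.toContinuousMap fun s => ?_, key 0 q.toContinuousMap fun s => ?_,
    key 1 r.toContinuousMap fun s => ?_⟩
  · refine (congrArg F (Prod.ext (Subtype.ext ?_) (Subtype.ext ?_))).trans (hp _)
    · rw [h₁, h₃, simpMap_succAbove_self, add_zero]
      exact simpMap_succAbove_apply 2 s 1
    · exact (h₂ _).trans (simpMap_succAbove_self 2 s)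
  · refine (congrArg F (Prod.ext (Subtype.ext ?_) (Subtype.ext ?_))).trans (hq _)
    · rw [h₁]
      refine (congrArg₂ (· + ·) (simpMap_succAbove_apply 0 s 0) (simpMap_succAbove_apply 0 s 1)).trans
        ?_
      simpa using s.2.2
    · rw [h₂, h₃]
      exact simpMap_succAbove_apply 0 s 1
  · refine (congrArg F (Prod.ext (Subtype.ext ?_) (Subtype.ext ?_))).trans (hr _)
    · rw [h₁, h₃, simpMap_succAbove_self, zero_add]
      exact simpMap_succAbove_apply 1 s 1
    · rw [h₂, h₃]
      exact simpMap_succAbove_apply 1 s 1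

/-- Three paths bound a triangle if one of them is homotopic to the concatenation of the others. The
concatenation itself bounds an explicit triangle, which is adjusted along the homotopy. -/
theorem exists_isTriangle {x y z : X} {p : Path x y} {q : Path y z} {r : Path x z}
    (h : (p.trans q).Homotopic r) :
    ∃ s, IsTriangle s (pathEdge p) (pathEdge q) (pathEdge r) := by
  have hS := hasHornFillers_sing X
  obtain ⟨H⟩ := h
  let d : Path x z :=
    { toFun := fun t => H (t, t)
      continuous_toFun := by fun_prop
      source' := by simp
      target' := by simp }
  -- The two halves of the homotopy, on both sides of its diagonal.
  have hA : IsTriangle (squareTriangle (H.toContinuousMap.comp ContinuousMap.prodSwap))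
      (pathEdge (p.trans q)) (constEdge (ptVertex z)) (pathEdge d) :=
    isTriangle_squareTriangle (q := Path.refl z) (fun t => H.apply_zero t) (fun t => H.target t)
      fun t => rfl
  have hB : IsTriangle (squareTriangle H.toContinuousMap)
      (constEdge (ptVertex x)) (pathEdge r) (pathEdge d) :=
    isTriangle_squareTriangle (p := Path.refl x) (fun t => H.source t) (fun t => H.apply_one t)
      fun t => rfl
  obtain ⟨f, hf, -⟩ := hS.exists_one (isTriangle_σ_one (δ_zero_pathEdge r))
    (isTriangle_σ_zero (δ_one_pathEdge r)) hB
  obtain ⟨g, hg, -⟩ := hS.exists_two (isTriangle_const (ptVertex z)) hf hA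
  let F : C(I × I, X) := (p.trans q).toContinuousMap.comp
    ⟨fun t => ⟨((t.1 : ℝ) + t.2) / 2, by
      have := t.1.2.1; have := t.1.2.2; have := t.2.2.1; have := t.2.2.2
      constructor <;> linarith⟩, by
      refine Continuous.subtype_mk ?_ _
      fun_prop⟩
  have hF : IsTriangle (squareTriangle F) (pathEdge p) (pathEdge q) (pathEdge (p.trans q)) := by
    refine isTriangle_squareTriangle (fun t => ?_) (fun t => ?_) fun t => ?_
    · change (p.trans q) ⟨((t : ℝ) + 0) / 2, _⟩ = p t
      rw [Path.trans_apply]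
      have ht : ((t : ℝ) + 0) / 2 ≤ 1 / 2 := by have := t.2.2; linarith
      rw [dif_pos ht]
      exact congrArg p (Subtype.ext (by change 2 * (((t : ℝ) + 0) / 2) = t; ring))
    · change (p.trans q) ⟨((1 : ℝ) + t) / 2, _⟩ = q t
      rw [Path.trans_apply]
      split_ifs with ht
      · change ((1 : ℝ) + t) / 2 ≤ 1 / 2 at ht
        have ht0 : t = 0 := Subtype.ext (le_antisymm (by change (t : ℝ) ≤ 0; linarith) t.2.1)
        subst ht0
        rw [q.source]
        exact (congrArg p (Subtype.ext (by
          change 2 * (((1 : ℝ) + (0 : ℝ)) / 2) = 1; norm_num))).trans p.target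
      · exact congrArg q (Subtype.ext (by change 2 * (((1 : ℝ) + t) / 2) - 1 = t; ring))
    · exact congrArg (p.trans q) (Subtype.ext (by change ((t : ℝ) + t) / 2 = t; ring))
  obtain ⟨s, hs, -⟩ := hS.exists_two (isTriangle_σ_one (δ_zero_pathEdge q)) hg hF
  exact ⟨s, hs⟩

end PathEdges

section Truncation

variable {X : Type u} [TopologicalSpace X]

theorem exists_pathEdge (s : (Sing X) _⦋1⦌) : ∃ (x y : X) (p : Path x y), pathEdge p = s := by
  refine ⟨_, _, edge (simplexMap s) 0 1, ?_⟩
  conv_rhs => rw [← singularSimplex_simplexMap s]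
  refine congrArg singularSimplex (ContinuousMap.ext fun z => ?_)
  refine congrArg (simplexMap s) (Subtype.ext (funext fun j => ?_))
  change (1 - ∑ i ∈ {1}, z.1 i) * (vtx (n := 1) 0).1 j + (∑ i ∈ {1}, z.1 i) * (vtx 1).1 j = z.1 j
  have hz : z.1 0 + z.1 1 = 1 := by simpa using z.2.2
  rw [Finset.sum_singleton, ← hz]
  fin_cases j <;> simp

theorem truncation_pathEdge {x y : X} (p : Path x y) :
    (truncation X).app (op ⦋1⦌) (pathEdge p) = ComposableArrows.mk₁ (cls p) := by
  let g : C(Simp 1, X) := p.toContinuousMap.comp (coordSum {1})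
  have h (i : Fin 2) : coordSum {1} (vtx (n := 1) i) = if i = 1 then 1 else 0 := by
    refine Subtype.ext ?_
    change ∑ j ∈ {1}, (vtx (n := 1) i).1 j = _
    rw [Finset.sum_singleton]
    fin_cases i <;> simp
  have h0 : g (vtx 0) = x := (congrArg p (h 0)).trans p.source
  have h1 : g (vtx 1) = y := (congrArg p (h 1)).trans p.target
  have hu : LiftsTo g (segPath (vtx 0) (vtx 1)) p := fun t => by
    refine congrArg p (Subtype.ext ?_)
    change ∑ j ∈ {1}, ((1 - (t : ℝ)) * (vtx (n := 1) 0).1 j + t * (vtx (n := 1) 1).1 j) = t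
    rw [Finset.sum_singleton]
    simp
  have key {x y : X} {p : Path x y} (h0 : g (vtx 0) = x) (h1 : g (vtx 1) = y)
      (hu : LiftsTo g (segPath (vtx 0) (vtx 1)) p) :
      (truncation X).app (op ⦋1⦌) (singularSimplex g) = ComposableArrows.mk₁ (cls p) := by
    subst h0 h1
    obtain rfl : p = edge g 0 1 := by ext t; exact (hu t).symm
    refine ComposableArrows.ext₁ rfl rfl
      (Eq.trans ?_ ((Category.id_comp _).trans (Category.comp_id _)).symm)
    have e : (vertexFunctor 1).map (homOfLE (Fin.zero_le 1) : (0 : Fin 2) ⟶ 1) =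
        cls (segPath (vtx 0) (vtx 1)) :=
      Subsingleton.elim (α := Path.Homotopic.Quotient (vtx (n := 1) 0) (vtx 1)) _ _
    exact congrArg (FundamentalGroupoid.map g).map e
  exact key h0 h1 hu

theorem mk₁_injective {C : Type*} [Category C] {x y x' y' : C} {f : x ⟶ y} {f' : x' ⟶ y'}
    (h : ComposableArrows.mk₁ f = ComposableArrows.mk₁ f') : Arrow.mk f = Arrow.mk f' :=
  congrArg ComposableArrows.arrowEquiv h

theorem nerve_triangle_ext {C : Type u} [Category.{v} C] {a b : (nerve C) _⦋2⦌}
    (h : ∀ i, (nerve C).δ i a = (nerve C).δ i b) : a = b := by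
  obtain ⟨x₀, x₁, x₂, f, g, rfl⟩ := ComposableArrows.mk₂_surjective a
  obtain ⟨y₀, y₁, y₂, f', g', rfl⟩ := ComposableArrows.mk₂_surjective b
  refine ComposableArrows.ext₂_of_arrow ?_ ?_
  · have := h 2
    rw [nerve.δ₂_mk₂_eq, nerve.δ₂_mk₂_eq] at this
    exact mk₁_injective this
  · have := h 0
    rw [nerve.δ₀_mk₂_eq, nerve.δ₀_mk₂_eq] at this
    exact mk₁_injective this

/-- Vertices of both simplicial sets are points, edges of the nerve are homotopy classes of paths,
and a triangle of the nerve is a relation between homotopy classes. -/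
theorem isTruncating_truncation (X : Type u) [TopologicalSpace X] :
    IsTruncating (truncation X) where
  bijective_vertex := by
    have h (x : X) : (truncation X).app (op ⦋0⦌) (ptVertex x) =
        ComposableArrows.mk₀ (FundamentalGroupoid.mk x) := ComposableArrows.ext₀ rfl
    constructor
    · intro s s' hs
      obtain ⟨x, rfl⟩ := exists_ptVertex s
      obtain ⟨y, rfl⟩ := exists_ptVertex s'
      rw [h, h] at hs
      have : FundamentalGroupoid.mk x = FundamentalGroupoid.mk y :=
        congrArg (fun a : ComposableArrows (FundamentalGroupoid X) 0 => a.obj 0) hs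
      exact congrArg (fun a => ptVertex (FundamentalGroupoid.as a)) this
    · intro a
      obtain ⟨⟨x⟩, rfl⟩ := ComposableArrows.mk₀_surjective a
      exact ⟨ptVertex x, h x⟩
  surjective_edge a := by
    obtain ⟨⟨x⟩, ⟨y⟩, f, rfl⟩ := ComposableArrows.mk₁_surjective a
    induction f using Path.Homotopic.Quotient.ind with | mk p =>
    exact ⟨pathEdge p, truncation_pathEdge p⟩
  triangle_ext _ _ h := nerve_triangle_ext h
  exists_triangle a u v w hu hv hw := by
    obtain ⟨⟨x⟩, ⟨y⟩, ⟨z⟩, f, g, rfl⟩ := ComposableArrows.mk₂_surjective a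
    rw [nerve.δ₂_mk₂_eq] at hu
    rw [nerve.δ₀_mk₂_eq] at hv
    rw [nerve.δ₁_mk₂_eq] at hw
    have key {x y : X} (s : (Sing X) _⦋1⦌) (f : FundamentalGroupoid.mk x ⟶ FundamentalGroupoid.mk y)
        (hs : (truncation X).app (op ⦋1⦌) s = ComposableArrows.mk₁ f) :
        ∃ p : Path x y, pathEdge p = s ∧ cls p = f := by
      obtain ⟨x', y', p, rfl⟩ := exists_pathEdge s
      rw [truncation_pathEdge] at hs
      have h := mk₁_injective hs
      obtain rfl : x' = x := congrArg (fun a => (Arrow.leftFunc.obj a).as) h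
      obtain rfl : y' = y := congrArg (fun a => (Arrow.rightFunc.obj a).as) h
      exact ⟨p, rfl, Arrow.mk_inj _ _ |>.1 h⟩
    obtain ⟨p, rfl, hp⟩ := key u f hu
    obtain ⟨q, rfl, hq⟩ := key v g hv
    obtain ⟨r, rfl, hr⟩ := key w (f ≫ g) hw
    exact exists_isTriangle (cls_eq_iff.1 (by rw [cls_trans, hp, hq, hr]))

end Truncation

/-! ### Exactness of the Hurewicz sequence -/

section Exactness

variable {X : Type u} [TopologicalSpace X]

/-- The 2-chains that are sums of boundaries and of squares of 2-dimensional loops at `x`. -/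
def sphericalChains (x : X) : AddSubgroup (Chain (Sing X) 2) :=
  (bdry (Sing X) 2).range ⊔
    AddSubgroup.closure (Set.range fun f : GenLoop (Fin 2) X x => squareElt f.1)

theorem affineSimplex_three (v : Fin 3 → Fin 2 → I) (t : Simp 2) (j : Fin 2) :
    (affineSimplex v t j : ℝ) = t.1 0 * v 0 j + t.1 1 * v 1 j + t.1 2 * v 2 j :=
  Fin.sum_univ_three fun i => t.1 i * (v i j : ℝ)

/-- A 2-simplex with constant boundary is the lower triangle of a 2-dimensional loop, whose upper
triangle is constant. -/
theorem exists_genLoop {x : X} {g : (Sing X) _⦋2⦌} (hg : IsTriangle g (constEdge (ptVertex x))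
    (constEdge (ptVertex x)) (constEdge (ptVertex x))) :
    ∃ f : GenLoop (Fin 2) X x, squareElt f.1 = chainGen g - chainGen (constTriangle (ptVertex x)) := by
  -- The square is mapped to the simplex by collapsing its upper triangle to the long edge.
  let c : C(Fin 2 → I, Simp 2) :=
    ⟨fun p => ⟨![1 - max (p 0 : ℝ) (p 1), max (p 0 : ℝ) (p 1) - p 1, p 1], by
      constructor
      · intro i
        fin_cases i
        · exact sub_nonneg.2 (max_le (p 0).2.2 (p 1).2.2)
        · exact sub_nonneg.2 (le_max_right _ _)
        · exact (p 1).2.1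
      · rw [Fin.sum_univ_three]
        simp⟩, by
      refine Continuous.subtype_mk (continuous_pi fun i => ?_) _
      fin_cases i
      · change Continuous fun p : Fin 2 → I => 1 - max (p 0 : ℝ) (p 1)
        fun_prop
      · change Continuous fun p : Fin 2 → I => max (p 0 : ℝ) (p 1) - p 1
        fun_prop
      · change Continuous fun p : Fin 2 → I => (p 1 : ℝ)
        fun_prop⟩
  have hface (i : Fin 3) (s : Simp 2) (hs : s.1 i = 0) : simplexMap g s = x := by
    obtain ⟨y, rfl⟩ := exists_simpMap_succAbove hs
    have h (i : Fin 3) : (Sing X).δ i g = constEdge (ptVertex x) := by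
      fin_cases i
      exacts [hg.δ_zero, hg.δ_one, hg.δ_two]
    exact congrArg (fun s => simplexMap s y) (h i)
  let f : GenLoop (Fin 2) X x := ⟨(simplexMap g).comp c, by
    rintro p ⟨j, hj⟩
    have h0 : (c p).1 0 = 1 - max (p 0 : ℝ) (p 1) := rfl
    have h1 : (c p).1 1 = max (p 0 : ℝ) (p 1) - p 1 := rfl
    have h2 : (c p).1 2 = p 1 := rfl
    have hp0 := (p 0).2
    have hp1 := (p 1).2
    fin_cases j
    · rcases hj with hj | hj
      · change p 0 = 0 at hj
        refine hface 1 _ ?_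
        rw [h1, hj]
        exact sub_eq_zero.2 (max_eq_right hp1.1)
      · change p 0 = 1 at hj
        refine hface 0 _ ?_
        rw [h0, hj]
        exact sub_eq_zero.2 (max_eq_left hp1.2).symm
    · rcases hj with hj | hj
      · change p 1 = 0 at hj
        refine hface 2 _ ?_
        rw [h2, hj]
        rfl
      · change p 1 = 1 at hj
        refine hface 0 _ ?_
        rw [h0, hj]
        exact sub_eq_zero.2 (max_eq_right hp0.2).symm⟩
  refine ⟨f, ?_⟩
  rw [squareElt_eq]
  congr 2
  · conv_rhs => rw [← singularSimplex_simplexMap g]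
    refine congrArg singularSimplex (ContinuousMap.ext fun s => ?_)
    refine congrArg (simplexMap g) (Subtype.ext ?_)
    have hs : s.1 0 + s.1 1 + s.1 2 = 1 := by
      rw [← Fin.sum_univ_three]
      exact s.2.2
    have e0 : ((affineSimplex ![![0, 0], ![1, 0], ![1, 1]] s : Fin 2 → I) 0 : ℝ) =
        s.1 1 + s.1 2 := by
      refine (affineSimplex_three _ s _).trans ?_
      simp
    have e1 : ((affineSimplex ![![0, 0], ![1, 0], ![1, 1]] s : Fin 2 → I) 1 : ℝ) = s.1 2 := by
      refine (affineSimplex_three _ s _).trans ?_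
      simp
    have hmax : max (s.1 1 + s.1 2) (s.1 2) = s.1 1 + s.1 2 :=
      max_eq_left (le_add_of_nonneg_left (s.2.1 1))
    funext i
    fin_cases i
    · change 1 - max _ _ = s.1 0
      rw [e0, e1, hmax]
      linarith
    · change max _ _ - _ = s.1 1
      rw [e0, e1, hmax]
      ring
    · exact e1
  · change _ = singularSimplex (ContinuousMap.const _ x)
    refine congrArg singularSimplex (ContinuousMap.ext fun s => hface 1 _ ?_)
    have e0 : ((affineSimplex ![![0, 0], ![0, 1], ![1, 1]] s : Fin 2 → I) 0 : ℝ) = s.1 2 := by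
      refine (affineSimplex_three _ s _).trans ?_
      simp
    have e1 : ((affineSimplex ![![0, 0], ![0, 1], ![1, 1]] s : Fin 2 → I) 1 : ℝ) =
        s.1 1 + s.1 2 := by
      refine (affineSimplex_three _ s _).trans ?_
      simp
    change max _ _ - _ = (0 : ℝ)
    rw [e0, e1, max_eq_right (le_add_of_nonneg_left (s.2.1 1)), sub_self]

theorem containsSpheres_sphericalChains (x : X) :
    ContainsSpheres (ptVertex x) (sphericalChains x) where
  bdry_mem c := AddSubgroup.mem_sup_left ⟨c, rfl⟩
  sphere_mem g hg := by
    obtain ⟨f, hf⟩ := exists_genLoop hg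
    rw [← hf]
    exact AddSubgroup.mem_sup_right (AddSubgroup.subset_closure ⟨f, rfl⟩)

theorem homologyClass_mem_range_hurewicz {x : X} (z : (bdry (Sing X) 1).ker)
    (hz : z.1 ∈ sphericalChains x) : homologyClass (Sing X) z ∈ (hurewicz X x).range := by
  obtain ⟨z, hz'⟩ := z
  obtain ⟨_, ⟨c, rfl⟩, q, hq, rfl⟩ := AddSubgroup.mem_sup.1 hz
  have key : AddSubgroup.closure (Set.range fun f : GenLoop (Fin 2) X x => squareElt f.1) ≤
      ((hurewicz X x).range.comap (homologyClass (Sing X))).map (AddSubgroup.subtype _) := by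
    rw [AddSubgroup.closure_le]
    rintro _ ⟨f, rfl⟩
    exact ⟨⟨squareElt f.1, bdry_squareElt f⟩,
      ⟨Additive.ofMul ⟦f⟧, hurewicz_mk f (bdry_squareElt f)⟩, rfl⟩
  obtain ⟨⟨q, h⟩, hmem, rfl⟩ := key hq
  have hc : bdry (Sing X) 1 (bdry (Sing X) 2 c) = 0 := bdry_bdry c
  have e : homologyClass (Sing X) ⟨bdry (Sing X) 2 c + q, hz'⟩ =
      homologyClass (Sing X) ⟨bdry (Sing X) 2 c, hc⟩ + homologyClass (Sing X) ⟨q, h⟩ :=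
    map_add (homologyClass (Sing X)) ⟨bdry (Sing X) 2 c, hc⟩ ⟨q, h⟩
  refine e.symm ▸ ?_
  rw [(homologyClass_eq_zero ⟨bdry (Sing X) 2 c, hc⟩).2 ⟨c, rfl⟩, zero_add]
  exact hmem

theorem truncationH2_hurewicz {x : X} (a : Additive (HomotopyGroup.Pi 2 X x)) :
    truncationH2 X (hurewicz X x a) = 0 := by
  induction a using Additive.rec with | _ a
  induction a using Quotient.inductionOn with | _ f
  rw [hurewicz_mk f (bdry_squareElt f)]
  refine (homologyMap_class (truncation X) _).trans ?_
  refine (homologyClass_eq_zero _).2 ⟨0, (map_zero _).trans (Eq.symm ?_)⟩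
  change chainMap (truncation X) 2 (squareElt f.1) = 0
  rw [squareElt_eq, map_sub, chainMap_gen, chainMap_gen, sub_eq_zero]
  -- The two triangles of the square have the same edges.
  refine congrArg chainGen (nerve_triangle_ext fun i => ?_)
  rw [← SSet.δ_naturality_apply, ← SSet.δ_naturality_apply, δ_singularSimplex, δ_singularSimplex,
    ContinuousMap.comp_assoc, ContinuousMap.comp_assoc, affineSimplex_comp_map,
    affineSimplex_comp_map]
  have h (v : Fin 2 → Fin 2 → I) (hv : ∃ j, v 0 j = v 1 j ∧ (v 0 j = 0 ∨ v 0 j = 1)) :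
      f.1.comp (affineSimplex v) = ContinuousMap.const _ x := by
    refine ContinuousMap.ext fun t => f.2 _ ?_
    obtain ⟨j, hj, hj'⟩ := hv
    have e : affineSimplex v t j = v 0 j := Subtype.ext (by
      change ∑ i, t.1 i * (v i j : ℝ) = v 0 j
      have ht : t.1 0 + t.1 1 = 1 := by simpa using t.2.2
      rw [Fin.sum_univ_two, ← hj, ← add_mul, ht, one_mul])
    exact ⟨j, e ▸ hj'⟩
  refine congrArg (fun g => (truncation X).app _ (singularSimplex g)) ?_
  fin_cases i
  · exact (h _ ⟨0, rfl, .inr rfl⟩).trans (h _ ⟨1, rfl, .inr rfl⟩).symm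
  · refine congrArg (fun v => f.1.comp (affineSimplex v)) (funext fun j => ?_)
    fin_cases j <;> rfl
  · exact (h _ ⟨1, rfl, .inl rfl⟩).trans (h _ ⟨0, rfl, .inl rfl⟩).symm

/-- The Hurewicz sequence in degree two of a path-connected space is exact, apart from the
injectivity of the Hurewicz homomorphism. -/
theorem exact_hurewicz [PathConnectedSpace X] (x : X) :
    Function.Exact (hurewicz X x) (truncationH2 X) := by
  intro a
  constructor
  · intro ha
    obtain ⟨z, rfl⟩ := homologyClass_surjective (Sing X) a
    refine homologyClass_mem_range_hurewicz z ?_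
    refine (isTruncating_truncation X).mem_of_homologyMap_eq_zero
      (containsSpheres_sphericalChains x) (hasHornFillers_sing X) (fun y => ?_) z ha
    obtain ⟨y, rfl⟩ := exists_ptVertex y
    exact ⟨pathEdge (PathConnectedSpace.somePath x y), δ_one_pathEdge _, δ_zero_pathEdge _⟩
  · rintro ⟨b, rfl⟩
    exact truncationH2_hurewicz b

theorem truncationH2_surjective (X : Type u) [TopologicalSpace X] :
    Function.Surjective (truncationH2 X) :=
  (isTruncating_truncation X).surjective_homologyMap

end Exactness

/-! ### Equivalent groupoids have nerves with the same homology -/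

section Nerve

open MonoidalCategory

variable {C D : Type u} [Category.{u} C] [Category.{u} D]

/-- The homotopy between the maps of nerves of two functors that is given by a natural
transformation. A simplex of the cylinder is a chain of arrows together with a monotone map to
`{0, 1}`, which says at which vertices the first functor is applied, and at which the second. -/
def nerveHomotopy {F G : C ⥤ D} (α : F ⟶ G) : SSet.Homotopy (nerveMap F) (nerveMap G) where
  h :=
    { app n := ↾fun z => (Functor.prod' (SSet.stdSimplex.objEquiv z.2).toOrderHom.monotone.functor
        (z.1 : Fin (n.unop.len + 1) ⥤ C)) ⋙ Functor.uncurry.obj (ComposableArrows.mk₁ α)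
      naturality _ _ _ := rfl }
  h₀ := by
    ext n z
    exact CategoryTheory.Functor.ext (fun _ => rfl) fun i j f => by
      change (𝟙 _ : _ ⟶ _) ≫ F.map _ = 𝟙 _ ≫ F.map _ ≫ 𝟙 _
      rw [Category.id_comp, Category.comp_id, Category.id_comp]
      rfl
  h₁ := by
    ext n z
    exact CategoryTheory.Functor.ext (fun _ => rfl) fun i j f => by
      change (𝟙 _ : _ ⟶ _) ≫ G.map _ = 𝟙 _ ≫ G.map _ ≫ 𝟙 _
      rw [Category.id_comp, Category.comp_id, Category.id_comp]
      rfl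
  rel := by
    ext n z
    exact z.1.2.elim

/-- The map induced on second homology of nerves by a functor. -/
def nerveH2Map (F : C ⥤ D) : H2 (nerve C) →+ H2 (nerve D) :=
  (SSet.homologyMap (nerveMap F) integers.{u} 2).hom

theorem nerveH2Map_congr {F G : C ⥤ D} (α : F ⟶ G) : nerveH2Map F = nerveH2Map G :=
  congrArg AddCommGrpCat.Hom.hom ((nerveHomotopy α).congr_homologyMap integers.{u} 2)

theorem nerveH2Map_id : nerveH2Map (𝟭 C) = AddMonoidHom.id _ :=
  congrArg AddCommGrpCat.Hom.hom (SSet.homologyMap_id (nerve C) integers.{u} 2)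

theorem nerveH2Map_comp {E : Type u} [Category.{u} E] (F : C ⥤ D) (G : D ⥤ E) :
    nerveH2Map (F ⋙ G) = (nerveH2Map G).comp (nerveH2Map F) :=
  congrArg AddCommGrpCat.Hom.hom
    (SSet.homologyMap_comp (f := nerveMap F) (g := nerveMap G) (R := integers.{u}) (n := 2))

theorem nerveH2Map_bijective (F : C ⥤ D) [F.IsEquivalence] :
    Function.Bijective (nerveH2Map F) := by
  refine Function.bijective_iff_has_inverse.2 ⟨nerveH2Map F.inv, fun a => ?_, fun a => ?_⟩
  · refine (DFunLike.congr_fun (nerveH2Map_comp F F.inv) a).symm.trans ?_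
    rw [← nerveH2Map_congr (F := 𝟭 C) (G := F ⋙ F.inv) F.asEquivalence.unit, nerveH2Map_id]
    rfl
  · refine (DFunLike.congr_fun (nerveH2Map_comp F.inv F) a).symm.trans ?_
    rw [nerveH2Map_congr (F := F.inv ⋙ F) (G := 𝟭 D) F.asEquivalence.counit, nerveH2Map_id]
    rfl

end Nerve

/-! ### Other models of the 1-truncation -/

section OneTruncation

variable {X K : Type u} [TopologicalSpace X] [TopologicalSpace K]

theorem fundamentalGroupoid_map_isEquivalence [PathConnectedSpace X] [PathConnectedSpace K]
    {τ : C(X, K)} (hτ : ∀ x, Function.Bijective (homotopyGroupMap 1 τ x)) :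
    (FundamentalGroupoid.map τ).IsEquivalence where
  faithful := ⟨fun {x y} f g hfg => by
    have h := (mapPiOne_bijective (hτ x.as)).1
    have e : (⟨f ≫ inv g⟩ : PiOne x.as) = ⟨𝟙 x⟩ := h (PiOne.ext (by
      change (FundamentalGroupoid.map τ).map (f ≫ inv g) = (FundamentalGroupoid.map τ).map (𝟙 x)
      rw [Functor.map_comp, hfg, ← Functor.map_comp, IsIso.hom_inv_id]))
    have e' : f ≫ inv g = 𝟙 x := congrArg PiOne.hom e
    rwa [IsIso.comp_inv_eq, Category.id_comp] at e'⟩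
  full := ⟨fun {x y} g => by
    obtain ⟨p⟩ : Nonempty (x ⟶ y) :=
      ⟨Path.Homotopic.Quotient.mk (PathConnectedSpace.somePath x.as y.as)⟩
    let q : (FundamentalGroupoid.map τ).obj x ⟶ (FundamentalGroupoid.map τ).obj x :=
      g ≫ inv ((FundamentalGroupoid.map τ).map p)
    obtain ⟨a, ha⟩ := (mapPiOne_bijective (hτ x.as)).2 ⟨q⟩
    have e : (FundamentalGroupoid.map τ).map a.hom = q := congrArg PiOne.hom ha
    refine ⟨a.hom ≫ p, ?_⟩
    rw [Functor.map_comp, e, Category.assoc, IsIso.inv_hom_id, Category.comp_id]⟩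
  essSurj := ⟨fun y => by
    let x : FundamentalGroupoid X := ⟨Nonempty.some inferInstance⟩
    let p : (FundamentalGroupoid.map τ).obj x ⟶ y :=
      Path.Homotopic.Quotient.mk (PathConnectedSpace.somePath _ _)
    exact ⟨x, ⟨asIso p⟩⟩⟩

theorem truncation_naturality (τ : C(X, K)) :
    TopCat.toSSet.map (TopCat.ofHom τ) ≫ truncation K =
      truncation X ≫ nerveMap (FundamentalGroupoid.map τ) := by
  ext n s
  change vertexFunctor _ ⋙ FundamentalGroupoid.map (τ.comp ((TopCat.of X).toSSetObjEquiv n s)) =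
    (vertexFunctor _ ⋙ FundamentalGroupoid.map ((TopCat.of X).toSSetObjEquiv n s)) ⋙
      FundamentalGroupoid.map τ
  rw [FundamentalGroupoid.map_comp, Functor.assoc]

theorem truncationH2_singularH2Map (τ : C(X, K)) (a : singularH2 X) :
    truncationH2 K (singularH2Map τ a) =
      nerveH2Map (FundamentalGroupoid.map τ) (truncationH2 X a) := by
  have h := congrArg (fun f => SSet.homologyMap f integers.{u} 2) (truncation_naturality τ)
  simp only [SSet.homologyMap_comp] at h
  exact congrArg (fun f => f.hom a) h

/-- If the second homotopy group is trivial, then so is the kernel of the truncation, which is the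
image of the Hurewicz homomorphism. -/
theorem truncationH2_bijective [PathConnectedSpace K] (y : K)
    [Subsingleton (HomotopyGroup.Pi 2 K y)] : Function.Bijective (truncationH2 K) := by
  refine ⟨(injective_iff_map_eq_zero _).2 fun a ha => ?_, truncationH2_surjective K⟩
  obtain ⟨b, rfl⟩ := (exact_hurewicz y a).1 ha
  have : b = 0 := Subsingleton.elim (α := HomotopyGroup.Pi 2 K y) _ _
  rw [this, map_zero]

/-- A 1-truncation with any target induces the same map on second homology as the truncation to the
nerve of the fundamental groupoid, up to an isomorphism of the targets. -/
theorem exists_addEquiv_singularH2Map [PathConnectedSpace X] {τ : C(X, K)}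
    (hτ : IsOneTruncation τ) :
    ∃ φ : H2 (nerve (FundamentalGroupoid X)) ≃+ singularH2 K,
      singularH2Map τ = φ.toAddMonoidHom.comp (truncationH2 X) := by
  have : PathConnectedSpace K :=
    (pathConnectedSpace_iff_of_bijective hτ.bijective_zeroth).1 inferInstance
  let y : K := Nonempty.some inferInstance
  have : Subsingleton (HomotopyGroup.Pi 2 K y) := hτ.subsingleton_pi 2 y le_rfl
  have := fundamentalGroupoid_map_isEquivalence hτ.bijective_pi_one
  let e₁ := AddEquiv.ofBijective _ (nerveH2Map_bijective (FundamentalGroupoid.map τ))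
  let e₂ := AddEquiv.ofBijective _ (truncationH2_bijective y)
  refine ⟨e₁.trans e₂.symm, AddMonoidHom.ext fun a => ?_⟩
  exact (e₂.eq_symm_apply).2 (truncationH2_singularH2Map τ a)

end OneTruncation

/-! ### Splitting -/

section Splitting

variable {A B C D : Type*} [AddCommGroup A] [AddCommGroup B] [AddCommGroup C] [AddCommGroup D]

theorem isSplitShortExact_of_leftInverse {f : A →+ B} {g : B →+ C} {r : B →+ A}
    (hr : ∀ a, r (f a) = a) (hfg : Function.Exact f g) (hg : Function.Surjective g) :
    IsSplitShortExact f g := by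
  refine ⟨Function.LeftInverse.injective hr, hfg, hg, ?_⟩
  -- The idempotent `b ↦ b - f (r b)` factors through `g`.
  have key (b b' : B) (h : g b = g b') : b - f (r b) = b' - f (r b') := by
    obtain ⟨a, ha⟩ := (hfg (b - b')).1 (by rw [map_sub, h, sub_self])
    have h' : f (r (b - b')) = b - b' := by rw [← ha, hr]
    rw [map_sub, map_sub] at h'
    rw [sub_eq_sub_iff_sub_eq_sub, h']
  have hfr (b : B) : g (b - f (r b)) = g b := by
    rw [map_sub, (hfg (f (r b))).2 ⟨_, rfl⟩, sub_zero]
  let s : C → B := fun c => Function.surjInv hg c - f (r (Function.surjInv hg c))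
  have hs (b : B) : s (g b) = b - f (r b) := key _ _ (Function.surjInv_eq hg _)
  refine ⟨AddMonoidHom.mk' s fun c c' => ?_, AddMonoidHom.ext fun c => ?_⟩
  · obtain ⟨b, rfl⟩ := hg c
    obtain ⟨b', rfl⟩ := hg c'
    rw [← map_add, hs, hs, hs, map_add, map_add]
    abel
  · exact (hfr _).trans (Function.surjInv_eq hg c)

theorem IsSplitShortExact.comp_addEquiv {f : A →+ B} {g : B →+ C} (h : IsSplitShortExact f g)
    (φ : C ≃+ D) : IsSplitShortExact f (φ.toAddMonoidHom.comp g) where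
  injective := h.injective
  exact b := by
    refine Iff.trans ?_ (h.exact b)
    exact map_eq_zero_iff φ φ.injective
  surjective := φ.surjective.comp h.surjective
  split := by
    obtain ⟨s, hs⟩ := h.split
    refine ⟨s.comp φ.symm.toAddMonoidHom, AddMonoidHom.ext fun c => ?_⟩
    exact (congrArg φ (DFunLike.congr_fun hs (φ.symm c))).trans (φ.apply_symm_apply c)

end Splitting

end

end LoopHurewicz

theorem mainTheorem2 {X : Type u} [TopologicalSpace X] [PathConnectedSpace X]
    (hX : LoopHurewicz.IsDoubleLoopSpace.{u, v} X) (x : X) :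
    LoopHurewicz.IsSplitShortExact (LoopHurewicz.hurewicz X x) (LoopHurewicz.truncationH2 X) ∧
      ∀ (K : Type u) [TopologicalSpace K] (τ : C(X, K)), LoopHurewicz.IsOneTruncation τ →
        LoopHurewicz.IsSplitShortExact (LoopHurewicz.hurewicz X x)
          (LoopHurewicz.singularH2Map τ) := by
  obtain ⟨r, hr⟩ := LoopHurewicz.exists_leftInverse_hurewicz hX x
  have h := LoopHurewicz.isSplitShortExact_of_leftInverse hr (LoopHurewicz.exact_hurewicz x)
    (LoopHurewicz.truncationH2_surjective X)
  refine ⟨h, fun K _ τ hτ => ?_⟩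
  obtain ⟨φ, hφ⟩ := LoopHurewicz.exists_addEquiv_singularH2Map hτ
  rw [hφ]
  exact h.comp_addEquiv φ
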